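/- Let $(\overline M,J,\overline g)$ be a locally conformal Kähler manifold: an almost Hermitian manifold such that each point has an open neighbourhood $U$ and a positive smooth function $f_U$ on $U$ for which $\exp(-f_U)\,\overline g_{|U}$ is a Kähler metric. Let $\Omega(X,Y)=\overline g(X,JY)$ be its Kähler form, $\omega$ its Lee form (a closed 1-form with $d\Omega=\omega\wedge\Omega$), and $B=\omega^\sharp$ its Lee vector field. Let $M$ be an (immersed) CR-submanifold of $\overline M$: $TM=D\oplus D^\perp$ orthogonally, where $D$ is a smooth distribution with $JD=D$ and $JD^\perp\subset TM^\perp$. Let $\mu$ be the orthogonal complement of $JD^\perp$ in the normal bundle $TM^\perp$, and let $\overline\nabla$ be the Levi-Civita connection of $\overline g$. The second fundamental form $h$, the shape operator $a_N$ and the normal connection $\nabla^\perp$ of $M$ are given by $h(X,Y)=(\overline\nabla_XY)^{\rm nor}$ and $\overline\nabla_XN=-a_NX+\nabla^\perp_XN$. Call $M$ a \emph{totally real ruled} CR-submanifold if $D^\perp$ is tangent to a foliation of $M$ whose leaves are totally geodesic immersed submanifolds of $(\overline M,\overline g)$. Suppose that $B\in\Gamma(JD^\perp)$ along $M$. Then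 the following assertions are equivalent: (i) $M$ is a totally real ruled CR-submanifold. (ii) $M$ is $D^\perp$-geodesic, i.e. $h(X,Z)=0$ for all $X,Z\in\Gamma(D^\perp)$, and $h(X,Y)\in\Gamma(\mu)$ for all $X\in\Gamma(D^\perp)$, $Y\in\Gamma(D)$. (iii) $JD^\perp$ is $D^\perp$-parallel, i.e. $\nabla^\perp_XJZ\in\Gamma(JD^\perp)$ for all $X,Z\in\Gamma(D^\perp)$, and $h(X,Y)\in\Gamma(\mu)$ for all $X\in\Gamma(D^\perp)$, $Y\in\Gamma(TM)$. (iv) $a_{JZ}X=0$ for all $X,Z\in\Gamma(D^\perp)$, and $a_NX\in\Gamma(D)$ for all $X\in\Gamma(D^\perp)$, $N\in\Gamma(\mu)$. -/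

import Mathlib

open Bundle
open scoped Manifold ContDiff

noncomputable section

namespace CRLCK

universe u

section VectorFields

variable {E : Type*} [NormedAddCommGroup E] [NormedSpace ℝ E]
  {M : Type*} [TopologicalSpace M] [ChartedSpace E M]

instance [FiniteDimensional ℝ E] (x : M) : FiniteDimensional ℝ (TangentSpace 𝓘(ℝ, E) x) :=
  inferInstanceAs (FiniteDimensional ℝ E)

/-- Smooth vector fields, `X ∈ Γ(TM)`. -/
def IsSmoothField [IsManifold 𝓘(ℝ, E) ∞ M] (X : Π x : M, TangentSpace 𝓘(ℝ, E) x) : Prop :=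
  ContMDiff 𝓘(ℝ, E) 𝓘(ℝ, E).tangent ∞ (fun x => (⟨x, X x⟩ : TangentBundle 𝓘(ℝ, E) M))

/-- Smooth sections of a family `D` of tangent subspaces, `X ∈ Γ(D)`. -/
def IsSectionOf [IsManifold 𝓘(ℝ, E) ∞ M] (D : Π x : M, Submodule ℝ (TangentSpace 𝓘(ℝ, E) x))
    (X : Π x : M, TangentSpace 𝓘(ℝ, E) x) : Prop :=
  IsSmoothField X ∧ ∀ x, X x ∈ D x

/-- A differentiable distribution: near every point it has a smooth frame (so its rank is locally
constant). -/
def IsSmoothDistribution [IsManifold 𝓘(ℝ, E) ∞ M]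
    (D : Π x : M, Submodule ℝ (TangentSpace 𝓘(ℝ, E) x)) : Prop :=
  ∀ x : M, ∃ U : Set M, IsOpen U ∧ x ∈ U ∧
    ∃ (k : ℕ) (X : Fin k → Π y : M, TangentSpace 𝓘(ℝ, E) y),
      (∀ i, ContMDiffOn 𝓘(ℝ, E) 𝓘(ℝ, E).tangent ∞
        (fun y => (⟨y, X i y⟩ : TangentBundle 𝓘(ℝ, E) M)) U) ∧
      ∀ y ∈ U, LinearIndependent ℝ (fun i => X i y) ∧
        Submodule.span ℝ (Set.range fun i => X i y) = D y

/-- `X f`, the derivative of the function `f` along the vector field `X`, at the point `x`. -/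
def dirDeriv (X : Π x : M, TangentSpace 𝓘(ℝ, E) x) (f : M → ℝ) (x : M) : ℝ :=
  mvfderiv 𝓘(ℝ, E) f x (X x)

/-- Exterior derivative of a 1-form `ω`:
`dω(X, Y) = X ω(Y) - Y ω(X) - ω([X, Y])`. -/
def extDerivOne (lee : Π x : M, TangentSpace 𝓘(ℝ, E) x →L[ℝ] ℝ)
    (X Y : Π x : M, TangentSpace 𝓘(ℝ, E) x) (x : M) : ℝ :=
  dirDeriv X (fun y => lee y (Y y)) x - dirDeriv Y (fun y => lee y (X y)) x
    - lee x (VectorField.mlieBracket 𝓘(ℝ, E) X Y x)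

/-- Exterior derivative of a 2-form:
`dβ(X, Y, Z) = X β(Y, Z) - Y β(X, Z) + Z β(X, Y) - β([X, Y], Z) + β([X, Z], Y) - β([Y, Z], X)`. -/
def extDerivTwo (β : Π x : M, TangentSpace 𝓘(ℝ, E) x → TangentSpace 𝓘(ℝ, E) x → ℝ)
    (X Y Z : Π x : M, TangentSpace 𝓘(ℝ, E) x) (x : M) : ℝ :=
  dirDeriv X (fun y => β y (Y y) (Z y)) x - dirDeriv Y (fun y => β y (X y) (Z y)) x
    + dirDeriv Z (fun y => β y (X y) (Y y)) x
    - β x (VectorField.mlieBracket 𝓘(ℝ, E) X Y x) (Z x)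
    + β x (VectorField.mlieBracket 𝓘(ℝ, E) X Z x) (Y x)
    - β x (VectorField.mlieBracket 𝓘(ℝ, E) Y Z x) (X x)

/-- The Nijenhuis tensor `[JX, JY] - J[JX, Y] - J[X, JY] - [X, Y]` of an almost complex
structure. -/
def nijenhuis (J : Π x : M, TangentSpace 𝓘(ℝ, E) x →L[ℝ] TangentSpace 𝓘(ℝ, E) x)
    (X Y : Π x : M, TangentSpace 𝓘(ℝ, E) x) (x : M) : TangentSpace 𝓘(ℝ, E) x :=
  VectorField.mlieBracket 𝓘(ℝ, E) (fun y => J y (X y)) (fun y => J y (Y y)) x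
    - J x (VectorField.mlieBracket 𝓘(ℝ, E) (fun y => J y (X y)) Y x)
    - J x (VectorField.mlieBracket 𝓘(ℝ, E) X (fun y => J y (Y y)) x)
    - VectorField.mlieBracket 𝓘(ℝ, E) X Y x

end VectorFields

section LocallyConformalKahler

variable {E : Type*} [NormedAddCommGroup E] [NormedSpace ℝ E]
  {M : Type*} [TopologicalSpace M] [ChartedSpace E M] [IsManifold 𝓘(ℝ, E) ∞ M]
  [RiemannianBundle (fun x : M => TangentSpace 𝓘(ℝ, E) x)]

/-- `J` is a smooth almost complex structure for which the Riemannian metric is Hermitian. -/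
structure IsAlmostHermitian
    (J : Π x : M, TangentSpace 𝓘(ℝ, E) x →L[ℝ] TangentSpace 𝓘(ℝ, E) x) : Prop where
  smooth : ContMDiff 𝓘(ℝ, E) (𝓘(ℝ, E).prod 𝓘(ℝ, E →L[ℝ] E)) ∞
    (fun x => TotalSpace.mk' (E →L[ℝ] E) x (J x))
  sq : ∀ (x : M) (v : TangentSpace 𝓘(ℝ, E) x), J x (J x v) = -v
  isometry : ∀ (x : M) (v w : TangentSpace 𝓘(ℝ, E) x), inner ℝ (J x v) (J x w) = inner ℝ v w

/-- The Kähler 2-form `Ω(X, Y) = g(X, JY)`. -/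
def kahlerForm (J : Π x : M, TangentSpace 𝓘(ℝ, E) x →L[ℝ] TangentSpace 𝓘(ℝ, E) x)
    (x : M) (v w : TangentSpace 𝓘(ℝ, E) x) : ℝ :=
  inner ℝ v (J x w)

/-- For a metric Hermitian with respect to `J`: the conformal metric `exp(-f) g` is Kählerian on
the open set `U`, that is, on `U` the almost complex structure is integrable and the Kähler form
`exp(-f) Ω` of the conformal metric is closed. -/
def IsKahlerConformalOn (J : Π x : M, TangentSpace 𝓘(ℝ, E) x →L[ℝ] TangentSpace 𝓘(ℝ, E) x)
    (f : M → ℝ) (U : Set M) : Prop :=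
  (∀ X Y : Π x : M, TangentSpace 𝓘(ℝ, E) x, IsSmoothField X → IsSmoothField Y →
    ∀ x ∈ U, nijenhuis J X Y x = 0) ∧
  (∀ X Y Z : Π x : M, TangentSpace 𝓘(ℝ, E) x,
    IsSmoothField X → IsSmoothField Y → IsSmoothField Z →
    ∀ x ∈ U, extDerivTwo (fun y v w => Real.exp (-f y) * kahlerForm J y v w) X Y Z x = 0)

/-- Locally conformal Kähler manifolds. -/
structure IsLCK (J : Π x : M, TangentSpace 𝓘(ℝ, E) x →L[ℝ] TangentSpace 𝓘(ℝ, E) x) : Prop where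
  almostHermitian : IsAlmostHermitian J
  locallyConformal : ∀ p : M, ∃ (U : Set M) (f : M → ℝ), IsOpen U ∧ p ∈ U ∧
    ContMDiffOn 𝓘(ℝ, E) 𝓘(ℝ, ℝ) ∞ f U ∧ (∀ x ∈ U, 0 < f x) ∧ IsKahlerConformalOn J f U

/-- A Lee form: a smooth closed 1-form `ω` with `dΩ = ω ∧ Ω`. -/
structure IsLeeForm (J : Π x : M, TangentSpace 𝓘(ℝ, E) x →L[ℝ] TangentSpace 𝓘(ℝ, E) x)
    (lee : Π x : M, TangentSpace 𝓘(ℝ, E) x →L[ℝ] ℝ) : Prop where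
  smooth : ∀ X : Π x : M, TangentSpace 𝓘(ℝ, E) x, IsSmoothField X →
    ContMDiff 𝓘(ℝ, E) 𝓘(ℝ, ℝ) ∞ (fun x => lee x (X x))
  closed : ∀ X Y : Π x : M, TangentSpace 𝓘(ℝ, E) x, IsSmoothField X → IsSmoothField Y →
    ∀ x, extDerivOne lee X Y x = 0
  deriv_kahlerForm : ∀ X Y Z : Π x : M, TangentSpace 𝓘(ℝ, E) x,
    IsSmoothField X → IsSmoothField Y → IsSmoothField Z →
    ∀ x, extDerivTwo (kahlerForm J) X Y Z x =
      lee x (X x) * kahlerForm J x (Y x) (Z x) - lee x (Y x) * kahlerForm J x (X x) (Z x)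
        + lee x (Z x) * kahlerForm J x (X x) (Y x)

end LocallyConformalKahler

section Submanifolds

/- The ambient Riemannian manifold is `N`; `φ : M → N` is an immersion, `M` carries the induced
metric, and `T_x M` is identified with its image `dφ(T_x M)` in `T_{φ x} N`. -/
variable {E : Type*} [NormedAddCommGroup E] [NormedSpace ℝ E] [FiniteDimensional ℝ E]
  {N : Type*} [TopologicalSpace N] [ChartedSpace E N] [IsManifold 𝓘(ℝ, E) ∞ N]
  [RiemannianBundle (fun x : N => TangentSpace 𝓘(ℝ, E) x)]
  {F : Type*} [NormedAddCommGroup F] [NormedSpace ℝ F]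
  {M : Type*} [TopologicalSpace M] [ChartedSpace F M]

/-- Derivative at `p`, in direction `w`, of the metric coefficient `g(u, v)`, where `u` and `v` are
extended to fields with constant components in the chart at `p`. -/
def metricDeriv (p : N) (w u v : TangentSpace 𝓘(ℝ, E) p) : ℝ :=
  mvfderiv 𝓘(ℝ, E) (fun y : N => inner ℝ
    ((FiberBundle.extend E u y : TangentSpace 𝓘(ℝ, E) y))
    (FiberBundle.extend E v y : TangentSpace 𝓘(ℝ, E) y)) p w

/-- The Christoffel symbols at `p` of the Levi-Civita connection, in the chart at `p`:
`g(Γ(u, v), w) = (∂_u g(v, w) + ∂_v g(u, w) - ∂_w g(u, v)) / 2` for all `w`, written out in an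
orthonormal basis. -/
def christoffel (p : N) (u v : TangentSpace 𝓘(ℝ, E) p) : TangentSpace 𝓘(ℝ, E) p :=
  ∑ k, ((metricDeriv p u v (stdOrthonormalBasis ℝ (TangentSpace 𝓘(ℝ, E) p) k)
      + metricDeriv p v u (stdOrthonormalBasis ℝ (TangentSpace 𝓘(ℝ, E) p) k)
      - metricDeriv p (stdOrthonormalBasis ℝ (TangentSpace 𝓘(ℝ, E) p) k) u v) / 2) •
    stdOrthonormalBasis ℝ (TangentSpace 𝓘(ℝ, E) p) k

/-- The Levi-Civita covariant derivative of a vector field `σ` along `φ : M → N`, in the direction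
`v ∈ T_x M`. With components in the chart of `N` at `φ x`, it is
`(∇_v σ)^k = dσ^k(v) + Γ^k_{ij} (dφ v)^i σ^j`. -/
def covAlong (φ : M → N) (σ : Π x : M, TangentSpace 𝓘(ℝ, E) (φ x)) (x : M)
    (v : TangentSpace 𝓘(ℝ, F) x) : TangentSpace 𝓘(ℝ, E) (φ x) :=
  (trivializationAt E (TangentSpace 𝓘(ℝ, E) (M := N)) (φ x)).symm (φ x)
      (mvfderiv 𝓘(ℝ, F) (fun y : M =>
        (trivializationAt E (TangentSpace 𝓘(ℝ, E) (M := N)) (φ x)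
          (⟨φ y, σ y⟩ : TangentBundle 𝓘(ℝ, E) N)).2) x v)
    + christoffel (φ x) (mfderiv 𝓘(ℝ, F) 𝓘(ℝ, E) φ x v) (σ x)

variable (E F) in
/-- Smooth immersions. -/
structure IsSmoothImmersion (φ : M → N) : Prop where
  smooth : ContMDiff 𝓘(ℝ, F) 𝓘(ℝ, E) ∞ φ
  injective_mfderiv : ∀ x, Function.Injective (mfderiv 𝓘(ℝ, F) 𝓘(ℝ, E) φ x)

/-- The image `dφ(D_x)` of a subspace `D_x` of `T_x M`. -/
def push (φ : M → N) (D : Π x : M, Submodule ℝ (TangentSpace 𝓘(ℝ, F) x)) (x : M) :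
    Submodule ℝ (TangentSpace 𝓘(ℝ, E) (φ x)) :=
  (D x).map (mfderiv 𝓘(ℝ, F) 𝓘(ℝ, E) φ x).toLinearMap

/-- The vector field `dφ(X)` along `φ`. -/
def pushField (φ : M → N) (X : Π x : M, TangentSpace 𝓘(ℝ, F) x) (x : M) :
    TangentSpace 𝓘(ℝ, E) (φ x) :=
  mfderiv 𝓘(ℝ, F) 𝓘(ℝ, E) φ x (X x)

variable (E F) in
/-- The tangent space `dφ(T_x M)` as a subspace of `T_{φ x} N`. -/
def tangentOf (φ : M → N) (x : M) : Submodule ℝ (TangentSpace 𝓘(ℝ, E) (φ x)) :=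
  push (F := F) φ (fun _ => ⊤) x

variable (E F) in
/-- The normal space of `M` at `x`. -/
def normalOf (φ : M → N) (x : M) : Submodule ℝ (TangentSpace 𝓘(ℝ, E) (φ x)) :=
  (tangentOf E F φ x)ᗮ

/-- The second fundamental form `h(X, Y)`, the normal component of `∇_X Y` (Gauss formula). -/
def secondForm (φ : M → N) (X Y : Π x : M, TangentSpace 𝓘(ℝ, F) x) (x : M) :
    TangentSpace 𝓘(ℝ, E) (φ x) :=
  (normalOf E F φ x).starProjection (covAlong φ (pushField φ Y) x (X x))

/-- The shape operator `a_ξ X`, minus the tangential component of `∇_X ξ` (Weingarten formula). -/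
def shapeOperator (φ : M → N) (ξ : Π x : M, TangentSpace 𝓘(ℝ, E) (φ x))
    (X : Π x : M, TangentSpace 𝓘(ℝ, F) x) (x : M) : TangentSpace 𝓘(ℝ, E) (φ x) :=
  -(tangentOf E F φ x).starProjection (covAlong φ ξ x (X x))

/-- The normal connection `∇^⊥_X ξ`, the normal component of `∇_X ξ` (Weingarten formula). -/
def normalConn (φ : M → N) (X : Π x : M, TangentSpace 𝓘(ℝ, F) x)
    (ξ : Π x : M, TangentSpace 𝓘(ℝ, E) (φ x)) (x : M) : TangentSpace 𝓘(ℝ, E) (φ x) :=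
  (normalOf E F φ x).starProjection (covAlong φ ξ x (X x))

variable (E F) in
/-- Totally geodesic immersions: the second fundamental form vanishes. -/
def IsTotallyGeodesic [IsManifold 𝓘(ℝ, F) ∞ M] (φ : M → N) : Prop :=
  ∀ X Y : Π x : M, TangentSpace 𝓘(ℝ, F) x, IsSmoothField X → IsSmoothField Y →
    ∀ x, secondForm (E := E) φ X Y x = 0

variable (E) in
/-- The orthogonal complement `D^⊥` of `D` in `TM`, with respect to the induced metric. -/
def orthCompl (φ : M → N) (D : Π x : M, Submodule ℝ (TangentSpace 𝓘(ℝ, F) x)) (x : M) :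
    Submodule ℝ (TangentSpace 𝓘(ℝ, F) x) :=
  (push φ D x)ᗮ.comap (mfderiv 𝓘(ℝ, F) 𝓘(ℝ, E) φ x).toLinearMap

/-- The subbundle `J D^⊥`. -/
def JPerp (J : Π p : N, TangentSpace 𝓘(ℝ, E) p →L[ℝ] TangentSpace 𝓘(ℝ, E) p) (φ : M → N)
    (D : Π x : M, Submodule ℝ (TangentSpace 𝓘(ℝ, F) x)) (x : M) :
    Submodule ℝ (TangentSpace 𝓘(ℝ, E) (φ x)) :=
  (push φ (orthCompl E φ D) x).map (J (φ x)).toLinearMap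

/-- The subbundle `μ`, the orthogonal complement of `J D^⊥` in the normal bundle. -/
def mu (J : Π p : N, TangentSpace 𝓘(ℝ, E) p →L[ℝ] TangentSpace 𝓘(ℝ, E) p) (φ : M → N)
    (D : Π x : M, Submodule ℝ (TangentSpace 𝓘(ℝ, F) x)) (x : M) :
    Submodule ℝ (TangentSpace 𝓘(ℝ, E) (φ x)) :=
  normalOf E F φ x ⊓ (JPerp J φ D x)ᗮ

/-- The vector field `JZ` along `φ`, for a vector field `Z` on `M`. -/
def JField (J : Π p : N, TangentSpace 𝓘(ℝ, E) p →L[ℝ] TangentSpace 𝓘(ℝ, E) p) (φ : M → N)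
    (Z : Π x : M, TangentSpace 𝓘(ℝ, F) x) (x : M) : TangentSpace 𝓘(ℝ, E) (φ x) :=
  J (φ x) (pushField φ Z x)

/-- Smooth sections along `φ` of a family `V` of subspaces of the tangent spaces of `N`. -/
def IsSectionAlong (φ : M → N) (V : Π x : M, Submodule ℝ (TangentSpace 𝓘(ℝ, E) (φ x)))
    (ξ : Π x : M, TangentSpace 𝓘(ℝ, E) (φ x)) : Prop :=
  ContMDiff 𝓘(ℝ, F) 𝓘(ℝ, E).tangent ∞ (fun x => (⟨φ x, ξ x⟩ : TangentBundle 𝓘(ℝ, E) N)) ∧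
    ∀ x, ξ x ∈ V x

/-- CR-submanifolds of an almost Hermitian manifold, with holomorphic distribution `D`. -/
structure IsCRSubmanifold [IsManifold 𝓘(ℝ, F) ∞ M]
    (J : Π p : N, TangentSpace 𝓘(ℝ, E) p →L[ℝ] TangentSpace 𝓘(ℝ, E) p) (φ : M → N)
    (D : Π x : M, Submodule ℝ (TangentSpace 𝓘(ℝ, F) x)) : Prop where
  immersion : IsSmoothImmersion E F φ
  distribution : IsSmoothDistribution D
  holomorphic : ∀ x, (push φ D x).map (J (φ x)).toLinearMap = push φ D x
  totallyReal : ∀ x, JPerp J φ D x ≤ normalOf E F φ x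

/-- The Lee vector field `B = ω^♯`, i.e. `g(v, B) = ω(v)` for all `v`. -/
def leeVector (lee : Π p : N, TangentSpace 𝓘(ℝ, E) p →L[ℝ] ℝ) (p : N) : TangentSpace 𝓘(ℝ, E) p :=
  (InnerProductSpace.toDual ℝ (TangentSpace 𝓘(ℝ, E) p)).symm (lee p)

end Submanifolds

section Ruled

variable {E : Type*} [NormedAddCommGroup E] [NormedSpace ℝ E] [FiniteDimensional ℝ E]
  {N : Type*} [TopologicalSpace N] [ChartedSpace E N] [IsManifold 𝓘(ℝ, E) ∞ N]
  [RiemannianBundle (fun x : N => TangentSpace 𝓘(ℝ, E) x)]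
  {F : Type*} [NormedAddCommGroup F] [NormedSpace ℝ F]
  {M : Type u} [TopologicalSpace M] [ChartedSpace F M]

/-- A connected integral manifold of the distribution `D`: a connected injectively immersed
submanifold `j : L → M` whose tangent space at each point is that of `D`. -/
structure IsIntegralManifold (D : Π x : M, Submodule ℝ (TangentSpace 𝓘(ℝ, F) x)) (k : ℕ)
    {L : Type u} [TopologicalSpace L] [ChartedSpace (EuclideanSpace ℝ (Fin k)) L]
    (j : L → M) : Prop where
  connected : ConnectedSpace L
  injective : Function.Injective j
  smooth : ContMDiff 𝓘(ℝ, EuclideanSpace ℝ (Fin k)) 𝓘(ℝ, F) ∞ j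
  injective_mfderiv :
    ∀ q, Function.Injective (mfderiv 𝓘(ℝ, EuclideanSpace ℝ (Fin k)) 𝓘(ℝ, F) j q)
  tangent : ∀ q,
    LinearMap.range (mfderiv 𝓘(ℝ, EuclideanSpace ℝ (Fin k)) 𝓘(ℝ, F) j q).toLinearMap = D (j q)

variable (E) in
/-- Totally real ruled CR-submanifolds: `D^⊥` is tangent to a foliation of `M` (through every point
passes an integral manifold of `D^⊥`) whose leaves are totally geodesic immersed in `N`. The leaves
are the maximal connected integral manifolds; every connected integral manifold is an open piece of
a leaf, so the condition is imposed on all of them. -/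
def IsTotallyRealRuled (φ : M → N) (D : Π x : M, Submodule ℝ (TangentSpace 𝓘(ℝ, F) x)) : Prop :=
  (∀ x : M, ∃ (k : ℕ) (L : Type u) (_ : TopologicalSpace L)
    (_ : ChartedSpace (EuclideanSpace ℝ (Fin k)) L)
    (_ : IsManifold 𝓘(ℝ, EuclideanSpace ℝ (Fin k)) ∞ L) (j : L → M),
    IsIntegralManifold (orthCompl E φ D) k j ∧ x ∈ Set.range j) ∧
  (∀ (k : ℕ) (L : Type u) [TopologicalSpace L] [ChartedSpace (EuclideanSpace ℝ (Fin k)) L]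
    [IsManifold 𝓘(ℝ, EuclideanSpace ℝ (Fin k)) ∞ L] (j : L → M),
    IsIntegralManifold (orthCompl E φ D) k j →
      IsTotallyGeodesic E (EuclideanSpace ℝ (Fin k)) (φ ∘ j))

end Ruled

end CRLCK

end

open CRLCK

/-!
The four conditions are compared through one property of the immersion `φ`, `IsPerpAutoparallel`:
for sections `X`, `Z` of `D^⊥` the ambient derivative `∇_X (dφ Z)` is again a section of `dφ(D^⊥)`.

*Geometry of the leaves.* If the property holds, then `D^⊥` is involutive because the Levi-Civita
connection is torsion-free (`covAlong_pushField_sub`), so by Frobenius' theorem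
(`IsSmoothDistribution.exists_isIntegralManifold`) it has an integral manifold through every point.
Conversely, along an integral manifold `L` of `D^⊥` every field on `L` may be compared at a point
with a section of `D^⊥` having the same value there. For a section `n` orthogonal to `D^⊥` one has
`g(∇_X Z, n) = -g(Z, ∇_X n)`, which depends on the value of `Z` only; so the component of `∇_X Z`
orthogonal to `D^⊥` is the same for both (`IsIntegralManifold.inner_covAlong_comp`). Hence all
integral manifolds are totally geodesic in the ambient manifold if and only if the property holds.

*Algebra.* On a locally conformal Kähler manifold `dΩ = ω ∧ Ω` and the vanishing of the Nijenhuis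
tensor determine `∇J` in terms of the Lee form (`two_mul_inner_covAlong_J`). As the Lee vector field
is a section of `J D^⊥`, it follows that `(∇_X J) s` lies in `D^⊥ ⊕ J D^⊥` for every `X` in `D^⊥`
(`IsCRSubmanifold.inner_covAlong_J`): tested against `D` or `μ`, the derivative `∇_X` commutes with
`J`. For `X`, `Z` in `D^⊥` and `Y` in `D` this gives `g(∇_X Z, JY) = g(JZ, h(X, Y))`
(`IsCRSubmanifold.inner_covAlong_holomorphic`), so the `D`-component of `∇_X Z` vanishes exactly if
`h(X, Y)` is in `μ`, which is the equivalence with the second condition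
(`IsCRSubmanifold.isPerpAutoparallel_iff`). For `N` in `μ` it gives
`g(∇_X JZ, JN) = g(∇_X Z, N)`, which relates the normal connection on `J D^⊥` to `h` and to `a_N`.
The remaining implications follow from the adjointness of `h` and the shape operator.

All conditions are stated for sections, and are tested pointwise; so vectors have to be extended to
sections of `D`, `D^⊥` and `μ`. This is done by Gram's matrix and a cutoff function
(`IsSmoothDistribution.exists_section`, `IsSmoothSubbundle.exists_orthogonal_section`).
-/

set_option linter.unusedSectionVars false

noncomputable section

section

open Filter Metric Set Topology

/-! ### The total differential equation `f' = V ∘ f` -/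

section TotalDifferentialEquation

variable {P F : Type*} [NormedAddCommGroup P] [NormedSpace ℝ P]
  [NormedAddCommGroup F] [NormedSpace ℝ F]

/-- Uniform first and second order Taylor estimates for a `C²` map on a small closed ball. -/
theorem ContDiffAt.exists_closedBall_taylor_bounds {G : Type*} [NormedAddCommGroup G]
    [NormedSpace ℝ G] {V : F → G} {z : F} (hV : ContDiffAt ℝ 2 V z) {U : Set F} (hU : U ∈ 𝓝 z) :
    ∃ R > 0, ∃ C > 0, closedBall z R ⊆ U ∧
      (∀ x ∈ closedBall z R, DifferentiableAt ℝ V x ∧ ‖V x‖ ≤ C ∧ ‖fderiv ℝ V x‖ ≤ C) ∧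
      ∀ x ∈ closedBall z R, ∀ y ∈ closedBall z R,
        ‖V y - V x - fderiv ℝ V x (y - x)‖ ≤ C * ‖y - x‖ ^ 2 := by
  have h1 : ContDiffAt ℝ 1 (fderiv ℝ V) z := hV.fderiv_right (by norm_num)
  obtain ⟨K, s, hs, hK⟩ := h1.exists_lipschitzOnWith
  have hdiff : ∀ᶠ x in 𝓝 z, DifferentiableAt ℝ V x :=
    (hV.eventually (by simp)).mono fun x hx => hx.differentiableAt (by norm_num)
  have hb1 : ∀ᶠ x in 𝓝 z, ‖V x‖ < ‖V z‖ + 1 :=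
    hV.continuousAt.norm.eventually_lt continuousAt_const (by linarith)
  have hb2 : ∀ᶠ x in 𝓝 z, ‖fderiv ℝ V x‖ < ‖fderiv ℝ V z‖ + 1 :=
    h1.continuousAt.norm.eventually_lt continuousAt_const (by linarith)
  obtain ⟨R, hR, hball⟩ := Metric.nhds_basis_closedBall.mem_iff.1
    (inter_mem hU (inter_mem hs (inter_mem hdiff (inter_mem hb1 hb2))))
  refine ⟨R, hR, ‖V z‖ + ‖fderiv ℝ V z‖ + 1 + K, by positivity, fun x hx => (hball hx).1,
    fun x hx => ?_, fun x hx y hy => ?_⟩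
  · obtain ⟨-, -, h, h', h''⟩ := hball hx
    simp only [mem_ofPred_eq] at h h' h''
    have := norm_nonneg (V z)
    have := norm_nonneg (fderiv ℝ V z)
    exact ⟨h, by linarith [show (0 : ℝ) ≤ K from K.2], by linarith [show (0 : ℝ) ≤ K from K.2]⟩
  · have hseg : segment ℝ x y ⊆ closedBall z R := (convex_closedBall z R).segment_subset hx hy
    have key := (convex_segment x y).norm_image_sub_le_of_norm_hasFDerivWithin_le'
      (f := V) (f' := fderiv ℝ V) (φ := fderiv ℝ V x) (C := K * ‖y - x‖)
      (fun w hw => (hball (hseg hw)).2.2.1.hasFDerivAt.hasFDerivWithinAt)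
      (fun w hw => by
        refine (hK.norm_sub_le (hball (hseg hw)).2.1 (hball hx).2.1).trans ?_
        gcongr
        exact norm_sub_le_of_mem_segment hw)
      (left_mem_segment ℝ x y) (right_mem_segment ℝ x y)
    refine key.trans ?_
    rw [mul_assoc, ← sq]
    gcongr
    have := norm_nonneg (V z)
    have := norm_nonneg (fderiv ℝ V z)
    linarith

/-- The radial solutions: for small `a` the curve `α_a' = V(α_a) a`, `α_a 0 = z`, is defined up to
time `1` and stays in the given ball. -/
theorem exists_radial_solution [CompleteSpace F] {V : F → P →L[ℝ] F} {z : F} {R C : ℝ}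
    (hR : 0 < R) (hC : 0 < C)
    (hV : ∀ x ∈ closedBall z R, DifferentiableAt ℝ V x ∧ ‖V x‖ ≤ C ∧ ‖fderiv ℝ V x‖ ≤ C)
    {a : P} (ha : C * ‖a‖ ≤ R) :
    ∃ α : ℝ → F, α 0 = z ∧ ContinuousOn α (Icc 0 1) ∧ (∀ t, α t ∈ closedBall z R) ∧
      ∀ t ∈ Ico (0 : ℝ) 1, HasDerivWithinAt α (V (α t) a) (Ici t) t := by
  lift R to NNReal using hR.le
  lift C to NNReal using hC.le
  have hlip : LipschitzOnWith C V (closedBall z R) :=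
    (convex_closedBall z (R : ℝ)).lipschitzOnWith_of_nnnorm_hasFDerivWithin_le
      (fun x hx => (hV x hx).1.hasFDerivAt.hasFDerivWithinAt) (fun x hx => (hV x hx).2.2)
  have hpl : IsPicardLindelof (fun _ x => V x a) (tmin := 0) (tmax := 1) ⟨0, by simp⟩ z
      R 0 (C * ‖a‖₊) (C * ‖a‖₊) := by
    refine .of_time_independent (fun x hx => ?_) ?_ ?_
    · refine ((V x).le_opNorm a).trans ?_
      rw [NNReal.coe_mul, coe_nnnorm]
      gcongr
      exact (hV x hx).2.1
    · refine LipschitzOnWith.of_dist_le_mul fun x hx y hy => ?_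
      rw [dist_eq_norm, dist_eq_norm, ← sub_apply, NNReal.coe_mul, coe_nnnorm]
      refine ((V x - V y).le_opNorm a).trans ?_
      have := hlip.norm_sub_le hx hy
      calc ‖V x - V y‖ * ‖a‖ ≤ (C * ‖x - y‖) * ‖a‖ := by gcongr
        _ = C * ‖a‖ * ‖x - y‖ := by ring
    · simpa using ha
  obtain ⟨α, hα⟩ := ODE.FunSpace.exists_isFixedPt_next hpl (mem_closedBall_self le_rfl)
  have hmem : ∀ t, α.compProj t ∈ closedBall z (R : ℝ) := fun t =>
    α.compProj_mem_closedBall hpl.mul_max_le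
  have hder : ∀ t ∈ Icc (0 : ℝ) 1,
      HasDerivWithinAt α.compProj (V (α.compProj t) a) (Icc 0 1) t := by
    intro t ht
    apply ODE.hasDerivWithinAt_picard_Icc (f := fun _ x => V x a) (t₀ := 0) (by simp)
      hpl.continuousOn_uncurry
      α.continuous_compProj.continuousOn (fun _ ht' ↦ hmem _) z ht |>.congr_of_mem _ ht
    intro t' ht'
    nth_rw 1 [← hα]
    rw [ODE.FunSpace.compProj_of_mem ht', ODE.FunSpace.next_apply]
  refine ⟨α.compProj, ?_, α.continuous_compProj.continuousOn, hmem, fun t ht => ?_⟩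
  · rw [← hα, ODE.FunSpace.compProj_of_mem (by simp), ODE.FunSpace.next_apply]
    simp
  · exact (hder t (Ico_subset_Icc_self ht)).mono_of_mem_nhdsWithin
      (mem_of_superset (Icc_mem_nhdsGE ht.2) (Icc_subset_Icc_left ht.1))

/-- The comparison of two radial solutions, up to second order in the difference of their
directions. The symmetry of `V' (V ·) ·` is used to exchange the two directions, and Grönwall's
inequality does the rest. -/
theorem norm_radial_sub_le {V : F → P →L[ℝ] F} {z : F} {R C : ℝ} (hR : 0 < R) (hC : 0 < C)
    (hV : ∀ x ∈ closedBall z R, DifferentiableAt ℝ V x ∧ ‖V x‖ ≤ C ∧ ‖fderiv ℝ V x‖ ≤ C)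
    (hT : ∀ x ∈ closedBall z R, ∀ y ∈ closedBall z R,
        ‖V y - V x - fderiv ℝ V x (y - x)‖ ≤ C * ‖y - x‖ ^ 2)
    (hsymm : ∀ x ∈ closedBall z R, ∀ a b, fderiv ℝ V x (V x a) b = fderiv ℝ V x (V x b) a)
    {a b : P} (hb : ‖b‖ ≤ 1) (hab : ‖a + b‖ ≤ 1) {α β : ℝ → F} (h0 : α 0 = β 0)
    (hαc : ContinuousOn α (Icc 0 1)) (hβc : ContinuousOn β (Icc 0 1))
    (hα : ∀ t, α t ∈ closedBall z R) (hβ : ∀ t, β t ∈ closedBall z R)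
    (hα' : ∀ t ∈ Ico (0 : ℝ) 1, HasDerivWithinAt α (V (α t) a) (Ici t) t)
    (hβ' : ∀ t ∈ Ico (0 : ℝ) 1, HasDerivWithinAt β (V (β t) (a + b)) (Ici t) t) :
    ‖β 1 - α 1 - V (α 1) b‖ ≤
      gronwallBound 0 (2 * C * (2 * R + C) + C) (2 * C ^ 3 + C ^ 2) 1 * ‖b‖ ^ 2 := by
  set K := 2 * C * (2 * R + C) + C with hKdef
  set M := 2 * C ^ 3 + C ^ 2 with hMdef
  have hK : 0 < K := by positivity
  set γ : ℝ → F := fun t => β t - α t - t • V (α t) b with hγ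
  set γ' : ℝ → F := fun t => V (β t) (a + b) - V (α t) a -
    (t • fderiv ℝ V (α t) (V (α t) a) b + V (α t) b) with hγ'
  have hVc : ContinuousOn (fun t => V (α t)) (Icc 0 1) := fun t ht =>
    (hV _ (hα t)).1.continuousAt.comp_continuousWithinAt (hαc t ht)
  have hcont : ContinuousOn γ (Icc 0 1) :=
    (hβc.sub hαc).sub (continuousOn_id.smul (hVc.clm_apply continuousOn_const))
  have hder : ∀ t ∈ Ico (0 : ℝ) 1, HasDerivWithinAt γ (γ' t) (Ici t) t := by
    intro t ht
    have h1 : HasDerivWithinAt (fun t => V (α t)) (fderiv ℝ V (α t) (V (α t) a)) (Ici t) t :=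
      (hV _ (hα t)).1.hasFDerivAt.comp_hasDerivWithinAt t (hα' t ht)
    have h2 : HasDerivWithinAt (fun t => V (α t) b) (fderiv ℝ V (α t) (V (α t) a) b) (Ici t) t := by
      simpa using h1.clm_apply (hasDerivWithinAt_const t (Ici t) b)
    have h3 := (hasDerivWithinAt_id t (Ici t)).smul h2
    simpa [hγ, hγ'] using! ((hβ' t ht).sub (hα' t ht)).sub h3
  have hb0 := norm_nonneg b
  have bound : ∀ t ∈ Ico (0 : ℝ) 1, ‖γ' t‖ ≤ K * ‖γ t‖ + M * ‖b‖ ^ 2 := by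
    intro t ht
    obtain ⟨-, hVα, hVα'⟩ := hV _ (hα t)
    have ht1 : ‖t‖ ≤ 1 := by rw [Real.norm_eq_abs, abs_le]; constructor <;> linarith [ht.1, ht.2]
    have hVb : ‖V (α t) b‖ ≤ C * ‖b‖ := ((V (α t)).le_opNorm b).trans (by gcongr)
    have htVb : ‖t • V (α t) b‖ ≤ C * ‖b‖ := by
      rw [norm_smul]
      calc ‖t‖ * ‖V (α t) b‖ ≤ 1 * (C * ‖b‖) := by gcongr
        _ = _ := one_mul _
    have hΔ : β t - α t = γ t + t • V (α t) b := by simp [hγ]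
    have hΔle : ‖β t - α t‖ ≤ ‖γ t‖ + C * ‖b‖ := by
      rw [hΔ]; exact (norm_add_le _ _).trans (by gcongr)
    have hγle : ‖γ t‖ ≤ 2 * R + C := by
      have h1 : ‖β t - α t‖ ≤ 2 * R := by
        have := dist_triangle_right (β t) (α t) z
        rw [← dist_eq_norm]
        linarith [mem_closedBall.1 (hα t), mem_closedBall.1 (hβ t)]
      have h2 : C * ‖b‖ ≤ C := by nlinarith
      calc ‖γ t‖ ≤ ‖β t - α t‖ + ‖t • V (α t) b‖ := norm_sub_le _ _
        _ ≤ _ := by linarith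
    -- the symmetry turns the derivative of `γ` into terms small in `γ` or quadratic in `b`
    have hrw : γ' t = (V (β t) - V (α t) - fderiv ℝ V (α t) (β t - α t)) (a + b)
        + fderiv ℝ V (α t) (γ t) (a + b) + fderiv ℝ V (α t) (t • V (α t) b) b := by
      have hs := hsymm _ (hα t) a b
      simp only [hγ', hs]
      rw [hΔ]
      simp only [map_add, map_smul, sub_apply, add_apply,
        smul_apply]
      abel
    have e1 : ‖(V (β t) - V (α t) - fderiv ℝ V (α t) (β t - α t)) (a + b)‖
        ≤ C * (‖γ t‖ + C * ‖b‖) ^ 2 := by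
      refine (ContinuousLinearMap.le_opNorm _ _).trans ?_
      calc _ ≤ (C * ‖β t - α t‖ ^ 2) * 1 := by
            gcongr
            exact hT _ (hα t) _ (hβ t)
        _ ≤ _ := by rw [mul_one]; gcongr
    have e2 : ‖fderiv ℝ V (α t) (γ t) (a + b)‖ ≤ C * ‖γ t‖ := by
      refine (ContinuousLinearMap.le_opNorm₂ _ _ _).trans ?_
      calc _ ≤ C * ‖γ t‖ * 1 := by gcongr
        _ = _ := mul_one _
    have e3 : ‖fderiv ℝ V (α t) (t • V (α t) b) b‖ ≤ C * (C * ‖b‖) * ‖b‖ :=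
      (ContinuousLinearMap.le_opNorm₂ _ _ _).trans (by gcongr)
    have hg0 := norm_nonneg (γ t)
    have e4 : (‖γ t‖ + C * ‖b‖) ^ 2 ≤ 2 * ((2 * R + C) * ‖γ t‖) + 2 * (C * ‖b‖) ^ 2 := by
      nlinarith [sq_nonneg (‖γ t‖ - C * ‖b‖)]
    calc ‖γ' t‖ ≤ C * (‖γ t‖ + C * ‖b‖) ^ 2 + C * ‖γ t‖ + C * (C * ‖b‖) * ‖b‖ := by
          rw [hrw]; exact (norm_add₃_le).trans (by gcongr)
      _ ≤ C * (2 * ((2 * R + C) * ‖γ t‖) + 2 * (C * ‖b‖) ^ 2) + C * ‖γ t‖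
          + C * (C * ‖b‖) * ‖b‖ := by gcongr
      _ = K * ‖γ t‖ + M * ‖b‖ ^ 2 := by rw [hKdef, hMdef]; ring
  have := norm_le_gronwallBound_of_norm_deriv_right_le hcont hder (δ := 0) (by simp [hγ, h0]) bound
    1 (by simp)
  simp only [hγ, one_smul] at this
  refine this.trans (le_of_eq ?_)
  simp only [gronwallBound_of_K_ne_0 hK.ne', sub_zero]
  ring

/-- **Frobenius' theorem**, as local solvability of the total differential equation
`f' = V ∘ f`, `f 0 = z`, under the integrability condition that `V' (V a) b` be symmetric. The
solution is obtained from radial curves, and it is differentiable because two of them agree to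
second order. -/
theorem exists_hasFDerivAt_eq_comp [CompleteSpace F] {V : F → P →L[ℝ] F} {z : F}
    (hV : ContDiffAt ℝ 2 V z) {U : Set F} (hU : U ∈ 𝓝 z)
    (hsymm : ∀ x ∈ U, ∀ a b, fderiv ℝ V x (V x a) b = fderiv ℝ V x (V x b) a) :
    ∃ r > 0, ∃ f : P → F, f 0 = z ∧ ∀ a ∈ ball (0 : P) r, f a ∈ U ∧ HasFDerivAt f (V (f a)) a := by
  obtain ⟨R, hR, C, hC, hRU, hb, hT⟩ := hV.exists_closedBall_taylor_bounds hU
  have hr : 0 < min (R / C) 1 := lt_min (by positivity) one_pos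
  have hsol : ∀ a : P, ‖a‖ ≤ min (R / C) 1 → ∃ α : ℝ → F, α 0 = z ∧ ContinuousOn α (Icc 0 1) ∧
      (∀ t, α t ∈ closedBall z R) ∧
      ∀ t ∈ Ico (0 : ℝ) 1, HasDerivWithinAt α (V (α t) a) (Ici t) t := fun a ha =>
    exists_radial_solution hR hC hb (by
      have := ha.trans (min_le_left _ _)
      rw [le_div_iff₀ hC] at this
      linarith)
  choose! α h0 hc hm hd using hsol
  have hest : ∀ a b : P, ‖a‖ ≤ min (R / C) 1 → ‖a + b‖ ≤ min (R / C) 1 → ‖b‖ ≤ 1 →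
      ‖α (a + b) 1 - α a 1 - V (α a 1) b‖ ≤
        gronwallBound 0 (2 * C * (2 * R + C) + C) (2 * C ^ 3 + C ^ 2) 1 * ‖b‖ ^ 2 :=
    fun a b ha hab hb1 => norm_radial_sub_le hR hC hb hT (fun x hx => hsymm x (hRU hx)) hb1
      (hab.trans (min_le_right _ _)) ((h0 a ha).trans (h0 _ hab).symm) (hc a ha) (hc _ hab)
      (hm a ha) (hm _ hab) (hd a ha) (hd _ hab)
  refine ⟨min (R / C) 1, hr, fun a => α a 1, ?_, fun a ha => ⟨hRU (hm a ?_ 1), ?_⟩⟩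
  -- `f 0 = z`: compare the radial curve for `a = 0` with the constant curve
  · have h := norm_radial_sub_le (a := (0 : P)) (b := 0) (β := fun _ => z) hR hC hb hT
      (fun x hx => hsymm x (hRU hx)) (by simp) (by simp) (h0 0 (by simpa using hr.le))
      (hc 0 (by simpa using hr.le)) continuousOn_const (hm 0 (by simpa using hr.le))
      (fun _ => mem_closedBall_self hR.le) (hd 0 (by simpa using hr.le))
      (fun t _ => by simpa using hasDerivWithinAt_const t (Ici t) z)
    simp only [map_zero, sub_zero, norm_zero, ne_eq, OfNat.ofNat_ne_zero, not_false_eq_true,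
      zero_pow, mul_zero, norm_le_zero_iff, sub_eq_zero] at h
    exact h.symm
  · exact (mem_ball_zero_iff.1 ha).le
  · rw [hasFDerivAt_iff_isLittleO_nhds_zero]
    refine Asymptotics.IsBigO.trans_isLittleO (g := fun b : P => ‖b‖ ^ 2) ?_ ?_
    · refine Asymptotics.IsBigO.of_bound
        (gronwallBound 0 (2 * C * (2 * R + C) + C) (2 * C ^ 3 + C ^ 2) 1) ?_
      have h1 : ∀ᶠ b in 𝓝 (0 : P), a + b ∈ ball (0 : P) (min (R / C) 1) := by
        refine (continuous_const.add continuous_id).continuousAt.eventually_mem ?_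
        simpa using isOpen_ball.mem_nhds ha
      filter_upwards [h1, closedBall_mem_nhds (0 : P) one_pos] with b hb1 hb2
      simpa using hest a b (mem_ball_zero_iff.1 ha).le (mem_ball_zero_iff.1 hb1).le
        (by simpa using hb2)
    · simpa using Asymptotics.isLittleO_norm_pow_id (E' := P) one_lt_two

/-- A solution of `f' = V ∘ f` is as smooth as `V`. -/
theorem contDiffOn_of_hasFDerivAt_comp {V : F → P →L[ℝ] F} {U : Set F} (hV : ContDiffOn ℝ ∞ V U)
    {f : P → F} {s : Set P} (hs : IsOpen s) (hfU : MapsTo f s U)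
    (hf : ∀ a ∈ s, HasFDerivAt f (V (f a)) a) : ContDiffOn ℝ ∞ f s := by
  rw [contDiffOn_infty]
  intro n
  induction n with
  | zero => exact contDiffOn_zero.2 fun a ha => (hf a ha).continuousAt.continuousWithinAt
  | succ n ih =>
    rw [Nat.cast_add, Nat.cast_one, contDiffOn_succ_iff_fderiv_of_isOpen hs]
    refine ⟨fun a ha => (hf a ha).differentiableAt.differentiableWithinAt, by simp, ?_⟩
    exact ((hV.of_le (mod_cast le_top)).comp ih hfU).congr fun a ha => (hf a ha).fderiv

end TotalDifferentialEquation

/-! ### Frobenius' theorem in a vector space -/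

section Frobenius

variable {F : Type*} [NormedAddCommGroup F] [NormedSpace ℝ F] [FiniteDimensional ℝ F]

/-- **Frobenius' theorem** for an involutive frame in a vector space. The frame is first normalized
so that a fixed linear map `T` sends it to the standard basis; the normalized frame commutes, since
its brackets lie in the distribution and are killed by `T`. -/
theorem exists_integral_map_of_involutive {k : ℕ} {Z : Fin k → F → F} {U : Set F} (hU : IsOpen U)
    {z : F} (hz : z ∈ U) (hZ : ∀ c, ContDiffOn ℝ ∞ (Z c) U)
    (hli : LinearIndependent ℝ fun c => Z c z)
    (hinv : ∀ y ∈ U, ∀ c d, VectorField.lieBracket ℝ (Z c) (Z d) y ∈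
      Submodule.span ℝ (range fun c => Z c y)) :
    ∃ r > 0, ∃ f : EuclideanSpace ℝ (Fin k) → F, f 0 = z ∧ MapsTo f (ball 0 r) U ∧
      ContDiffOn ℝ ∞ f (ball 0 r) ∧ InjOn f (ball 0 r) ∧
      ∀ a ∈ ball 0 r, Function.Injective (fderiv ℝ f a) ∧
        LinearMap.range (fderiv ℝ f a).toLinearMap =
          Submodule.span ℝ (range fun c => Z c (f a)) := by
  have : CompleteSpace F := FiniteDimensional.complete ℝ F
  let P := EuclideanSpace ℝ (Fin k)
  let A : F → P →L[ℝ] F := fun y => ∑ c, (EuclideanSpace.proj c : P →L[ℝ] ℝ).smulRight (Z c y)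
  have hA_apply : ∀ y (a : P), A y a = ∑ c, a c • Z c y := fun y a => by
    simp only [A, sum_apply, ContinuousLinearMap.smulRight_apply]
    rfl
  have hA : ContDiffOn ℝ ∞ A U := ContDiffOn.sum fun c _ =>
    ((ContinuousLinearMap.smulRightL ℝ P F (EuclideanSpace.proj c)).contDiff).comp_contDiffOn (hZ c)
  have hrange : ∀ y, LinearMap.range (A y).toLinearMap =
      Submodule.span ℝ (range fun c => Z c y) := by
    intro y
    ext v
    rw [Submodule.mem_span_range_iff_exists_fun, LinearMap.mem_range]
    constructor
    · rintro ⟨a, rfl⟩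
      exact ⟨a, (hA_apply y a).symm⟩
    · rintro ⟨c, rfl⟩
      exact ⟨WithLp.toLp 2 c, hA_apply y _⟩
  have hAinj : Function.Injective (A z) := by
    rw [injective_iff_map_eq_zero]
    intro a ha
    rw [hA_apply] at ha
    ext c
    exact Fintype.linearIndependent_iff.1 hli (fun c => a c) ha c
  obtain ⟨T₀, hT₀⟩ := (A z).toLinearMap.exists_leftInverse_of_injective
    (LinearMap.ker_eq_bot.2 hAinj)
  let T : F →L[ℝ] P := T₀.toContinuousLinearMap
  let B : F → P →L[ℝ] P := fun y => T ∘L A y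
  have hB : ContDiffOn ℝ ∞ B U := contDiffOn_const.clm_comp hA
  have hBz : B z = (ContinuousLinearEquiv.refl ℝ P : P →L[ℝ] P) := by
    ext1 a
    exact LinearMap.congr_fun hT₀ a
  let U' : Set F := U ∩ B ⁻¹' range ((↑) : (P ≃L[ℝ] P) → P →L[ℝ] P)
  have hU' : IsOpen U' := hB.continuousOn.isOpen_inter_preimage hU ContinuousLinearEquiv.isOpen
  have hzU' : z ∈ U' := ⟨hz, ⟨_, hBz.symm⟩⟩
  let S : F → P →L[ℝ] P := fun y => (B y).inverse
  have hS : ContDiffOn ℝ ∞ S U' := fun y hy => by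
    obtain ⟨e, he⟩ := hy.2
    have h1 : ContDiffAt ℝ ∞ ContinuousLinearMap.inverse (B y) := he ▸ contDiffAt_map_inverse e
    exact (h1.comp y (hB.contDiffAt (hU.mem_nhds hy.1))).contDiffWithinAt
  have hBS : ∀ y ∈ U', ∀ a, B y (S y a) = a := fun y hy a => by
    obtain ⟨e, he⟩ := hy.2
    simp only [S, ← he, ContinuousLinearMap.inverse_equiv]
    exact e.apply_symm_apply a
  have hSB : ∀ y ∈ U', ∀ a, S y (B y a) = a := fun y hy a => by
    obtain ⟨e, he⟩ := hy.2
    simp only [S, ← he, ContinuousLinearMap.inverse_equiv]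
    exact e.symm_apply_apply a
  let V : F → P →L[ℝ] F := fun y => A y ∘L S y
  have hV : ContDiffOn ℝ ∞ V U' := (hA.mono inter_subset_left).clm_comp hS
  have hTV : ∀ y ∈ U', ∀ a, T (V y a) = a := hBS
  have hVrange : ∀ y ∈ U', LinearMap.range (V y).toLinearMap =
      Submodule.span ℝ (range fun c => Z c y) := fun y hy => by
    rw [← hrange]
    ext v
    constructor
    · rintro ⟨a, rfl⟩
      exact ⟨S y a, rfl⟩
    · rintro ⟨a, rfl⟩
      exact ⟨B y a, congrArg (A y) (hSB y hy a)⟩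
  -- the normalized frame commutes: `T` is injective on the range of `V y`, which contains the
  -- difference below
  have hsymm : ∀ y ∈ U', ∀ a b, fderiv ℝ V y (V y a) b = fderiv ℝ V y (V y b) a := by
    intro y hy a b
    have hAd : DifferentiableAt ℝ A y :=
      (hA.contDiffAt (hU.mem_nhds hy.1)).differentiableAt (by simp)
    have hZd : ∀ c, DifferentiableAt ℝ (Z c) y := fun c =>
      ((hZ c).contDiffAt (hU.mem_nhds hy.1)).differentiableAt (by simp)
    have hSd : DifferentiableAt ℝ S y :=
      (hS.contDiffAt (hU'.mem_nhds hy)).differentiableAt (by simp)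
    have hVd : DifferentiableAt ℝ V y :=
      (hV.contDiffAt (hU'.mem_nhds hy)).differentiableAt (by simp)
    have hAder : ∀ w a, fderiv ℝ A y w a = ∑ c, a c • fderiv ℝ (Z c) y w := fun w a => by
      have h1 : HasFDerivAt (fun y => A y a) (∑ c, a c • fderiv ℝ (Z c) y) y := by
        simp only [hA_apply]
        exact HasFDerivAt.fun_sum fun c _ => (hZd c).hasFDerivAt.const_smul (a c)
      have h2 := (hAd.hasFDerivAt.clm_apply (hasFDerivAt_const a y)).unique h1
      simpa using congrArg (fun L : F →L[ℝ] F => L w) h2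
    have hVder : ∀ w a, fderiv ℝ V y w a = fderiv ℝ A y w (S y a) + A y (fderiv ℝ S y w a) :=
      fun w a => by
        have h := congrArg (fun L : F →L[ℝ] P →L[ℝ] F => L w a)
          (hAd.hasFDerivAt.clm_comp hSd.hasFDerivAt).fderiv
        simp at h
        rw [show fderiv ℝ V y w a = _ from h, add_comm]
    have hmem : fderiv ℝ V y (V y a) b - fderiv ℝ V y (V y b) a ∈
        LinearMap.range (V y).toLinearMap := by
      have h1 : fderiv ℝ V y (V y a) b - fderiv ℝ V y (V y b) a =
          (∑ c, ∑ d, (S y b c * S y a d) • VectorField.lieBracket ℝ (Z d) (Z c) y)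
            + A y (fderiv ℝ S y (V y a) b - fderiv ℝ S y (V y b) a) := by
        have h2 : ∀ a b, fderiv ℝ A y (V y a) (S y b) =
            ∑ c, ∑ d, (S y b c * S y a d) • fderiv ℝ (Z c) y (Z d y) := fun a b => by
          rw [hAder]
          refine Finset.sum_congr rfl fun c _ => ?_
          rw [show V y a = ∑ d, S y a d • Z d y from hA_apply y _, map_sum, Finset.smul_sum]
          simp only [map_smul, smul_smul]
        rw [hVder, hVder, h2, h2, map_sub]
        rw [Finset.sum_comm (f := fun c d => (S y a c * S y b d) • fderiv ℝ (Z c) y (Z d y))]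
        simp only [VectorField.lieBracket, smul_sub, Finset.sum_sub_distrib, mul_comm (S y a _)]
        abel
      rw [h1, hVrange y hy]
      refine Submodule.add_mem _ (Submodule.sum_mem _ fun c _ => Submodule.sum_mem _ fun d _ =>
        Submodule.smul_mem _ _ (hinv y hy.1 d c)) ?_
      rw [← hrange]
      exact LinearMap.mem_range_self _ _
    -- `T ∘ V` is constant on `U'`, so derivatives of `V` are killed by `T`
    have hT0 : ∀ w a, T (fderiv ℝ V y w a) = 0 := fun w a => by
      have h1 : HasFDerivAt (fun y => T (V y a)) (0 : F →L[ℝ] P) y :=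
        (hasFDerivAt_const a y).congr_of_eventuallyEq
          (by filter_upwards [hU'.mem_nhds hy] with y' hy' using hTV y' hy' a)
      have h2 := (T.hasFDerivAt.comp y
        (hVd.hasFDerivAt.clm_apply (hasFDerivAt_const a y))).unique h1
      simpa using congrArg (fun L : F →L[ℝ] P => L w) h2
    -- the difference is `V y c` for some `c`, and `c = T (V y c) = 0`
    obtain ⟨c, hc⟩ := hmem
    have hc' : V y c = fderiv ℝ V y (V y a) b - fderiv ℝ V y (V y b) a := hc
    have h3 := hTV y hy c
    rw [hc', map_sub, hT0, hT0, sub_zero] at h3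
    rw [← h3, map_zero] at hc'
    exact (sub_eq_zero.1 hc'.symm)
  obtain ⟨r, hr, f, hf0, hf⟩ := exists_hasFDerivAt_eq_comp
    ((hV.contDiffAt (hU'.mem_nhds hzU')).of_le (ENat.LEInfty.out : (2 : WithTop ℕ∞) ≤ ∞))
    (hU'.mem_nhds hzU') hsymm
  -- `T` is, up to translation, a left inverse of `f`, so `f` is injective
  have hfT : ∀ a ∈ ball (0 : P) r, T (f a) = T z + a := by
    intro a ha
    have h1 : ∀ b ∈ ball (0 : P) r, HasFDerivAt (fun b => T (f b) - b) (0 : P →L[ℝ] P) b :=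
      fun b hb => by
        have h2 := (T.hasFDerivAt.comp b (hf b hb).2).sub (hasFDerivAt_id b)
        refine h2.congr_fderiv ?_
        ext1 w
        simpa [sub_eq_zero] using hTV _ (hf b hb).1 w
    have h3 := isOpen_ball.is_const_of_fderiv_eq_zero (convex_ball (0 : P) r).isPreconnected
      (fun b hb => (h1 b hb).differentiableAt.differentiableWithinAt)
      (fun b hb => (h1 b hb).fderiv) ha (mem_ball_self hr)
    simp only [hf0, sub_zero] at h3
    rw [← h3]
    abel
  refine ⟨r, hr, f, hf0, fun a ha => (hf a ha).1.1, contDiffOn_of_hasFDerivAt_comp hV isOpen_ball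
    (fun a ha => (hf a ha).1) (fun a ha => (hf a ha).2), fun a ha b hb hab => ?_, fun a ha => ?_⟩
  · have h1 := hfT a ha
    rw [hab, hfT b hb] at h1
    exact (add_left_cancel h1).symm
  · rw [(hf a ha).2.fderiv]
    exact ⟨Function.LeftInverse.injective (g := T) (hTV _ (hf a ha).1), hVrange _ (hf a ha).1⟩

end Frobenius

namespace CRLCK

/-! ### Differentiable vector fields along a map -/

section Along

variable {E : Type*} [NormedAddCommGroup E] [NormedSpace ℝ E]
  {N : Type*} [TopologicalSpace N] [ChartedSpace E N] [IsManifold 𝓘(ℝ, E) ∞ N]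
  {F : Type*} [NormedAddCommGroup F] [NormedSpace ℝ F]
  {M : Type*} [TopologicalSpace M] [ChartedSpace F M]

theorem mvfderiv_congr {G : Type*} [NormedAddCommGroup G] [NormedSpace ℝ G] {f g : M → G} {x : M}
    (h : f =ᶠ[𝓝 x] g) : mvfderiv 𝓘(ℝ, F) f x = mvfderiv 𝓘(ℝ, F) g x := by
  ext v
  exact congrArg (fun L : F →L[ℝ] G => L v) h.mfderiv_eq

theorem mvfderiv_comp_vec {F' : Type*} [NormedAddCommGroup F'] [NormedSpace ℝ F']
    {L : Type*} [TopologicalSpace L] [ChartedSpace F' L]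
    {G : Type*} [NormedAddCommGroup G] [NormedSpace ℝ G] {f : M → G} {j : L → M} {q : L}
    (hf : MDifferentiableAt 𝓘(ℝ, F) 𝓘(ℝ, G) f (j q))
    (hj : MDifferentiableAt 𝓘(ℝ, F') 𝓘(ℝ, F) j q) (w : TangentSpace 𝓘(ℝ, F') q) :
    mvfderiv 𝓘(ℝ, F') (f ∘ j) q w =
      mvfderiv 𝓘(ℝ, F) f (j q) (mfderiv 𝓘(ℝ, F') 𝓘(ℝ, F) j q w) :=
  mfderiv_comp_apply q hf hj w

variable (F) in
/-- Differentiability at `x` of a vector field `σ` along the map `φ`. -/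
def MDiffAlongAt (φ : M → N) (σ : Π x : M, TangentSpace 𝓘(ℝ, E) (φ x)) (x : M) : Prop :=
  MDifferentiableAt 𝓘(ℝ, F) 𝓘(ℝ, E).tangent (fun y => (⟨φ y, σ y⟩ : TangentBundle 𝓘(ℝ, E) N)) x

/-- The components of a vector field `σ` along `φ`, in the chart of `N` at the point `p`. -/
def components (φ : M → N) (p : N) (σ : Π x : M, TangentSpace 𝓘(ℝ, E) (φ x)) (y : M) : E :=
  (trivializationAt E (TangentSpace 𝓘(ℝ, E) (M := N)) p
    (⟨φ y, σ y⟩ : TangentBundle 𝓘(ℝ, E) N)).2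

variable {φ : M → N} {σ τ : Π x : M, TangentSpace 𝓘(ℝ, E) (φ x)} {x : M}

theorem mdiffAlongAt_iff : MDiffAlongAt F φ σ x ↔
    MDifferentiableAt 𝓘(ℝ, F) 𝓘(ℝ, E) φ x ∧
      MDifferentiableAt 𝓘(ℝ, F) 𝓘(ℝ, E) (components φ (φ x) σ) x :=
  mdifferentiableAt_totalSpace _ _

theorem MDiffAlongAt.eventually_mem (h : MDiffAlongAt F φ σ x) :
    ∀ᶠ y in 𝓝 x, φ y ∈ (trivializationAt E (TangentSpace 𝓘(ℝ, E) (M := N)) (φ x)).baseSet :=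
  (mdiffAlongAt_iff.1 h).1.continuousAt.eventually_mem
    ((trivializationAt E _ (φ x)).open_baseSet.mem_nhds
      (FiberBundle.mem_baseSet_trivializationAt' (φ x)))

theorem components_eq {p : N} {y : M}
    (hy : φ y ∈ (trivializationAt E (TangentSpace 𝓘(ℝ, E) (M := N)) p).baseSet) :
    components φ p σ y =
      (trivializationAt E (TangentSpace 𝓘(ℝ, E) (M := N)) p).continuousLinearMapAt ℝ (φ y)
        (σ y) := by
  rw [components, Trivialization.continuousLinearMapAt_apply, Trivialization.linearMapAt_apply,
    if_pos hy]

theorem symmL_components {p : N} {y : M}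
    (hy : φ y ∈ (trivializationAt E (TangentSpace 𝓘(ℝ, E) (M := N)) p).baseSet) :
    (trivializationAt E (TangentSpace 𝓘(ℝ, E) (M := N)) p).symmL ℝ (φ y) (components φ p σ y)
      = σ y := by
  rw [components_eq hy, Trivialization.symmL_continuousLinearMapAt _ hy]

theorem MDiffAlongAt.congr (h : MDiffAlongAt F φ σ x) (hστ : ∀ᶠ y in 𝓝 x, τ y = σ y) :
    MDiffAlongAt F φ τ x :=
  MDifferentiableAt.congr_of_eventuallyEq h (hστ.mono fun y hy => by simp [hy])

theorem MDiffAlongAt.add (hσ : MDiffAlongAt F φ σ x) (hτ : MDiffAlongAt F φ τ x) :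
    MDiffAlongAt F φ (fun y => σ y + τ y) x := by
  refine mdiffAlongAt_iff.2 ⟨(mdiffAlongAt_iff.1 hσ).1, ?_⟩
  refine ((mdiffAlongAt_iff.1 hσ).2.add (mdiffAlongAt_iff.1 hτ).2).congr_of_eventuallyEq ?_
  filter_upwards [hσ.eventually_mem] with y hy
  simp [components_eq hy]

theorem MDiffAlongAt.smul {f : M → ℝ} (hf : MDifferentiableAt 𝓘(ℝ, F) 𝓘(ℝ, ℝ) f x)
    (hσ : MDiffAlongAt F φ σ x) : MDiffAlongAt F φ (fun y => f y • σ y) x := by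
  refine mdiffAlongAt_iff.2 ⟨(mdiffAlongAt_iff.1 hσ).1, ?_⟩
  refine (MDifferentiableAt.smul hf (mdiffAlongAt_iff.1 hσ).2).congr_of_eventuallyEq ?_
  filter_upwards [hσ.eventually_mem] with y hy
  simp [components_eq hy]

theorem MDiffAlongAt.comp_field {Y : Π q : N, TangentSpace 𝓘(ℝ, E) q}
    (hY : MDiffAlongAt E (fun q : N => q) Y (φ x)) (hφ : MDifferentiableAt 𝓘(ℝ, F) 𝓘(ℝ, E) φ x) :
    MDiffAlongAt F φ (fun y => Y (φ y)) x :=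
  MDifferentiableAt.comp x (f := φ) hY hφ

theorem mdiffAlongAt_extend {p : N} (u : TangentSpace 𝓘(ℝ, E) p) :
    MDiffAlongAt E (fun q : N => q) (FiberBundle.extend E u : Π q : N, TangentSpace 𝓘(ℝ, E) q) p :=
  FiberBundle.mdifferentiableAt_extend 𝓘(ℝ, E) E u

/-- `FiberBundle.extend` extends a tangent vector to a field with constant components in the
chart. -/
theorem components_extend {y : M} {p : N}
    (hy : φ y ∈ (trivializationAt E (TangentSpace 𝓘(ℝ, E) (M := N)) p).baseSet)
    (u : TangentSpace 𝓘(ℝ, E) p) :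
    components φ p (fun y => (FiberBundle.extend E u (φ y) : TangentSpace 𝓘(ℝ, E) (φ y))) y =
      (trivializationAt E (TangentSpace 𝓘(ℝ, E) (M := N)) p).continuousLinearMapAt ℝ p u := by
  have h : (FiberBundle.extend E u (φ y) : TangentSpace 𝓘(ℝ, E) (φ y)) =
      (trivializationAt E (TangentSpace 𝓘(ℝ, E) (M := N)) p).symmL ℝ (φ y)
        (trivializationAt E (TangentSpace 𝓘(ℝ, E) (M := N)) p ⟨p, u⟩).2 := by
    rw [Trivialization.symmL_apply _ hy, FiberBundle.extend]
  rw [components_eq hy, h, Trivialization.continuousLinearMapAt_symmL _ hy,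
    Trivialization.continuousLinearMapAt_apply, Trivialization.linearMapAt_apply,
    if_pos (FiberBundle.mem_baseSet_trivializationAt' p)]

/-- An induction principle for germs of vector fields along a map: every such germ is a combination,
with functions as coefficients, of fields with constant components. -/
theorem mdiffAlong_induction [FiniteDimensional ℝ E] (hφ : MDifferentiableAt 𝓘(ℝ, F) 𝓘(ℝ, E) φ x)
    {P : (Π y : M, TangentSpace 𝓘(ℝ, E) (φ y)) → Prop}
    (hextend : ∀ u : TangentSpace 𝓘(ℝ, E) (φ x),
      P (fun y => (FiberBundle.extend E u (φ y) : TangentSpace 𝓘(ℝ, E) (φ y))))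
    (hadd : ∀ σ τ, MDiffAlongAt F φ σ x → MDiffAlongAt F φ τ x → P σ → P τ →
      P (fun y => σ y + τ y))
    (hsmul : ∀ (f : M → ℝ) σ, MDifferentiableAt 𝓘(ℝ, F) 𝓘(ℝ, ℝ) f x → MDiffAlongAt F φ σ x → P σ →
      P (fun y => f y • σ y))
    (hcongr : ∀ σ τ, MDiffAlongAt F φ σ x → (∀ᶠ y in 𝓝 x, τ y = σ y) → P σ → P τ)
    (hσ : MDiffAlongAt F φ σ x) : P σ := by
  classical
  set e := trivializationAt E (TangentSpace 𝓘(ℝ, E) (M := N)) (φ x) with he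
  have hmem : φ x ∈ e.baseSet := FiberBundle.mem_baseSet_trivializationAt' (φ x)
  let b := Module.finBasis ℝ E
  let u : Fin (Module.finrank ℝ E) → TangentSpace 𝓘(ℝ, E) (φ x) := fun i => e.symmL ℝ (φ x) (b i)
  let s : Fin (Module.finrank ℝ E) → M → ℝ := fun i y => b.coord i (components φ (φ x) σ y)
  have hs : ∀ i, MDifferentiableAt 𝓘(ℝ, F) 𝓘(ℝ, ℝ) (s i) x := fun i =>
    ((b.coord i).toContinuousLinearMap.mdifferentiableAt).comp x (mdiffAlongAt_iff.1 hσ).2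
  have hu : ∀ i, MDiffAlongAt F φ
      (fun y => (FiberBundle.extend E (u i) (φ y) : TangentSpace 𝓘(ℝ, E) (φ y))) x := fun i =>
    MDiffAlongAt.comp_field (mdiffAlongAt_extend (u i)) hφ
  have h0 : MDiffAlongAt F φ (fun y => (0 : TangentSpace 𝓘(ℝ, E) (φ y))) x :=
    (MDiffAlongAt.smul (f := fun _ => 0) mdifferentiableAt_const hσ).congr (by simp)
  have key : ∀ t : Finset (Fin (Module.finrank ℝ E)),
      MDiffAlongAt F φ (fun y => ∑ i ∈ t, s i y •
        (FiberBundle.extend E (u i) (φ y) : TangentSpace 𝓘(ℝ, E) (φ y))) x ∧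
      P (fun y => ∑ i ∈ t, s i y •
        (FiberBundle.extend E (u i) (φ y) : TangentSpace 𝓘(ℝ, E) (φ y))) := by
    intro t
    induction t using Finset.induction_on with
    | empty =>
      refine ⟨h0.congr (by simp), hcongr (fun y => (0 : ℝ) • σ y) _
        (MDiffAlongAt.smul mdifferentiableAt_const hσ) (by simp) ?_⟩
      refine hcongr (fun y => (0 : ℝ) • (FiberBundle.extend E (0 : TangentSpace 𝓘(ℝ, E) (φ x)) (φ y)
        : TangentSpace 𝓘(ℝ, E) (φ y))) _ ?_ (by simp) ?_
      · exact MDiffAlongAt.smul mdifferentiableAt_const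
          (MDiffAlongAt.comp_field (mdiffAlongAt_extend 0) hφ)
      · exact hsmul _ _ mdifferentiableAt_const
          (MDiffAlongAt.comp_field (mdiffAlongAt_extend 0) hφ) (hextend 0)
    | insert a t ha ih =>
      have h1 := MDiffAlongAt.smul (hs a) (hu a)
      simp only [Finset.sum_insert ha]
      exact ⟨h1.add ih.1, hadd _ _ h1 ih.1 (hsmul _ _ (hs a) (hu a) (hextend _)) ih.2⟩
  refine hcongr _ _ (key Finset.univ).1 ?_ (key Finset.univ).2
  filter_upwards [hσ.eventually_mem] with y hy
  have h1 : ∀ i, (FiberBundle.extend E (u i) (φ y) : TangentSpace 𝓘(ℝ, E) (φ y))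
      = e.symmL ℝ (φ y) (b i) := fun i => by
    rw [← symmL_components (σ := fun y => (FiberBundle.extend E (u i) (φ y) :
      TangentSpace 𝓘(ℝ, E) (φ y))) hy, components_extend hy]
    congr 1
    exact Trivialization.continuousLinearMapAt_symmL _ hmem _
  simp only [h1, ← map_smul, ← map_sum]
  rw [← symmL_components (σ := σ) hy]
  congr 1
  exact (b.sum_repr _).symm

/-- Near `p`, the extension with constant components is linear in the vector that is extended. -/
theorem eventually_extend_eq_symmL (p : N) : ∀ᶠ q in 𝓝 p, ∀ u : TangentSpace 𝓘(ℝ, E) p,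
    (FiberBundle.extend E u q : TangentSpace 𝓘(ℝ, E) q) =
      (trivializationAt E (TangentSpace 𝓘(ℝ, E) (M := N)) p).symmL ℝ q
        ((trivializationAt E (TangentSpace 𝓘(ℝ, E) (M := N)) p).continuousLinearMapAt ℝ p u) := by
  filter_upwards [(trivializationAt E (TangentSpace 𝓘(ℝ, E) (M := N)) p).open_baseSet.mem_nhds
    (FiberBundle.mem_baseSet_trivializationAt' p)] with q hq u
  rw [← components_extend (φ := fun q : N => q) hq u, symmL_components (φ := fun q : N => q) hq]

variable [RiemannianBundle (fun x : N => TangentSpace 𝓘(ℝ, E) x)]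
  [IsContMDiffRiemannianBundle 𝓘(ℝ, E) ∞ E (fun p : N => TangentSpace 𝓘(ℝ, E) p)]

theorem MDiffAlongAt.inner (hσ : MDiffAlongAt F φ σ x) (hτ : MDiffAlongAt F φ τ x) :
    MDifferentiableAt 𝓘(ℝ, F) 𝓘(ℝ, ℝ) (fun y => inner ℝ (σ y) (τ y)) x :=
  MDifferentiableAt.inner_bundle hσ hτ

/-! ### The Christoffel symbols -/

theorem mdifferentiableAt_inner_extend {p : N} (u v : TangentSpace 𝓘(ℝ, E) p) :
    MDifferentiableAt 𝓘(ℝ, E) 𝓘(ℝ, ℝ) (fun y : N => inner ℝ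
      (FiberBundle.extend E u y : TangentSpace 𝓘(ℝ, E) y)
      (FiberBundle.extend E v y : TangentSpace 𝓘(ℝ, E) y)) p :=
  MDiffAlongAt.inner (φ := fun q : N => q) (mdiffAlongAt_extend u) (mdiffAlongAt_extend v)

section MetricDeriv

variable (p : N) (u u' v v' w w' : TangentSpace 𝓘(ℝ, E) p) (c : ℝ)

theorem metricDeriv_comm : metricDeriv p w u v = metricDeriv p w v u := by
  simp only [metricDeriv, real_inner_comm]

theorem metricDeriv_add_fst :
    metricDeriv p (w + w') u v = metricDeriv p w u v + metricDeriv p w' u v := by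
  simp [metricDeriv]

theorem metricDeriv_smul_fst : metricDeriv p (c • w) u v = c * metricDeriv p w u v := by
  simp [metricDeriv]

theorem metricDeriv_add_snd :
    metricDeriv p w (u + u') v = metricDeriv p w u v + metricDeriv p w u' v := by
  have h : (fun y : N => inner ℝ (FiberBundle.extend E (u + u') y : TangentSpace 𝓘(ℝ, E) y)
      (FiberBundle.extend E v y : TangentSpace 𝓘(ℝ, E) y)) =ᶠ[𝓝 p]
      fun y => inner ℝ (FiberBundle.extend E u y : TangentSpace 𝓘(ℝ, E) y)
        (FiberBundle.extend E v y : TangentSpace 𝓘(ℝ, E) y) +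
        inner ℝ (FiberBundle.extend E u' y : TangentSpace 𝓘(ℝ, E) y)
        (FiberBundle.extend E v y : TangentSpace 𝓘(ℝ, E) y) := by
    filter_upwards [eventually_extend_eq_symmL (E := E) p] with q hq
    simp only [hq, map_add, inner_add_left]
  rw [metricDeriv, mvfderiv_congr h, mvfderiv_fun_add
    (mdifferentiableAt_inner_extend (E := E) u v)
    (mdifferentiableAt_inner_extend (E := E) u' v), add_apply]
  rfl

theorem metricDeriv_smul_snd : metricDeriv p w (c • u) v = c * metricDeriv p w u v := by
  have h : (fun y : N => inner ℝ (FiberBundle.extend E (c • u) y : TangentSpace 𝓘(ℝ, E) y)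
      (FiberBundle.extend E v y : TangentSpace 𝓘(ℝ, E) y)) =ᶠ[𝓝 p]
      fun y => c • inner ℝ (FiberBundle.extend E u y : TangentSpace 𝓘(ℝ, E) y)
        (FiberBundle.extend E v y : TangentSpace 𝓘(ℝ, E) y) := by
    filter_upwards [eventually_extend_eq_symmL (E := E) p] with q hq
    simp only [hq, map_smul, inner_smul_left, smul_eq_mul, conj_trivial]
  rw [metricDeriv, mvfderiv_congr h, mvfderiv_fun_smul (a := fun _ => c) mdifferentiableAt_const
    (mdifferentiableAt_inner_extend (E := E) u v), mvfderiv_const]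
  simp [metricDeriv]

theorem metricDeriv_add_trd :
    metricDeriv p w u (v + v') = metricDeriv p w u v + metricDeriv p w u v' := by
  rw [metricDeriv_comm, metricDeriv_add_snd, metricDeriv_comm p v, metricDeriv_comm p v']

theorem metricDeriv_smul_trd : metricDeriv p w u (c • v) = c * metricDeriv p w u v := by
  rw [metricDeriv_comm, metricDeriv_smul_snd, metricDeriv_comm p v]

end MetricDeriv

variable [FiniteDimensional ℝ E]

section Christoffel

variable {p : N} (u v v' w : TangentSpace 𝓘(ℝ, E) p) (c : ℝ)

/-- The Koszul formula; the right side is linear in `w`, so the values on an orthonormal basis,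
which define `christoffel`, determine it. -/
theorem inner_christoffel : inner ℝ (christoffel p u v) w =
    (metricDeriv p u v w + metricDeriv p v u w - metricDeriv p w u v) / 2 := by
  let L : TangentSpace 𝓘(ℝ, E) p →ₗ[ℝ] ℝ :=
    { toFun := fun w => (metricDeriv p u v w + metricDeriv p v u w - metricDeriv p w u v) / 2
      map_add' := fun w w' => by
        simp only [metricDeriv_add_trd, metricDeriv_add_fst]; ring
      map_smul' := fun c w => by
        simp only [metricDeriv_smul_trd, metricDeriv_smul_fst, RingHom.id_apply, smul_eq_mul]
        ring }
  have h : L w = ∑ k, inner ℝ (stdOrthonormalBasis ℝ (TangentSpace 𝓘(ℝ, E) p) k) w *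
      L (stdOrthonormalBasis ℝ (TangentSpace 𝓘(ℝ, E) p) k) := by
    conv_lhs => rw [← (stdOrthonormalBasis ℝ (TangentSpace 𝓘(ℝ, E) p)).sum_repr' w, map_sum]
    simp only [map_smul, smul_eq_mul]
  change _ = L w
  rw [h, christoffel, sum_inner]
  refine Finset.sum_congr rfl fun k _ => ?_
  rw [inner_smul_left, conj_trivial, mul_comm]
  rfl

theorem christoffel_add_right : christoffel p u (v + v') = christoffel p u v + christoffel p u v' :=
  ext_inner_right ℝ fun w => by
    simp only [inner_add_left, inner_christoffel, metricDeriv_add_snd, metricDeriv_add_fst,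
      metricDeriv_add_trd]
    ring

theorem christoffel_smul_right : christoffel p u (c • v) = c • christoffel p u v :=
  ext_inner_right ℝ fun w => by
    simp only [inner_smul_left, inner_christoffel, metricDeriv_smul_snd, metricDeriv_smul_fst,
      metricDeriv_smul_trd, conj_trivial]
    ring

theorem christoffel_comm : christoffel p u v = christoffel p v u :=
  ext_inner_right ℝ fun w => by
    simp only [inner_christoffel]
    rw [metricDeriv_comm p u v w]
    ring

/-- The Christoffel symbols are metric. -/
theorem inner_christoffel_add : inner ℝ (christoffel p u v) w + inner ℝ v (christoffel p u w) =
    metricDeriv p u v w := by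
  rw [real_inner_comm (christoffel p u w) v, inner_christoffel, inner_christoffel,
    metricDeriv_comm p w v u]
  ring

end Christoffel

/-! ### The covariant derivative along a map -/

theorem covAlong_eq (v : TangentSpace 𝓘(ℝ, F) x) : covAlong φ σ x v =
    (trivializationAt E (TangentSpace 𝓘(ℝ, E) (M := N)) (φ x)).symmL ℝ (φ x)
        (mvfderiv 𝓘(ℝ, F) (components φ (φ x) σ) x v)
      + christoffel (φ x) (mfderiv 𝓘(ℝ, F) 𝓘(ℝ, E) φ x v) (σ x) := by
  rw [covAlong, Trivialization.symmL_apply _ (FiberBundle.mem_baseSet_trivializationAt' (φ x))]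
  rfl

theorem covAlong_congr (hστ : ∀ᶠ y in 𝓝 x, τ y = σ y) (v : TangentSpace 𝓘(ℝ, F) x) :
    covAlong φ τ x v = covAlong φ σ x v := by
  have h : components φ (φ x) τ =ᶠ[𝓝 x] components φ (φ x) σ :=
    hστ.mono fun y hy => by simp [components, hy]
  rw [covAlong_eq, covAlong_eq, mvfderiv_congr h, hστ.self_of_nhds]

theorem covAlong_add (hσ : MDiffAlongAt F φ σ x) (hτ : MDiffAlongAt F φ τ x)
    (v : TangentSpace 𝓘(ℝ, F) x) :
    covAlong φ (fun y => σ y + τ y) x v = covAlong φ σ x v + covAlong φ τ x v := by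
  have h : components φ (φ x) (fun y => σ y + τ y) =ᶠ[𝓝 x]
      fun y => components φ (φ x) σ y + components φ (φ x) τ y := by
    filter_upwards [hσ.eventually_mem] with y hy
    simp [components_eq hy]
  have h2 : ∀ u : TangentSpace 𝓘(ℝ, E) (φ x), christoffel (φ x) u (σ x + τ x) =
    christoffel (φ x) u (σ x) + christoffel (φ x) u (τ x) :=
    fun u => christoffel_add_right u _ _
  rw [covAlong_eq, covAlong_eq, covAlong_eq, mvfderiv_congr h,
    mvfderiv_fun_add (mdiffAlongAt_iff.1 hσ).2 (mdiffAlongAt_iff.1 hτ).2, h2]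
  simp only [add_apply, map_add]
  abel

theorem covAlong_smul {f : M → ℝ} (hf : MDifferentiableAt 𝓘(ℝ, F) 𝓘(ℝ, ℝ) f x)
    (hσ : MDiffAlongAt F φ σ x) (v : TangentSpace 𝓘(ℝ, F) x) :
    covAlong φ (fun y => f y • σ y) x v =
      f x • covAlong φ σ x v + mvfderiv 𝓘(ℝ, F) f x v • σ x := by
  have h : components φ (φ x) (fun y => f y • σ y) =ᶠ[𝓝 x]
      fun y => f y • components φ (φ x) σ y := by
    filter_upwards [hσ.eventually_mem] with y hy
    simp [components_eq hy]
  rw [covAlong_eq, covAlong_eq, mvfderiv_congr h,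
    mvfderiv_fun_smul hf (mdiffAlongAt_iff.1 hσ).2, christoffel_smul_right]
  simp only [add_apply, smul_apply, map_add, map_smul, ContinuousLinearMap.smulRight_apply,
    symmL_components (hσ.eventually_mem.self_of_nhds)]
  module

/-- For fields with constant components only the Christoffel term remains. -/
theorem covAlong_extend (hφ : MDifferentiableAt 𝓘(ℝ, F) 𝓘(ℝ, E) φ x)
    (u : TangentSpace 𝓘(ℝ, E) (φ x)) (v : TangentSpace 𝓘(ℝ, F) x) :
    covAlong φ (fun y => (FiberBundle.extend E u (φ y) : TangentSpace 𝓘(ℝ, E) (φ y))) x v =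
      christoffel (φ x) (mfderiv 𝓘(ℝ, F) 𝓘(ℝ, E) φ x v) u := by
  have h : components φ (φ x)
      (fun y => (FiberBundle.extend E u (φ y) : TangentSpace 𝓘(ℝ, E) (φ y))) =ᶠ[𝓝 x]
      fun _ => (trivializationAt E (TangentSpace 𝓘(ℝ, E) (M := N)) (φ x)).continuousLinearMapAt
        ℝ (φ x) u := by
    filter_upwards [(MDiffAlongAt.comp_field (mdiffAlongAt_extend u) hφ).eventually_mem] with y hy
    rw [components_extend hy]
  rw [covAlong_eq, mvfderiv_congr h, mvfderiv_const, FiberBundle.extend_apply_self]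
  simp

/-- The Levi-Civita connection is metric. -/
theorem mvfderiv_inner (hσ : MDiffAlongAt F φ σ x) (hτ : MDiffAlongAt F φ τ x)
    (v : TangentSpace 𝓘(ℝ, F) x) :
    mvfderiv 𝓘(ℝ, F) (fun y => inner ℝ (σ y) (τ y)) x v =
      inner ℝ (covAlong φ σ x v) (τ x) + inner ℝ (σ x) (covAlong φ τ x v) := by
  have hφ := (mdiffAlongAt_iff.1 hσ).1
  let P : (Π y : M, TangentSpace 𝓘(ℝ, E) (φ y)) → (Π y : M, TangentSpace 𝓘(ℝ, E) (φ y)) → Prop :=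
    fun σ τ => mvfderiv 𝓘(ℝ, F) (fun y => inner ℝ (σ y) (τ y)) x v =
      inner ℝ (covAlong φ σ x v) (τ x) + inner ℝ (σ x) (covAlong φ τ x v)
  have hsymm : ∀ σ τ, P σ τ → P τ σ := fun σ τ h => by
    have h1 : (fun y => inner ℝ (τ y) (σ y)) = fun y => inner ℝ (σ y) (τ y) :=
      funext fun y => real_inner_comm _ _
    change mvfderiv 𝓘(ℝ, F) (fun y => inner ℝ (τ y) (σ y)) x v = _
    rw [h1, h, add_comm]
    exact congrArg₂ (· + ·) (real_inner_comm _ _) (real_inner_comm _ _)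
  -- for a fixed second argument, it suffices that the first one has constant components
  have hred : ∀ τ, MDiffAlongAt F φ τ x → (∀ u : TangentSpace 𝓘(ℝ, E) (φ x),
      P (fun y => (FiberBundle.extend E u (φ y) : TangentSpace 𝓘(ℝ, E) (φ y))) τ) →
      ∀ σ, MDiffAlongAt F φ σ x → P σ τ := by
    intro τ hτ h0 σ hσ
    refine mdiffAlong_induction (P := fun σ => P σ τ) hφ h0 ?_ ?_ ?_ hσ
    · intro σ σ' hσ hσ' h h'
      simp only [P, inner_add_left] at h h' ⊢
      rw [mvfderiv_fun_add (hσ.inner hτ) (hσ'.inner hτ), add_apply, h, h', covAlong_add hσ hσ',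
        inner_add_left]
      ring
    · intro f σ hf hσ h
      have h1 : (fun y => inner ℝ (f y • σ y) (τ y)) = fun y => f y • inner ℝ (σ y) (τ y) :=
        funext fun y => by simp [inner_smul_left]
      simp only [P] at h ⊢
      rw [h1, mvfderiv_fun_smul hf (hσ.inner hτ), covAlong_smul hf hσ]
      simp only [add_apply, smul_apply, h, ContinuousLinearMap.smulRight_apply, inner_add_left,
        inner_smul_left, conj_trivial, smul_eq_mul]
      ring
    · intro σ σ' hσ hσσ' h
      have h1 : (fun y => inner ℝ (σ' y) (τ y)) =ᶠ[𝓝 x] fun y => inner ℝ (σ y) (τ y) :=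
        hσσ'.mono fun y hy => by simp only [hy]
      simp only [P] at h ⊢
      rw [mvfderiv_congr h1, h, covAlong_congr hσσ', hσσ'.self_of_nhds]
  have hext : ∀ u : TangentSpace 𝓘(ℝ, E) (φ x), MDiffAlongAt F φ
      (fun y => (FiberBundle.extend E u (φ y) : TangentSpace 𝓘(ℝ, E) (φ y))) x :=
    fun u => MDiffAlongAt.comp_field (mdiffAlongAt_extend u) hφ
  refine hred τ hτ (fun u => hsymm _ _ (hred _ (hext u) (fun w => ?_) τ hτ)) σ hσ
  simp only [P]
  rw [covAlong_extend hφ, covAlong_extend hφ, FiberBundle.extend_apply_self,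
    FiberBundle.extend_apply_self, inner_christoffel_add]
  exact mvfderiv_comp_apply (f := φ) (g := fun q : N =>
    inner ℝ (FiberBundle.extend E w q : TangentSpace 𝓘(ℝ, E) q)
      (FiberBundle.extend E u q : TangentSpace 𝓘(ℝ, E) q)) x
    (mdifferentiableAt_inner_extend w u) hφ v

variable {F' : Type*} [NormedAddCommGroup F'] [NormedSpace ℝ F']
  {L : Type*} [TopologicalSpace L] [ChartedSpace F' L]

theorem MDiffAlongAt.comp {j : L → M} {q : L} (hσ : MDiffAlongAt F φ σ (j q))
    (hj : MDifferentiableAt 𝓘(ℝ, F') 𝓘(ℝ, F) j q) :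
    MDiffAlongAt F' (φ ∘ j) (fun y => σ (j y)) q :=
  MDifferentiableAt.comp q (f := j) hσ hj

/-- The chain rule: the covariant derivative of a field `σ ∘ j` along `φ ∘ j`. -/
theorem covAlong_comp {j : L → M} {q : L} (hσ : MDiffAlongAt F φ σ (j q))
    (hj : MDifferentiableAt 𝓘(ℝ, F') 𝓘(ℝ, F) j q) (w : TangentSpace 𝓘(ℝ, F') q) :
    covAlong (φ ∘ j) (fun y => σ (j y)) q w =
      covAlong φ σ (j q) (mfderiv 𝓘(ℝ, F') 𝓘(ℝ, F) j q w) := by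
  have hφ := (mdiffAlongAt_iff.1 hσ).1
  rw [covAlong_eq, covAlong_eq, ← mvfderiv_comp_vec (mdiffAlongAt_iff.1 hσ).2 hj w,
    mfderiv_comp q hφ hj]
  rfl

end Along

/-! ### Torsion-freeness -/

section Torsion

variable {F : Type*} [NormedAddCommGroup F] [NormedSpace ℝ F]
  {M : Type*} [TopologicalSpace M] [ChartedSpace F M] [IsManifold 𝓘(ℝ, F) ∞ M]

/-- Differentiability at `x` of a vector field. -/
abbrev MDiffFieldAt (X : Π x : M, TangentSpace 𝓘(ℝ, F) x) (x : M) : Prop :=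
  MDifferentiableAt 𝓘(ℝ, F) 𝓘(ℝ, F).tangent (fun y => (⟨y, X y⟩ : TangentBundle 𝓘(ℝ, F) M)) x

variable {G : Type*} [NormedAddCommGroup G] [NormedSpace ℝ G]

theorem fderiv_comp_chart_apply {Φ : M → G} {x : M} {z : F} (hz : z ∈ (extChartAt 𝓘(ℝ, F) x).target)
    (hΦ : MDifferentiableAt 𝓘(ℝ, F) 𝓘(ℝ, G) Φ ((extChartAt 𝓘(ℝ, F) x).symm z)) (u : F) :
    fderiv ℝ (Φ ∘ (extChartAt 𝓘(ℝ, F) x).symm) z u =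
      mvfderiv 𝓘(ℝ, F) Φ ((extChartAt 𝓘(ℝ, F) x).symm z)
        (mfderiv 𝓘(ℝ, F) 𝓘(ℝ, F) (extChartAt 𝓘(ℝ, F) x).symm z u) := by
  have hd : MDifferentiableAt 𝓘(ℝ, F) 𝓘(ℝ, F) (extChartAt 𝓘(ℝ, F) x).symm z :=
    ((contMDiffOn_extChartAt_symm x).contMDiffAt
      ((isOpen_extChartAt_target x).mem_nhds hz)).mdifferentiableAt (n := ∞) (by simp)
  rw [← mvfderiv_comp_vec hΦ hd u, mvfderiv, mfderiv_eq_fderiv]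
  rfl

/-- The directional derivative of a function, computed in the chart at the point. Here `f` is only
assumed to be differentiable when read in the chart. -/
theorem mvfderiv_eq_fderiv_comp_chart {f : M → G} {x : M}
    (hf : DifferentiableAt ℝ (f ∘ (extChartAt 𝓘(ℝ, F) x).symm) (extChartAt 𝓘(ℝ, F) x x))
    (v : TangentSpace 𝓘(ℝ, F) x) :
    mvfderiv 𝓘(ℝ, F) f x v = fderiv ℝ (f ∘ (extChartAt 𝓘(ℝ, F) x).symm) (extChartAt 𝓘(ℝ, F) x x)
      (mfderiv 𝓘(ℝ, F) 𝓘(ℝ, F) (extChartAt 𝓘(ℝ, F) x) x v) := by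
  have h : f =ᶠ[𝓝 x] (f ∘ (extChartAt 𝓘(ℝ, F) x).symm) ∘ extChartAt 𝓘(ℝ, F) x := by
    filter_upwards [extChartAt_source_mem_nhds (I := 𝓘(ℝ, F)) x] with y hy
    simp only [Function.comp_apply, (extChartAt 𝓘(ℝ, F) x).left_inv hy]
  rw [mvfderiv_congr h, mvfderiv_comp_vec hf.mdifferentiableAt
    (contMDiffAt_extChartAt.mdifferentiableAt (n := ∞) (by simp)), mvfderiv, mfderiv_eq_fderiv]
  rfl

variable [CompleteSpace F]

/-- The commutator of two directional derivatives of a vector-valued function. -/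
theorem mvfderiv_mvfderiv_sub {Φ : M → G} {x : M} (hΦ : ContMDiffAt 𝓘(ℝ, F) 𝓘(ℝ, G) ∞ Φ x)
    {X Z : Π x : M, TangentSpace 𝓘(ℝ, F) x} (hX : MDiffFieldAt X x) (hZ : MDiffFieldAt Z x) :
    mvfderiv 𝓘(ℝ, F) (fun y => mvfderiv 𝓘(ℝ, F) Φ y (Z y)) x (X x) -
      mvfderiv 𝓘(ℝ, F) (fun y => mvfderiv 𝓘(ℝ, F) Φ y (X y)) x (Z x) =
      mvfderiv 𝓘(ℝ, F) Φ x (VectorField.mlieBracket 𝓘(ℝ, F) X Z x) := by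
  set ψ := extChartAt 𝓘(ℝ, F) x with hψ
  have hmem : ψ x ∈ ψ.target := mem_extChartAt_target x
  have hxx : ψ.symm (ψ x) = x := extChartAt_to_inv x
  have hΦ' : ∀ᶠ z in 𝓝 (ψ x), ContMDiffAt 𝓘(ℝ, F) 𝓘(ℝ, G) 1 Φ (ψ.symm z) := by
    have h1 : ∀ᶠ y in 𝓝 x, ContMDiffAt 𝓘(ℝ, F) 𝓘(ℝ, G) 1 Φ y :=
      (contMDiffAt_iff_contMDiffAt_nhds (by simp)).1 (hΦ.of_le (mod_cast le_top))
    refine (continuousAt_extChartAt_symm x).eventually ?_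
    rwa [extChartAt_to_inv x]
  have hΦhat : ContDiffAt ℝ ∞ (Φ ∘ ψ.symm) (ψ x) := by
    rw [← contMDiffAt_iff_contDiffAt]
    refine ContMDiffAt.comp (ψ x) (by rwa [hxx]) ?_
    exact (contMDiffOn_extChartAt_symm x).contMDiffAt ((isOpen_extChartAt_target x).mem_nhds hmem)
  have htarget : ∀ᶠ z in 𝓝 (ψ x), z ∈ ψ.target := (isOpen_extChartAt_target x).mem_nhds hmem
  -- the representatives of vector fields in the chart at `x`
  let hat : (Π x : M, TangentSpace 𝓘(ℝ, F) x) → F → F := fun X z =>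
    VectorField.mpullback 𝓘(ℝ, F) 𝓘(ℝ, F) ψ.symm X z
  have hinv : ∀ z ∈ ψ.target, (mfderiv 𝓘(ℝ, F) 𝓘(ℝ, F) ψ.symm z).IsInvertible := fun z hz => by
    have := isInvertible_mfderivWithin_extChartAt_symm (I := 𝓘(ℝ, F)) (x := x) hz
    simpa only [modelWithCornersSelf_coe, range_id, mfderivWithin_univ] using this
  have hhat : ∀ X, ∀ z ∈ ψ.target,
      mfderiv 𝓘(ℝ, F) 𝓘(ℝ, F) ψ.symm z (hat X z) = X (ψ.symm z) := fun X z hz =>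
    (hinv z hz).self_apply_inverse _
  have hhatd : ∀ X, MDiffFieldAt X x → DifferentiableAt ℝ (hat X) (ψ x) := fun X hX => by
    have := MDifferentiableWithinAt.differentiableWithinAt_mpullbackWithin_vectorField
      (mdifferentiableWithinAt_univ.2 hX)
    simp only [modelWithCornersSelf_coe, range_id, VectorField.mpullbackWithin_univ, preimage_univ,
      inter_univ] at this
    exact differentiableWithinAt_univ.1 this
  have hhatx : ∀ X : Π x : M, TangentSpace 𝓘(ℝ, F) x,
      mfderiv 𝓘(ℝ, F) 𝓘(ℝ, F) ψ x (X x) = hat X (ψ x) := fun X => by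
    have := (VectorField.eventuallyEq_mpullback_mpullbackWithin_extChartAt (I := 𝓘(ℝ, F)) (x := x)
      (s := univ) X).self_of_nhdsWithin (mem_univ x)
    rw [this, VectorField.mpullback_apply]
    simp only [modelWithCornersSelf_coe, range_id, VectorField.mpullbackWithin_univ]
    exact (isInvertible_mfderiv_extChartAt (mem_extChartAt_source x)).self_apply_inverse _
  have hrepr : ∀ X : Π x : M, TangentSpace 𝓘(ℝ, F) x,
      ((fun y => mvfderiv 𝓘(ℝ, F) Φ y (X y)) ∘ ψ.symm) =ᶠ[𝓝 (ψ x)]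
        fun z => fderiv ℝ (Φ ∘ ψ.symm) z (hat X z) := fun X => by
    filter_upwards [hΦ', htarget] with z hz hz'
    rw [fderiv_comp_chart_apply hz' (hz.mdifferentiableAt (by simp)), hhat X z hz']
    rfl
  have hdd : DifferentiableAt ℝ (fderiv ℝ (Φ ∘ ψ.symm)) (ψ x) :=
    (hΦhat.fderiv_right (m := 1) (by norm_num [ENat.LEInfty.out])).differentiableAt (by simp)
  have hder : ∀ X Z : Π x : M, TangentSpace 𝓘(ℝ, F) x, MDiffFieldAt Z x →
      mvfderiv 𝓘(ℝ, F) (fun y => mvfderiv 𝓘(ℝ, F) Φ y (Z y)) x (X x) =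
        fderiv ℝ (fderiv ℝ (Φ ∘ ψ.symm)) (ψ x) (hat X (ψ x)) (hat Z (ψ x)) +
          fderiv ℝ (Φ ∘ ψ.symm) (ψ x) (fderiv ℝ (hat Z) (ψ x) (hat X (ψ x))) := by
    intro X Z hZ
    have hdiff := (hdd.clm_apply (hhatd Z hZ)).congr_of_eventuallyEq (hrepr Z)
    rw [mvfderiv_eq_fderiv_comp_chart hdiff, (hrepr Z).fderiv_eq, hhatx,
      fderiv_clm_apply hdd (hhatd Z hZ)]
    simp [add_comm]
  have hsymm := (hΦhat.isSymmSndFDerivAt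
    (by simpa using! (ENat.LEInfty.out : (2 : WithTop ℕ∞) ≤ ∞))) (hat X (ψ x)) (hat Z (ψ x))
  have hbr : mfderiv 𝓘(ℝ, F) 𝓘(ℝ, F) ψ x (VectorField.mlieBracket 𝓘(ℝ, F) X Z x) =
      VectorField.lieBracket ℝ (hat X) (hat Z) (ψ x) := by
    rw [← VectorField.mlieBracketWithin_univ, VectorField.mlieBracketWithin_apply]
    simp only [modelWithCornersSelf_coe, range_id, VectorField.mpullbackWithin_univ, preimage_univ,
      inter_univ]
    refine ((isInvertible_mfderiv_extChartAt
      (mem_extChartAt_source x)).self_apply_inverse _).trans ?_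
    exact congrFun (VectorField.lieBracketWithin_univ (V := hat X) (W := hat Z)) (ψ x)
  rw [hder X Z hZ, hder Z X hX, mvfderiv_eq_fderiv_comp_chart (hΦhat.differentiableAt (by simp)),
    hbr, hsymm, VectorField.lieBracket, map_sub]
  abel

variable {E : Type*} [NormedAddCommGroup E] [NormedSpace ℝ E]
  {N : Type*} [TopologicalSpace N] [ChartedSpace E N] [IsManifold 𝓘(ℝ, E) ∞ N]

/-- The components of `dφ(X)` are the directional derivatives of the coordinate expression of
`φ`. -/
theorem components_pushField {φ : M → N} {x : M} (hφ : ContMDiff 𝓘(ℝ, F) 𝓘(ℝ, E) ∞ φ)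
    (X : Π x : M, TangentSpace 𝓘(ℝ, F) x) :
    components φ (φ x) (pushField φ X) =ᶠ[𝓝 x] fun y =>
      mvfderiv 𝓘(ℝ, F) (extChartAt 𝓘(ℝ, E) (φ x) ∘ φ) y (X y) := by
  filter_upwards [hφ.continuous.continuousAt.eventually_mem (chart_source_mem_nhds E (φ x))]
    with y hy'
  rw [components_eq (by simpa using hy'), mvfderiv_comp_vec
    ((contMDiffAt_extChartAt' hy').mdifferentiableAt (n := ∞) (by simp))
    (hφ.mdifferentiableAt (by simp)), TangentBundle.continuousLinearMapAt_trivializationAt hy']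
  rfl

variable [RiemannianBundle (fun x : N => TangentSpace 𝓘(ℝ, E) x)]
  [IsContMDiffRiemannianBundle 𝓘(ℝ, E) ∞ E (fun p : N => TangentSpace 𝓘(ℝ, E) p)]
  [FiniteDimensional ℝ E]

/-- The Levi-Civita connection is torsion-free. -/
theorem covAlong_pushField_sub {φ : M → N} {x : M} (hφ : ContMDiff 𝓘(ℝ, F) 𝓘(ℝ, E) ∞ φ)
    {X Z : Π x : M, TangentSpace 𝓘(ℝ, F) x} (hX : MDiffFieldAt X x) (hZ : MDiffFieldAt Z x) :
    covAlong φ (pushField φ Z) x (X x) - covAlong φ (pushField φ X) x (Z x) =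
      mfderiv 𝓘(ℝ, F) 𝓘(ℝ, E) φ x (VectorField.mlieBracket 𝓘(ℝ, F) X Z x) := by
  have hΦ : ContMDiffAt 𝓘(ℝ, F) 𝓘(ℝ, E) ∞ (extChartAt 𝓘(ℝ, E) (φ x) ∘ φ) x :=
    contMDiffAt_extChartAt.comp x hφ.contMDiffAt
  have hmem : φ x ∈ (chartAt E (φ x)).source := mem_chart_source E (φ x)
  have h := mvfderiv_mvfderiv_sub hΦ hX hZ
  rw [covAlong_eq, covAlong_eq, mvfderiv_congr (components_pushField hφ Z),
    mvfderiv_congr (components_pushField hφ X), pushField, pushField, christoffel_comm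
    (mfderiv 𝓘(ℝ, F) 𝓘(ℝ, E) φ x (X x)), add_sub_add_right_eq_sub, ← map_sub, h, mvfderiv_comp_vec
    (contMDiffAt_extChartAt.mdifferentiableAt (n := ∞) (by simp))
    (hφ.mdifferentiableAt (by simp))]
  have := TangentBundle.continuousLinearMapAt_trivializationAt (I := 𝓘(ℝ, E)) hmem
  refine Eq.trans ?_ (Trivialization.symmL_continuousLinearMapAt (R := ℝ)
    (trivializationAt E (TangentSpace 𝓘(ℝ, E) (M := N)) (φ x))
    (FiberBundle.mem_baseSet_trivializationAt' (φ x)) _)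
  rw [this]
  rfl

end Torsion

/-! ### Smooth vector fields along a map -/

section SmoothAlong

variable {E : Type*} [NormedAddCommGroup E] [NormedSpace ℝ E]
  {N : Type*} [TopologicalSpace N] [ChartedSpace E N] [IsManifold 𝓘(ℝ, E) ∞ N]
  {F : Type*} [NormedAddCommGroup F] [NormedSpace ℝ F]
  {M : Type*} [TopologicalSpace M] [ChartedSpace F M]
  {φ : M → N} {σ τ : Π x : M, TangentSpace 𝓘(ℝ, E) (φ x)} {x : M}

variable (F) in
/-- Smoothness at `x` of a vector field `σ` along the map `φ`. -/
def SmoothAlongAt (φ : M → N) (σ : Π x : M, TangentSpace 𝓘(ℝ, E) (φ x)) (x : M) : Prop :=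
  ContMDiffAt 𝓘(ℝ, F) 𝓘(ℝ, E).tangent ∞ (fun y => (⟨φ y, σ y⟩ : TangentBundle 𝓘(ℝ, E) N)) x

theorem SmoothAlongAt.mdiff (h : SmoothAlongAt F φ σ x) : MDiffAlongAt F φ σ x :=
  h.mdifferentiableAt (by simp)

theorem smoothAlongAt_iff : SmoothAlongAt F φ σ x ↔ ContMDiffAt 𝓘(ℝ, F) 𝓘(ℝ, E) ∞ φ x ∧
    ContMDiffAt 𝓘(ℝ, F) 𝓘(ℝ, E) ∞ (components φ (φ x) σ) x :=
  contMDiffAt_totalSpace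

theorem SmoothAlongAt.congr (h : SmoothAlongAt F φ σ x) (hστ : ∀ᶠ y in 𝓝 x, τ y = σ y) :
    SmoothAlongAt F φ τ x :=
  ContMDiffAt.congr_of_eventuallyEq h (hστ.mono fun y hy => by simp [hy])

theorem SmoothAlongAt.add (hσ : SmoothAlongAt F φ σ x) (hτ : SmoothAlongAt F φ τ x) :
    SmoothAlongAt F φ (fun y => σ y + τ y) x := by
  refine smoothAlongAt_iff.2 ⟨(smoothAlongAt_iff.1 hσ).1, ?_⟩
  refine ((smoothAlongAt_iff.1 hσ).2.add (smoothAlongAt_iff.1 hτ).2).congr_of_eventuallyEq ?_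
  filter_upwards [hσ.mdiff.eventually_mem] with y hy
  simp [components_eq hy]

theorem SmoothAlongAt.smul {f : M → ℝ} (hf : ContMDiffAt 𝓘(ℝ, F) 𝓘(ℝ, ℝ) ∞ f x)
    (hσ : SmoothAlongAt F φ σ x) : SmoothAlongAt F φ (fun y => f y • σ y) x := by
  refine smoothAlongAt_iff.2 ⟨(smoothAlongAt_iff.1 hσ).1, ?_⟩
  refine (ContMDiffAt.smul hf (smoothAlongAt_iff.1 hσ).2).congr_of_eventuallyEq ?_
  filter_upwards [hσ.mdiff.eventually_mem] with y hy
  simp [components_eq hy]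

theorem SmoothAlongAt.sub (hσ : SmoothAlongAt F φ σ x) (hτ : SmoothAlongAt F φ τ x) :
    SmoothAlongAt F φ (fun y => σ y - τ y) x :=
  (hσ.add (SmoothAlongAt.smul (f := fun _ => -1) contMDiffAt_const hτ)).congr (by
    simp [sub_eq_add_neg])

theorem smoothAlongAt_zero (hφ : ContMDiffAt 𝓘(ℝ, F) 𝓘(ℝ, E) ∞ φ x) :
    SmoothAlongAt F φ (fun y => (0 : TangentSpace 𝓘(ℝ, E) (φ y))) x := by
  refine smoothAlongAt_iff.2 ⟨hφ, ?_⟩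
  refine (contMDiffAt_const (c := (0 : E))).congr_of_eventuallyEq ?_
  filter_upwards [hφ.continuousAt.eventually_mem
    ((trivializationAt E (TangentSpace 𝓘(ℝ, E) (M := N)) (φ x)).open_baseSet.mem_nhds
      (FiberBundle.mem_baseSet_trivializationAt' (φ x)))] with y hy
  simp [components_eq hy]

theorem SmoothAlongAt.sum {ι : Type*} (s : Finset ι) {f : ι → M → ℝ}
    {τ : ι → Π x : M, TangentSpace 𝓘(ℝ, E) (φ x)} (hφ : ContMDiffAt 𝓘(ℝ, F) 𝓘(ℝ, E) ∞ φ x)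
    (hf : ∀ i, ContMDiffAt 𝓘(ℝ, F) 𝓘(ℝ, ℝ) ∞ (f i) x) (hτ : ∀ i, SmoothAlongAt F φ (τ i) x) :
    SmoothAlongAt F φ (fun y => ∑ i ∈ s, f i y • τ i y) x := by
  classical
  induction s using Finset.induction_on with
  | empty => simpa using smoothAlongAt_zero hφ
  | insert a s ha ih =>
    simp only [Finset.sum_insert ha]
    exact (SmoothAlongAt.smul (hf a) (hτ a)).add ih

theorem SmoothAlongAt.comp_field {Y : Π q : N, TangentSpace 𝓘(ℝ, E) q}
    (hY : SmoothAlongAt E (fun q : N => q) Y (φ x)) (hφ : ContMDiffAt 𝓘(ℝ, F) 𝓘(ℝ, E) ∞ φ x) :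
    SmoothAlongAt F φ (fun y => Y (φ y)) x :=
  ContMDiffAt.comp x (f := φ) hY hφ

theorem smoothAlongAt_pushField [IsManifold 𝓘(ℝ, F) ∞ M] (hφ : ContMDiff 𝓘(ℝ, F) 𝓘(ℝ, E) ∞ φ)
    {X : Π x : M, TangentSpace 𝓘(ℝ, F) x} (hX : SmoothAlongAt F (fun y : M => y) X x) :
    SmoothAlongAt F φ (pushField (E := E) φ X) x :=
  ContMDiffAt.comp x (f := fun y => (⟨y, X y⟩ : TangentBundle 𝓘(ℝ, F) M))
    ((hφ.contMDiff_tangentMap (m := ∞) (by simp)).contMDiffAt) hX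

theorem SmoothAlongAt.clm_apply
    {J : Π p : N, TangentSpace 𝓘(ℝ, E) p →L[ℝ] TangentSpace 𝓘(ℝ, E) p}
    (hJ : ContMDiff 𝓘(ℝ, E) (𝓘(ℝ, E).prod 𝓘(ℝ, E →L[ℝ] E)) ∞
      (fun x => TotalSpace.mk' (E →L[ℝ] E) x (J x)))
    (hσ : SmoothAlongAt F φ σ x) : SmoothAlongAt F φ (fun y => J (φ y) (σ y)) x :=
  ContMDiffAt.clm_bundle_apply (hJ.contMDiffAt.comp x (smoothAlongAt_iff.1 hσ).1) hσ

/-- Near `p`, the field with constant components in the chart at `p` is smooth. -/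
theorem exists_smoothAlongAt_extend {p : N} (u : TangentSpace 𝓘(ℝ, E) p) :
    ∃ U : Set N, IsOpen U ∧ p ∈ U ∧ ∀ q ∈ U, SmoothAlongAt E (fun q : N => q)
      (FiberBundle.extend E u : Π q : N, TangentSpace 𝓘(ℝ, E) q) q := by
  obtain ⟨s, hs, h⟩ := FiberBundle.exists_contMDiffOn_extend 𝓘(ℝ, E) E (k := ∞) u
  obtain ⟨U, hUs, hU, hp⟩ := mem_nhds_iff.1 hs
  exact ⟨U, hU, hp, fun q hq => (h.mono hUs).contMDiffAt (hU.mem_nhds hq)⟩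

variable [FiniteDimensional ℝ F] [T2Space M] [IsManifold 𝓘(ℝ, F) ∞ M]

/-- Cutting off a local vector field along `φ`. -/
theorem exists_cutoff {U : Set M} (hU : IsOpen U) (hx : x ∈ U)
    (hφ : ContMDiff 𝓘(ℝ, F) 𝓘(ℝ, E) ∞ φ) (hσ : ∀ y ∈ U, SmoothAlongAt F φ σ y) :
    ∃ f : M → ℝ, (∀ᶠ y in 𝓝 x, f y = 1) ∧ (∀ y, y ∉ U → f y = 0) ∧
      ∀ y, SmoothAlongAt F φ (fun y => f y • σ y) y := by
  obtain ⟨f, -, hf⟩ := (SmoothBumpFunction.nhds_basis_tsupport (I := 𝓘(ℝ, F)) x).mem_iff.1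
    (hU.mem_nhds hx)
  refine ⟨f, f.eventuallyEq_one, fun y hy => image_eq_zero_of_notMem_tsupport fun h => hy (hf h),
    fun y => ?_⟩
  by_cases hy : y ∈ tsupport f
  · exact SmoothAlongAt.smul f.contMDiffAt (hσ y (hf hy))
  · refine (smoothAlongAt_zero hφ.contMDiffAt).congr ?_
    filter_upwards [(isClosed_tsupport f).isOpen_compl.mem_nhds hy] with z hz
    simp [image_eq_zero_of_notMem_tsupport hz]

/-- Every tangent vector extends to a global smooth vector field. -/
theorem exists_smooth_extension {p : M} (u : TangentSpace 𝓘(ℝ, F) p) :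
    ∃ Y : Π q : M, TangentSpace 𝓘(ℝ, F) q, (∀ q, SmoothAlongAt F (fun q : M => q) Y q) ∧
      ∀ᶠ q in 𝓝 p, Y q = FiberBundle.extend F u q := by
  obtain ⟨U, hU, hp, h⟩ := exists_smoothAlongAt_extend (E := F) u
  obtain ⟨f, hf1, -, hf⟩ := exists_cutoff hU hp contMDiff_id h
  exact ⟨_, hf, hf1.mono fun q hq => by rw [hq, one_smul]⟩

end SmoothAlong

/-! ### Orthogonal projection to the span of independent fields -/

section OrthPart

variable {E : Type*} [NormedAddCommGroup E] [NormedSpace ℝ E]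
  {N : Type*} [TopologicalSpace N] [ChartedSpace E N] [IsManifold 𝓘(ℝ, E) ∞ N]
  [RiemannianBundle (fun x : N => TangentSpace 𝓘(ℝ, E) x)]
  [IsContMDiffRiemannianBundle 𝓘(ℝ, E) ∞ E (fun p : N => TangentSpace 𝓘(ℝ, E) p)]
  {F : Type*} [NormedAddCommGroup F] [NormedSpace ℝ F]
  {M : Type*} [TopologicalSpace M] [ChartedSpace F M]
  {φ : M → N} {σ τ : Π x : M, TangentSpace 𝓘(ℝ, E) (φ x)} {x : M}

theorem SmoothAlongAt.inner (hσ : SmoothAlongAt F φ σ x) (hτ : SmoothAlongAt F φ τ x) :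
    ContMDiffAt 𝓘(ℝ, F) 𝓘(ℝ, ℝ) ∞ (fun y => inner ℝ (σ y) (τ y)) x :=
  ContMDiffAt.inner_bundle hσ hτ

theorem contMDiffAt_det {ι : Type*} [Fintype ι] [DecidableEq ι] {A : M → Matrix ι ι ℝ}
    (hA : ∀ i j, ContMDiffAt 𝓘(ℝ, F) 𝓘(ℝ, ℝ) ∞ (fun y => A y i j) x) :
    ContMDiffAt 𝓘(ℝ, F) 𝓘(ℝ, ℝ) ∞ (fun y => (A y).det) x := by
  simp only [Matrix.det_apply']
  refine contMDiffAt_finsetSum fun g _ => ?_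
  exact contMDiffAt_const.mul (contMDiffAt_finsetProd fun i _ => hA _ _)

variable {ι : Type*} [Fintype ι] [DecidableEq ι]

/-- The coefficients of the orthogonal projection of the field `W` to the span of the fields `Y i`,
where these are independent, by Cramer's rule. -/
def projCoeff (Y : ι → Π x : M, TangentSpace 𝓘(ℝ, E) (φ x))
    (W : Π x : M, TangentSpace 𝓘(ℝ, E) (φ x)) (i : ι) (y : M) : ℝ :=
  ((Matrix.gram ℝ fun i => Y i y).det)⁻¹ *
    (Matrix.gram ℝ fun i => Y i y).cramer (fun k => inner ℝ (Y k y) (W y)) i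

variable {Y : ι → Π x : M, TangentSpace 𝓘(ℝ, E) (φ x)} {W : Π x : M, TangentSpace 𝓘(ℝ, E) (φ x)}

theorem contMDiffAt_projCoeff (hY : ∀ i, SmoothAlongAt F φ (Y i) x) (hW : SmoothAlongAt F φ W x)
    (hli : LinearIndependent ℝ fun i => Y i x) (i : ι) :
    ContMDiffAt 𝓘(ℝ, F) 𝓘(ℝ, ℝ) ∞ (projCoeff Y W i) x := by
  refine ContMDiffAt.mul (ContMDiffAt.inv₀ (contMDiffAt_det fun i j => ?_) ?_) ?_
  · exact (hY i).inner (hY j)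
  · exact Matrix.det_gram_ne_zero_iff_linearIndependent.2 hli
  · simp only [Matrix.cramer_apply]
    refine contMDiffAt_det fun k j => ?_
    by_cases hj : j = i
    · subst hj
      simpa only [Matrix.updateCol_self] using (hY k).inner hW
    · simpa only [Matrix.updateCol_ne hj, Matrix.gram_apply] using (hY k).inner (hY j)

/-- The residual of the projection is orthogonal to each `Y j`. -/
theorem inner_sub_projCoeff {y : M} (hli : LinearIndependent ℝ fun i => Y i y) (j : ι) :
    inner ℝ (Y j y) (W y - ∑ i, projCoeff Y W i y • Y i y) = 0 := by
  have hdet := Matrix.det_gram_ne_zero_iff_linearIndependent.2 hli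
  have h := congrFun (Matrix.mulVec_cramer (Matrix.gram ℝ fun i => Y i y)
    (fun k => inner ℝ (Y k y) (W y))) j
  simp only [Matrix.mulVec, dotProduct, Matrix.gram_apply, Pi.smul_apply, smul_eq_mul] at h
  rw [inner_sub_right, inner_sum, sub_eq_zero]
  simp only [inner_smul_right, projCoeff]
  rw [← mul_right_inj' hdet, ← h, Finset.mul_sum]
  refine Finset.sum_congr rfl fun i _ => ?_
  field_simp

theorem projCoeff_eq_zero {y : M} (h : ∀ i, inner ℝ (Y i y) (W y) = 0) (i : ι) :
    projCoeff Y W i y = 0 := by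
  have : (fun k => inner ℝ (Y k y) (W y)) = (0 : ι → ℝ) := funext h
  rw [projCoeff, this, map_zero, Pi.zero_apply, mul_zero]

/-- Linear independence of smooth fields is an open condition. -/
theorem eventually_linearIndependent (hY : ∀ i, SmoothAlongAt F φ (Y i) x)
    (hli : LinearIndependent ℝ fun i => Y i x) :
    ∀ᶠ y in 𝓝 x, LinearIndependent ℝ fun i => Y i y := by
  have h : ContinuousAt (fun y => (Matrix.gram ℝ fun i => Y i y).det) x :=
    (contMDiffAt_det fun i j => (hY i).inner (hY j)).continuousAt
  filter_upwards [h.eventually_ne (Matrix.det_gram_ne_zero_iff_linearIndependent.2 hli)] with y hy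
  exact Matrix.det_gram_ne_zero_iff_linearIndependent.1 hy

end OrthPart

/-! ### The covariant derivative of the complex structure -/

section LeeTensor

variable {E : Type*} [NormedAddCommGroup E] [NormedSpace ℝ E]
  {N : Type*} [TopologicalSpace N] [ChartedSpace E N] [IsManifold 𝓘(ℝ, E) ∞ N]
  [RiemannianBundle (fun x : N => TangentSpace 𝓘(ℝ, E) x)]
  {J : Π p : N, TangentSpace 𝓘(ℝ, E) p →L[ℝ] TangentSpace 𝓘(ℝ, E) p}

theorem IsAlmostHermitian.inner_left (hJ : IsAlmostHermitian J) (p : N)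
    (v w : TangentSpace 𝓘(ℝ, E) p) : inner ℝ (J p v) w = -inner ℝ v (J p w) := by
  rw [← hJ.isometry p v, hJ.sq, inner_neg_right, neg_neg]

theorem IsSmoothField.J_apply (hJ : IsAlmostHermitian J) {X : Π q : N, TangentSpace 𝓘(ℝ, E) q}
    (hX : IsSmoothField X) : IsSmoothField (fun q => J q (X q)) :=
  fun q => SmoothAlongAt.clm_apply (φ := fun q : N => q) hJ.smooth (hX q)

theorem IsSmoothField.mdiff {X : Π q : N, TangentSpace 𝓘(ℝ, E) q} (hX : IsSmoothField X) (p : N) :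
    MDiffAlongAt E (fun q : N => q) X p :=
  SmoothAlongAt.mdiff (φ := fun q : N => q) (hX p)

variable [FiniteDimensional ℝ E]

/-- `∇_A B`, for vector fields on `N`. -/
def nabla (A B : Π q : N, TangentSpace 𝓘(ℝ, E) q) (p : N) : TangentSpace 𝓘(ℝ, E) p :=
  covAlong (fun q : N => q) B p (A p)

/-- `(∇_A J) B`, for vector fields on `N`. -/
def nablaJ (J : Π p : N, TangentSpace 𝓘(ℝ, E) p →L[ℝ] TangentSpace 𝓘(ℝ, E) p)
    (A B : Π q : N, TangentSpace 𝓘(ℝ, E) q) (p : N) : TangentSpace 𝓘(ℝ, E) p :=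
  nabla A (fun q => J q (B q)) p - J p (nabla A B p)

/-- The trilinear expression in the Lee form that equals `2 g(w, (∇_u J) s)` on a locally conformal
Kähler manifold. -/
def leeTensor (J : Π p : N, TangentSpace 𝓘(ℝ, E) p →L[ℝ] TangentSpace 𝓘(ℝ, E) p)
    (lee : Π p : N, TangentSpace 𝓘(ℝ, E) p →L[ℝ] ℝ) (p : N) (u w s : TangentSpace 𝓘(ℝ, E) p) : ℝ :=
  lee p s * inner ℝ u (J p w) - lee p w * inner ℝ u (J p s)
    - lee p (J p w) * inner ℝ u s + lee p (J p s) * inner ℝ u w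

variable [IsContMDiffRiemannianBundle 𝓘(ℝ, E) ∞ E (fun p : N => TangentSpace 𝓘(ℝ, E) p)]
  {lee : Π p : N, TangentSpace 𝓘(ℝ, E) p →L[ℝ] ℝ}
  {X Y Z : Π q : N, TangentSpace 𝓘(ℝ, E) q} {p : N}

theorem nabla_sub_nabla (hX : IsSmoothField X) (hY : IsSmoothField Y) :
    nabla X Y p - nabla Y X p = VectorField.mlieBracket 𝓘(ℝ, E) X Y p := by
  have h := covAlong_pushField_sub (φ := fun q : N => q) contMDiff_id (hX.mdiff p) (hY.mdiff p)
  have hid : ∀ q : N, mfderiv 𝓘(ℝ, E) 𝓘(ℝ, E) (fun q : N => q) q = .id ℝ _ := fun q => mfderiv_id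
  have hp : ∀ X : Π q : N, TangentSpace 𝓘(ℝ, E) q, pushField (E := E) (fun q : N => q) X = X :=
    fun X => funext fun q => by
      have := hid q
      rw [pushField, this]; rfl
  rw [hp, hp, hid] at h
  exact h

theorem dirDeriv_inner (hY : IsSmoothField Y) (hZ : IsSmoothField Z) :
    dirDeriv X (fun y => inner ℝ (Y y) (Z y)) p =
      inner ℝ (nabla X Y p) (Z p) + inner ℝ (Y p) (nabla X Z p) :=
  mvfderiv_inner (hY.mdiff p) (hZ.mdiff p) (X p)

theorem covAlong_neg {F : Type*} [NormedAddCommGroup F] [NormedSpace ℝ F]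
    {M : Type*} [TopologicalSpace M] [ChartedSpace F M] {φ : M → N}
    {σ : Π x : M, TangentSpace 𝓘(ℝ, E) (φ x)} {x : M} (hσ : MDiffAlongAt F φ σ x)
    (v : TangentSpace 𝓘(ℝ, F) x) : covAlong φ (fun y => -σ y) x v = -covAlong φ σ x v := by
  have h := covAlong_smul (f := fun _ => (-1 : ℝ)) mdifferentiableAt_const hσ v
  simpa [mvfderiv_const] using h

/-- `(∇_X J) J = -J (∇_X J)`, from differentiating `J² = -1`. -/
theorem nablaJ_J_apply (hJ : IsAlmostHermitian J) (hY : IsSmoothField Y) :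
    nablaJ J X (fun q => J q (Y q)) p = -J p (nablaJ J X Y p) := by
  have h1 : (fun q => J q (J q (Y q))) = fun q => -Y q := funext fun q => hJ.sq q _
  rw [nablaJ, nablaJ, h1, map_sub, hJ.sq, nabla, covAlong_neg (hY.mdiff p)]
  simp only [nabla]
  abel

/-- `∇_X J` is skew-adjoint, like `J`. -/
theorem inner_nablaJ_left (hJ : IsAlmostHermitian J) (hY : IsSmoothField Y)
    (hZ : IsSmoothField Z) :
    inner ℝ (nablaJ J X Y p) (Z p) = -inner ℝ (Y p) (nablaJ J X Z p) := by
  have h1 : (fun y => inner ℝ (J y (Y y)) (Z y)) = fun y => (-1 : ℝ) • inner ℝ (Y y) (J y (Z y)) :=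
    funext fun y => by rw [hJ.inner_left]; simp
  have h2 := dirDeriv_inner (X := X) (p := p) (hY.J_apply hJ) hZ
  have h3 := dirDeriv_inner (X := X) (p := p) hY (hZ.J_apply hJ)
  rw [h1, dirDeriv, mvfderiv_fun_smul (a := fun _ => (-1 : ℝ)) mdifferentiableAt_const
    (MDiffAlongAt.inner (φ := fun q : N => q) (hY.mdiff p) ((hZ.J_apply hJ).mdiff p)),
    mvfderiv_const] at h2
  rw [dirDeriv] at h3
  simp only [add_apply, smul_apply, ContinuousLinearMap.smulRight_apply, zero_apply, h3,
    smul_eq_mul] at h2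
  have h4 := hJ.inner_left p (nabla X Y p) (Z p)
  have h5 := hJ.inner_left p (Y p) (nabla X Z p)
  rw [nablaJ, nablaJ, inner_sub_left, inner_sub_right]
  linarith

/-- The exterior derivative of the Kähler form is the cyclic sum of `g(Y, (∇_X J) Z)`. -/
theorem extDerivTwo_kahlerForm (hJ : IsAlmostHermitian J) (hX : IsSmoothField X)
    (hY : IsSmoothField Y) (hZ : IsSmoothField Z) :
    extDerivTwo (kahlerForm J) X Y Z p = inner ℝ (Y p) (nablaJ J X Z p)
      + inner ℝ (Z p) (nablaJ J Y X p) + inner ℝ (X p) (nablaJ J Z Y p) := by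
  have h0 := inner_nablaJ_left (X := Y) (p := p) hJ hX hZ
  rw [real_inner_comm] at h0
  have h1 := hJ.inner_left p (nabla X Z p) (Y p)
  have h2 := hJ.inner_left p (nabla Y Z p) (X p)
  have h3 := hJ.inner_left p (nabla Z Y p) (X p)
  rw [real_inner_comm] at h1 h2 h3
  have h4 : inner ℝ (Z p) (nablaJ J Y X p) = -inner ℝ (X p) (nablaJ J Y Z p) := h0
  rw [h4]
  simp only [extDerivTwo, kahlerForm, dirDeriv_inner hY (hZ.J_apply hJ),
    dirDeriv_inner hX (hZ.J_apply hJ), dirDeriv_inner hX (hY.J_apply hJ), ← nabla_sub_nabla hX hY,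
    ← nabla_sub_nabla hX hZ, ← nabla_sub_nabla hY hZ, inner_sub_left, nablaJ, inner_sub_right]
  linarith

/-- The Nijenhuis tensor, with all brackets expressed by the torsion-free connection. -/
theorem nijenhuis_eq (hJ : IsAlmostHermitian J) (hX : IsSmoothField X) (hY : IsSmoothField Y) :
    nijenhuis J X Y p = nablaJ J (fun q => J q (X q)) Y p - nablaJ J (fun q => J q (Y q)) X p
      + J p (nablaJ J Y X p) - J p (nablaJ J X Y p) := by
  rw [nijenhuis, ← nabla_sub_nabla (hX.J_apply hJ) (hY.J_apply hJ),
    ← nabla_sub_nabla (hX.J_apply hJ) hY, ← nabla_sub_nabla hX (hY.J_apply hJ),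
    ← nabla_sub_nabla hX hY]
  simp only [nablaJ, map_sub, hJ.sq]
  abel

/-- The covariant derivative of `J` on a locally conformal Kähler manifold, a linear combination of
the values of `dΩ` at `(X, Y, Z)` and `(X, JY, JZ)` and of the Nijenhuis tensor at `(Y, Z)`, which
vanishes. -/
theorem two_mul_inner_nablaJ (hJ : IsLCK J) (hlee : IsLeeForm J lee) (hX : IsSmoothField X)
    (hY : IsSmoothField Y) (hZ : IsSmoothField Z) :
    2 * inner ℝ (Y p) (nablaJ J X Z p) = leeTensor J lee p (X p) (Y p) (Z p) := by
  have hH := hJ.almostHermitian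
  obtain ⟨U, f, -, hp, -, -, hN, -⟩ := hJ.locallyConformal p
  have hN' : inner ℝ (X p) (J p (nijenhuis J Y Z p)) = 0 := by
    rw [hN Y Z hY hZ p hp, map_zero, inner_zero_right]
  have hd := hlee.deriv_kahlerForm X Y Z hX hY hZ p
  have hd' := hlee.deriv_kahlerForm X _ _ hX (hY.J_apply hH) (hZ.J_apply hH) p
  rw [extDerivTwo_kahlerForm hH hX hY hZ] at hd
  rw [extDerivTwo_kahlerForm hH hX (hY.J_apply hH) (hZ.J_apply hH)] at hd'
  rw [nijenhuis_eq hH hY hZ] at hN'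
  have h1 := inner_nablaJ_left (X := Y) (p := p) hH hX hZ
  have h2 := inner_nablaJ_left (X := fun q => J q (Y q)) (p := p) hH hX (hZ.J_apply hH)
  rw [real_inner_comm] at h1 h2
  simp only [nablaJ_J_apply hH hY, nablaJ_J_apply hH hZ, inner_neg_right, kahlerForm, hH.isometry,
    hH.sq, map_sub, map_add, inner_sub_right, inner_add_right, hH.inner_left p (Y p) (Z p)]
    at hN' hd hd' h1 h2
  rw [leeTensor]
  linarith

variable {F : Type*} [NormedAddCommGroup F] [NormedSpace ℝ F] {M : Type*} [TopologicalSpace M]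
  [ChartedSpace F M] {φ : M → N} {σ : Π x : M, TangentSpace 𝓘(ℝ, E) (φ x)} {x : M}

theorem MDiffAlongAt.J_apply (hJ : IsAlmostHermitian J) (hσ : MDiffAlongAt F φ σ x) :
    MDiffAlongAt F φ (fun y => J (φ y) (σ y)) x :=
  MDifferentiableAt.clm_bundle_apply
    ((hJ.smooth.mdifferentiable (by simp) (φ x)).comp x (mdiffAlongAt_iff.1 hσ).1) hσ

/-- `two_mul_inner_nablaJ` for fields along a map. Both sides are linear over functions in `σ`, so
it suffices to consider the restriction of a field on the ambient manifold. -/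
theorem two_mul_inner_covAlong_J [T2Space N] (hJ : IsLCK J) (hlee : IsLeeForm J lee)
    (hσ : MDiffAlongAt F φ σ x) (v : TangentSpace 𝓘(ℝ, F) x) (w : TangentSpace 𝓘(ℝ, E) (φ x)) :
    2 * inner ℝ w (covAlong φ (fun y => J (φ y) (σ y)) x v - J (φ x) (covAlong φ σ x v)) =
      leeTensor J lee (φ x) (mfderiv 𝓘(ℝ, F) 𝓘(ℝ, E) φ x v) w (σ x) := by
  have hH := hJ.almostHermitian
  have hφ := (mdiffAlongAt_iff.1 hσ).1
  refine mdiffAlong_induction (P := fun σ => 2 * inner ℝ w (covAlong φ (fun y => J (φ y) (σ y)) x v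
    - J (φ x) (covAlong φ σ x v)) = leeTensor J lee (φ x) (mfderiv 𝓘(ℝ, F) 𝓘(ℝ, E) φ x v) w (σ x))
    hφ (fun u => ?_) ?_ ?_ ?_ hσ
  · obtain ⟨Z, hZ, hZu⟩ := exists_smooth_extension u
    obtain ⟨X, hX, hXv⟩ := exists_smooth_extension (mfderiv 𝓘(ℝ, F) 𝓘(ℝ, E) φ x v)
    obtain ⟨Y, hY, hYw⟩ := exists_smooth_extension w
    have hZ' : IsSmoothField Z := hZ
    have h := two_mul_inner_nablaJ (p := φ x) hJ hlee hX hY hZ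
    have h1 : ∀ᶠ y in 𝓝 x, (FiberBundle.extend E u (φ y) : TangentSpace 𝓘(ℝ, E) (φ y)) = Z (φ y) :=
      hφ.continuousAt.eventually (hZu.mono fun q hq => hq.symm)
    have h2 := covAlong_comp (φ := fun q : N => q) (hZ'.mdiff (φ x)) hφ v
    have h3 := covAlong_comp (φ := fun q : N => q) ((hZ'.J_apply hH).mdiff (φ x)) hφ v
    rw [covAlong_congr h1, covAlong_congr (σ := fun y => J (φ y) (Z (φ y)))
      (h1.mono fun y hy => congrArg (J (φ y)) hy)]
    beta_reduce
    rw [h1.self_of_nhds]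
    rw [nablaJ, nabla, nabla, hXv.self_of_nhds, hYw.self_of_nhds, FiberBundle.extend_apply_self,
      FiberBundle.extend_apply_self, ← h2, ← h3] at h
    exact h
  · intro σ τ hσ hτ h h'
    simp only [map_add, covAlong_add hσ hτ, covAlong_add (hσ.J_apply hH) (hτ.J_apply hH),
      leeTensor, inner_add_right, inner_sub_right] at h h' ⊢
    linarith
  · intro f σ hf hσ h
    simp only [map_smul, map_add, covAlong_smul hf hσ, covAlong_smul hf (hσ.J_apply hH),
      leeTensor, inner_add_right, inner_sub_right, inner_smul_right, smul_eq_mul] at h ⊢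
    linear_combination f x * h
  · intro σ τ hσ hστ h
    rw [covAlong_congr hστ, covAlong_congr (σ := fun y => J (φ y) (σ y))
      (hστ.mono fun y hy => by rw [hy]), hστ.self_of_nhds]
    exact h

end LeeTensor

/-! ### Subbundles along an immersion and extension of vectors to sections -/

section Extension

variable {E : Type*} [NormedAddCommGroup E] [NormedSpace ℝ E]
  {N : Type*} [TopologicalSpace N] [ChartedSpace E N] [IsManifold 𝓘(ℝ, E) ∞ N]
  {F : Type*} [NormedAddCommGroup F] [NormedSpace ℝ F] [FiniteDimensional ℝ F]
  {M : Type*} [TopologicalSpace M] [T2Space M] [ChartedSpace F M] [IsManifold 𝓘(ℝ, F) ∞ M]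
  {φ : M → N} {D : Π x : M, Submodule ℝ (TangentSpace 𝓘(ℝ, F) x)}

/-- A vector of a family of subspaces with a smooth spanning set near the point extends to a global
section: take constant coefficients and cut off. -/
theorem exists_section_of_frame {x : M} (hφ : ContMDiff 𝓘(ℝ, F) 𝓘(ℝ, E) ∞ φ) {ι : Type*} [Fintype ι]
    {V : Π x : M, Submodule ℝ (TangentSpace 𝓘(ℝ, E) (φ x))} {U : Set M} (hU : IsOpen U) (hx : x ∈ U)
    {Y : ι → Π y : M, TangentSpace 𝓘(ℝ, E) (φ y)}
    (hY : ∀ i, ∀ y ∈ U, SmoothAlongAt F φ (Y i) y)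
    (hV : ∀ y ∈ U, Submodule.span ℝ (Set.range fun i => Y i y) = V y)
    {v : TangentSpace 𝓘(ℝ, E) (φ x)} (hv : v ∈ V x) :
    ∃ σ, IsSectionAlong (F := F) φ V σ ∧ σ x = v := by
  rw [← hV x hx, Submodule.mem_span_range_iff_exists_fun] at hv
  obtain ⟨c, rfl⟩ := hv
  obtain ⟨f, hf1, hf0, hf⟩ := exists_cutoff (F := F) (σ := fun y => ∑ i, c i • Y i y) hU hx hφ
    fun y hy => SmoothAlongAt.sum _ hφ.contMDiffAt (fun i => contMDiffAt_const (c := c i))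
      fun i => hY i y hy
  refine ⟨_, ⟨hf, fun y => ?_⟩, by simp only [hf1.self_of_nhds, one_smul]⟩
  by_cases hy : y ∈ U
  · refine Submodule.smul_mem _ _ (Submodule.sum_mem _ fun i _ => Submodule.smul_mem _ _ ?_)
    rw [← hV y hy]
    exact Submodule.subset_span (mem_range_self i)
  · simp only [hf0 y hy, zero_smul, Submodule.zero_mem]

/-- A vector of a distribution extends to a section. -/
theorem IsSmoothDistribution.exists_section (hD : IsSmoothDistribution D) {x : M}
    {v : TangentSpace 𝓘(ℝ, F) x} (hv : v ∈ D x) : ∃ X, IsSectionOf D X ∧ X x = v := by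
  obtain ⟨U, hU, hx, k, X, hX, hXD⟩ := hD x
  exact exists_section_of_frame (φ := fun y : M => y) contMDiff_id hU hx
    (fun i y hy => (hX i).contMDiffAt (hU.mem_nhds hy)) (fun y hy => (hXD y hy).2) hv

end Extension

section Subbundles

variable {E : Type*} [NormedAddCommGroup E] [NormedSpace ℝ E] [FiniteDimensional ℝ E]
  {N : Type*} [TopologicalSpace N] [ChartedSpace E N] [IsManifold 𝓘(ℝ, E) ∞ N]
  [RiemannianBundle (fun x : N => TangentSpace 𝓘(ℝ, E) x)]
  [IsContMDiffRiemannianBundle 𝓘(ℝ, E) ∞ E (fun p : N => TangentSpace 𝓘(ℝ, E) p)]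
  {F : Type*} [NormedAddCommGroup F] [NormedSpace ℝ F] [FiniteDimensional ℝ F]
  {M : Type*} [TopologicalSpace M] [T2Space M] [ChartedSpace F M] [IsManifold 𝓘(ℝ, F) ∞ M]
  {φ : M → N} {D : Π x : M, Submodule ℝ (TangentSpace 𝓘(ℝ, F) x)}

theorem linearIndependent_pushField {x : M}
    (hinj : Function.Injective (mfderiv 𝓘(ℝ, F) 𝓘(ℝ, E) φ x))
    {ι : Type*} (X : ι → Π x : M, TangentSpace 𝓘(ℝ, F) x) :
    (LinearIndependent ℝ fun i => pushField (E := E) φ (X i) x) ↔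
      LinearIndependent ℝ fun i => X i x :=
  LinearMap.linearIndependent_iff_of_injOn (mfderiv 𝓘(ℝ, F) 𝓘(ℝ, E) φ x).toLinearMap
    (hinj.injOn)

/-- `D` and `D^⊥` are complementary in `TM`; as `D^⊥` is defined by means of the induced metric,
this requires an immersion. -/
theorem isCompl_orthCompl {x : M} (hinj : Function.Injective (mfderiv 𝓘(ℝ, F) 𝓘(ℝ, E) φ x)) :
    IsCompl (D x) (orthCompl E φ D x) := by
  constructor
  · rw [Submodule.disjoint_def]
    intro v hv hv'
    have h1 : mfderiv 𝓘(ℝ, F) 𝓘(ℝ, E) φ x v ∈ push φ D x := Submodule.mem_map_of_mem hv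
    have h2 : mfderiv 𝓘(ℝ, F) 𝓘(ℝ, E) φ x v ∈ (push φ D x)ᗮ := hv'
    have h3 := (Submodule.orthogonal_disjoint (push (E := E) φ D x)).le_bot ⟨h1, h2⟩
    exact hinj (h3.trans (map_zero _).symm)
  · rw [codisjoint_iff, eq_top_iff]
    intro v _
    obtain ⟨y, hy, z, hz, hyz⟩ := (push (E := E) φ D x).exists_add_mem_mem_orthogonal
      (mfderiv 𝓘(ℝ, F) 𝓘(ℝ, E) φ x v)
    obtain ⟨d, hd, hdy⟩ := Submodule.mem_map.1 hy
    refine Submodule.mem_sup.2 ⟨d, hd, v - d, ?_, by abel⟩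
    have h1 : mfderiv 𝓘(ℝ, F) 𝓘(ℝ, E) φ x (v - d) = z := by
      rw [map_sub, hyz, ← hdy]
      exact add_sub_cancel_left _ _
    change mfderiv 𝓘(ℝ, F) 𝓘(ℝ, E) φ x (v - d) ∈ (push (E := E) φ D x)ᗮ
    rwa [h1]

/-- The orthogonal complement of a smooth distribution is a smooth distribution. -/
theorem IsSmoothDistribution.orthCompl (hφ : IsSmoothImmersion E F φ)
    (hD : IsSmoothDistribution D) :
    IsSmoothDistribution (orthCompl E φ D) := by
  intro x
  obtain ⟨U, hU, hx, k, X, hX, hXD⟩ := hD x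
  have hXs : ∀ i, ∀ y ∈ U, SmoothAlongAt F (fun y : M => y) (X i) y :=
    fun i y hy => (hX i).contMDiffAt (hU.mem_nhds hy)
  -- extend a basis of the complement at `x`, and project
  let b := Module.finBasis ℝ (CRLCK.orthCompl E φ D x)
  set l := Module.finrank ℝ (CRLCK.orthCompl E φ D x) with hl
  choose W hW hWb using fun a => exists_smooth_extension (b a : TangentSpace 𝓘(ℝ, F) x)
  have hWx : ∀ a, W a x = b a := fun a => by
    rw [(hWb a).self_of_nhds, FiberBundle.extend_apply_self]
  let dX : Fin k → Π x : M, TangentSpace 𝓘(ℝ, E) (φ x) := fun i => pushField φ (X i)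
  have hdX : ∀ i, ∀ y ∈ U, SmoothAlongAt F φ (dX i) y := fun i y hy =>
    smoothAlongAt_pushField hφ.smooth (hXs i y hy)
  have hdW : ∀ a y, SmoothAlongAt F φ (pushField (E := E) φ (W a)) y := fun a y =>
    smoothAlongAt_pushField hφ.smooth (hW a y)
  have hdXli : ∀ y ∈ U, LinearIndependent ℝ fun i => dX i y := fun y hy =>
    (linearIndependent_pushField (hφ.injective_mfderiv y) X).2 (hXD y hy).1
  let Z : Fin l → Π y : M, TangentSpace 𝓘(ℝ, F) y := fun a y =>
    W a y - ∑ i, projCoeff dX (pushField φ (W a)) i y • X i y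
  have hZ : ∀ a, ∀ y ∈ U, SmoothAlongAt F (fun y : M => y) (Z a) y := fun a y hy =>
    SmoothAlongAt.sub (φ := fun y : M => y) (hW a y)
      (SmoothAlongAt.sum (φ := fun y : M => y) _ contMDiffAt_id
        (fun i => contMDiffAt_projCoeff (fun i => hdX i y hy) (hdW a y) (hdXli y hy) i)
        fun i => hXs i y hy)
  have hdZ : ∀ a y, pushField (E := E) φ (Z a) y =
      pushField φ (W a) y - ∑ i, projCoeff dX (pushField φ (W a)) i y • dX i y := fun a y => by
    simp only [pushField, Z, map_sub, map_sum, map_smul, dX]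
  have hspan : ∀ y ∈ U, Submodule.span ℝ (Set.range fun i => dX i y) = push φ D y := fun y hy => by
    rw [push, ← (hXD y hy).2, Submodule.map_span, ← Set.range_comp]
    rfl
  have hZmem : ∀ a, ∀ y ∈ U, Z a y ∈ CRLCK.orthCompl E φ D y := fun a y hy => by
    change pushField φ (Z a) y ∈ (push (E := E) φ D y)ᗮ
    rw [← hspan y hy, hdZ, Submodule.mem_orthogonal]
    intro u hu
    induction hu using Submodule.span_induction with
    | mem u hu => obtain ⟨i, rfl⟩ := hu; exact inner_sub_projCoeff (hdXli y hy) i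
    | zero => simp
    | add u v _ _ h h' => rw [inner_add_left, h, h', add_zero]
    | smul c u _ h => rw [inner_smul_left, h, mul_zero]
  have hZx : ∀ a, Z a x = b a := fun a => by
    have h0 : ∀ i, projCoeff dX (pushField φ (W a)) i x = 0 := fun i => by
      refine projCoeff_eq_zero (fun i => ?_) i
      have h1 : pushField φ (W a) x ∈ (push (E := E) φ D x)ᗮ := by
        rw [pushField, hWx]; exact (b a).2
      refine h1 _ ?_
      rw [← hspan x hx]
      exact Submodule.subset_span (mem_range_self i)
    simp only [Z, h0, zero_smul, Finset.sum_const_zero, sub_zero, hWx]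
  have hli : LinearIndependent ℝ fun a => pushField (E := E) φ (Z a) x := by
    rw [linearIndependent_pushField (hφ.injective_mfderiv x)]
    simp only [hZx]
    exact b.linearIndependent.map' (CRLCK.orthCompl E φ D x).subtype (Submodule.ker_subtype _)
  obtain ⟨V, hVsub, hV, hxV⟩ := mem_nhds_iff.1 ((eventually_linearIndependent
    (fun a => smoothAlongAt_pushField hφ.smooth (hZ a x hx)) hli).and (hU.mem_nhds hx))
  have hfin : ∀ y ∈ U, k + Module.finrank ℝ (CRLCK.orthCompl E φ D y) = Module.finrank ℝ F :=
    fun y hy => by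
      have h1 := Submodule.finrank_add_eq_of_isCompl
        (isCompl_orthCompl (D := D) (hφ.injective_mfderiv y))
      have h2 : Module.finrank ℝ (D y) = k := by
        rw [← (hXD y hy).2, finrank_span_eq_card (hXD y hy).1, Fintype.card_fin]
      rw [h2] at h1
      exact h1
  refine ⟨V, hV, hxV, l, Z, fun a y hy => (hZ a y (hVsub hy).2).contMDiffWithinAt, fun y hy => ?_⟩
  have hliy := (linearIndependent_pushField (hφ.injective_mfderiv y) Z).1 (hVsub hy).1
  refine ⟨hliy, Submodule.eq_of_le_of_finrank_eq (Submodule.span_le.2 ?_) ?_⟩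
  · rintro _ ⟨a, rfl⟩
    exact hZmem a y (hVsub hy).2
  · rw [finrank_span_eq_card hliy, Fintype.card_fin]
    have h1 := hfin y (hVsub hy).2
    have h2 := hfin x hx
    omega

/-- Smooth subbundles of the pull-back of `TN` along `φ`, given by local frames. -/
def IsSmoothSubbundle (F : Type*) [NormedAddCommGroup F] [NormedSpace ℝ F]
    {M : Type*} [TopologicalSpace M] [ChartedSpace F M] (φ : M → N)
    (V : Π x : M, Submodule ℝ (TangentSpace 𝓘(ℝ, E) (φ x))) : Prop :=
  ∀ x : M, ∃ U : Set M, IsOpen U ∧ x ∈ U ∧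
    ∃ (ι : Type) (_ : Fintype ι) (Y : ι → Π y : M, TangentSpace 𝓘(ℝ, E) (φ y)),
      (∀ i, ∀ y ∈ U, SmoothAlongAt F φ (Y i) y) ∧
      ∀ y ∈ U, LinearIndependent ℝ (fun i => Y i y) ∧
        Submodule.span ℝ (Set.range fun i => Y i y) = V y

variable {V W : Π x : M, Submodule ℝ (TangentSpace 𝓘(ℝ, E) (φ x))}

theorem IsSmoothDistribution.push (hφ : IsSmoothImmersion E F φ) (hD : IsSmoothDistribution D) :
    IsSmoothSubbundle F φ (push (E := E) φ D) := by
  intro x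
  obtain ⟨U, hU, hx, k, X, hX, hXD⟩ := hD x
  refine ⟨U, hU, hx, Fin k, inferInstance, fun i => pushField φ (X i), fun i y hy =>
    smoothAlongAt_pushField hφ.smooth ((hX i).contMDiffAt (hU.mem_nhds hy)), fun y hy =>
    ⟨(linearIndependent_pushField (hφ.injective_mfderiv y) X).2 (hXD y hy).1, ?_⟩⟩
  rw [CRLCK.push, ← (hXD y hy).2, Submodule.map_span, ← Set.range_comp]
  rfl

theorem IsSmoothSubbundle.sup (hV : IsSmoothSubbundle F φ V) (hW : IsSmoothSubbundle F φ W)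
    (hVW : ∀ x, Disjoint (V x) (W x)) : IsSmoothSubbundle F φ (fun x => V x ⊔ W x) := by
  intro x
  obtain ⟨U, hU, hx, ι, _, Y, hY, hYV⟩ := hV x
  obtain ⟨U', hU', hx', ι', _, Y', hY', hYV'⟩ := hW x
  refine ⟨U ∩ U', hU.inter hU', ⟨hx, hx'⟩, ι ⊕ ι', inferInstance, Sum.elim Y Y', ?_, ?_⟩
  · rintro (i | i) y hy
    exacts [hY i y hy.1, hY' i y hy.2]
  · intro y hy
    have h : (fun i => (Sum.elim Y Y' i : Π y : M, TangentSpace 𝓘(ℝ, E) (φ y)) y) =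
      Sum.elim (fun i => Y i y) (fun i => Y' i y) := by
      funext i; cases i <;> rfl
    rw [h, Set.Sum.elim_range, Submodule.span_union, (hYV y hy.1).2, (hYV' y hy.2).2]
    refine ⟨(hYV y hy.1).1.sum_type (hYV' y hy.2).1 ?_, rfl⟩
    rw [(hYV y hy.1).2, (hYV' y hy.2).2]
    exact hVW y

theorem IsSmoothSubbundle.map_J
    {J : Π p : N, TangentSpace 𝓘(ℝ, E) p →L[ℝ] TangentSpace 𝓘(ℝ, E) p} (hJ : IsAlmostHermitian J)
    (hV : IsSmoothSubbundle F φ V) :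
    IsSmoothSubbundle F φ (fun x => (V x).map (J (φ x)).toLinearMap) := by
  intro x
  obtain ⟨U, hU, hx, ι, _, Y, hY, hYV⟩ := hV x
  refine ⟨U, hU, hx, ι, inferInstance, fun i y => J (φ y) (Y i y), fun i y hy =>
    SmoothAlongAt.clm_apply hJ.smooth (hY i y hy), fun y hy => ⟨?_, ?_⟩⟩
  · refine (hYV y hy).1.map' (J (φ y)).toLinearMap (LinearMap.ker_eq_bot.2 fun v w h => ?_)
    have h1 : J (φ y) (J (φ y) v) = J (φ y) (J (φ y) w) := congrArg (J (φ y)) h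
    rwa [hJ.sq, hJ.sq, neg_inj] at h1
  · beta_reduce
    rw [← (hYV y hy).2, Submodule.map_span, ← Set.range_comp]
    rfl

/-- A vector orthogonal to a smooth subbundle extends to a section of the orthogonal complement. -/
theorem IsSmoothSubbundle.exists_orthogonal_section [T2Space N] (hφ : ContMDiff 𝓘(ℝ, F) 𝓘(ℝ, E) ∞ φ)
    (hV : IsSmoothSubbundle F φ V) {x : M} {w : TangentSpace 𝓘(ℝ, E) (φ x)} (hw : w ∈ (V x)ᗮ) :
    ∃ ξ, IsSectionAlong (F := F) φ (fun x => (V x)ᗮ) ξ ∧ ξ x = w := by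
  classical
  obtain ⟨U, hU, hx, ι, _, Y, hY, hYV⟩ := hV x
  obtain ⟨W, hW, hWw⟩ := exists_smooth_extension w
  have hWφ : ∀ y, SmoothAlongAt F φ (fun y => W (φ y)) y := fun y =>
    SmoothAlongAt.comp_field (hW (φ y)) hφ.contMDiffAt
  obtain ⟨f, hf1, hf0, hf⟩ := exists_cutoff (F := F)
    (σ := fun y => W (φ y) - ∑ i, projCoeff Y (fun y => W (φ y)) i y • Y i y) hU hx hφ
    fun y hy => (hWφ y).sub (SmoothAlongAt.sum _ hφ.contMDiffAt
      (contMDiffAt_projCoeff (fun i => hY i y hy) (hWφ y) (hYV y hy).1) fun i => hY i y hy)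
  refine ⟨_, ⟨hf, fun y => ?_⟩, ?_⟩
  · by_cases hy : y ∈ U
    · refine Submodule.smul_mem _ _ ?_
      beta_reduce
      rw [← (hYV y hy).2, Submodule.mem_orthogonal]
      intro u hu
      induction hu using Submodule.span_induction with
      | mem u hu =>
        obtain ⟨i, rfl⟩ := hu
        exact inner_sub_projCoeff (W := fun y => W (φ y)) (hYV y hy).1 i
      | zero => simp
      | add u v _ _ h h' => rw [inner_add_left, h, h', add_zero]
      | smul c u _ h => rw [inner_smul_left, h, mul_zero]
    · simp only [hf0 y hy, zero_smul, Submodule.zero_mem]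
  · have hWx : W (φ x) = w := by rw [hWw.self_of_nhds, FiberBundle.extend_apply_self]
    have h0 : ∀ i, projCoeff Y (fun y => W (φ y)) i x = 0 := fun i => by
      refine projCoeff_eq_zero (fun i => ?_) i
      rw [hWx]
      refine hw _ ?_
      rw [← (hYV x hx).2]
      exact Submodule.subset_span (mem_range_self i)
    simp only [hf1.self_of_nhds, one_smul, h0, zero_smul, Finset.sum_const_zero, sub_zero, hWx]

end Subbundles

/-! ### The tangent and normal decompositions of a CR-submanifold -/

section Decomposition

theorem inner_starProjection_of_mem {H : Type*} [NormedAddCommGroup H] [InnerProductSpace ℝ H]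
    (K : Submodule ℝ H) [K.HasOrthogonalProjection] {c n : H} (hn : n ∈ K) :
    inner ℝ (K.starProjection c) n = inner ℝ c n := by
  rw [Submodule.inner_starProjection_left_eq_right, Submodule.starProjection_eq_self_iff.2 hn]

variable {E : Type*} [NormedAddCommGroup E] [NormedSpace ℝ E] [FiniteDimensional ℝ E]
  {N : Type*} [TopologicalSpace N] [ChartedSpace E N] [IsManifold 𝓘(ℝ, E) ∞ N]
  [RiemannianBundle (fun x : N => TangentSpace 𝓘(ℝ, E) x)]
  [IsContMDiffRiemannianBundle 𝓘(ℝ, E) ∞ E (fun p : N => TangentSpace 𝓘(ℝ, E) p)]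
  {F : Type*} [NormedAddCommGroup F] [NormedSpace ℝ F] [FiniteDimensional ℝ F]
  {M : Type*} [TopologicalSpace M] [T2Space M] [ChartedSpace F M] [IsManifold 𝓘(ℝ, F) ∞ M]
  {φ : M → N} {D : Π x : M, Submodule ℝ (TangentSpace 𝓘(ℝ, F) x)}
  {J : Π p : N, TangentSpace 𝓘(ℝ, E) p →L[ℝ] TangentSpace 𝓘(ℝ, E) p}

variable (E) in
/-- The image `dφ(D^⊥)` of the totally real distribution. -/
abbrev pushPerp (φ : M → N) (D : Π x : M, Submodule ℝ (TangentSpace 𝓘(ℝ, F) x)) (x : M) :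
    Submodule ℝ (TangentSpace 𝓘(ℝ, E) (φ x)) :=
  push φ (orthCompl E φ D) x

variable {x : M}

theorem mfderiv_mem_tangentOf (v : TangentSpace 𝓘(ℝ, F) x) :
    mfderiv 𝓘(ℝ, F) 𝓘(ℝ, E) φ x v ∈ tangentOf E F φ x :=
  Submodule.mem_map_of_mem (f := (mfderiv 𝓘(ℝ, F) 𝓘(ℝ, E) φ x).toLinearMap) trivial

theorem push_le_tangentOf : push φ D x ≤ tangentOf E F φ x :=
  Submodule.map_mono le_top

theorem inner_push_pushPerp {d z : TangentSpace 𝓘(ℝ, E) (φ x)} (hd : d ∈ push φ D x)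
    (hz : z ∈ pushPerp E φ D x) : inner ℝ d z = 0 := by
  obtain ⟨v, hv, rfl⟩ := Submodule.mem_map.1 hz
  exact hv d hd

namespace IsCRSubmanifold

variable (hM : IsCRSubmanifold J φ D)
include hM

theorem tangentOf_eq (x : M) : tangentOf E F φ x = push φ D x ⊔ pushPerp E φ D x := by
  have h := (isCompl_orthCompl (E := E) (D := D) (hM.immersion.injective_mfderiv x)).sup_eq_top
  exact (congrArg (Submodule.map (mfderiv 𝓘(ℝ, F) 𝓘(ℝ, E) φ x).toLinearMap) h).symm.trans
    (Submodule.map_sup ..)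

theorem J_mem_JPerp {z : TangentSpace 𝓘(ℝ, E) (φ x)} (hz : z ∈ pushPerp E φ D x) :
    J (φ x) z ∈ JPerp J φ D x :=
  Submodule.mem_map_of_mem (f := (J (φ x)).toLinearMap) hz

theorem inner_tangentOf_JPerp {t z : TangentSpace 𝓘(ℝ, E) (φ x)} (ht : t ∈ tangentOf E F φ x)
    (hz : z ∈ pushPerp E φ D x) : inner ℝ t (J (φ x) z) = 0 :=
  hM.totallyReal x (hM.J_mem_JPerp hz) t ht

theorem J_mem_push {d : TangentSpace 𝓘(ℝ, E) (φ x)} (hd : d ∈ push φ D x) :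
    J (φ x) d ∈ push φ D x := by
  rw [← hM.holomorphic x]
  exact Submodule.mem_map_of_mem (f := (J (φ x)).toLinearMap) hd

theorem mem_pushPerp {c : TangentSpace 𝓘(ℝ, E) (φ x)} (hc : c ∈ tangentOf E F φ x)
    (hcD : ∀ d ∈ push φ D x, inner ℝ d c = 0) : c ∈ pushPerp E φ D x := by
  obtain ⟨v, -, rfl⟩ := Submodule.mem_map.1 hc
  exact Submodule.mem_map_of_mem hcD

theorem mem_push {c : TangentSpace 𝓘(ℝ, E) (φ x)} (hc : c ∈ tangentOf E F φ x)
    (hcP : ∀ z ∈ pushPerp E φ D x, inner ℝ z c = 0) : c ∈ push φ D x := by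
  rw [hM.tangentOf_eq] at hc
  obtain ⟨d, hd, z, hz, rfl⟩ := Submodule.mem_sup.1 hc
  have h := hcP z hz
  rw [inner_add_right, real_inner_comm, inner_push_pushPerp hd hz, zero_add,
    inner_self_eq_zero] at h
  rwa [h, add_zero]

theorem inner_JPerp_mu {z n : TangentSpace 𝓘(ℝ, E) (φ x)} (hz : z ∈ pushPerp E φ D x)
    (hn : n ∈ mu J φ D x) : inner ℝ (J (φ x) z) n = 0 :=
  hn.2 _ (hM.J_mem_JPerp hz)

theorem inner_tangentOf_mu {t n : TangentSpace 𝓘(ℝ, E) (φ x)} (ht : t ∈ tangentOf E F φ x)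
    (hn : n ∈ mu J φ D x) : inner ℝ t n = 0 :=
  hn.1 _ ht

theorem mem_mu {n : TangentSpace 𝓘(ℝ, E) (φ x)} (hn : n ∈ normalOf E F φ x)
    (h : ∀ z ∈ pushPerp E φ D x, inner ℝ (J (φ x) z) n = 0) : n ∈ mu J φ D x := by
  refine ⟨hn, (Submodule.mem_orthogonal _ _).2 fun u hu => ?_⟩
  obtain ⟨z, hz, rfl⟩ := Submodule.mem_map.1 hu
  exact h z hz

theorem J_mem_mu (hJ : IsAlmostHermitian J) {n : TangentSpace 𝓘(ℝ, E) (φ x)}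
    (hn : n ∈ mu J φ D x) : J (φ x) n ∈ mu J φ D x := by
  refine hM.mem_mu ((Submodule.mem_orthogonal _ _).2 fun t ht => ?_) fun z hz => ?_
  · have ht' := ht
    rw [hM.tangentOf_eq] at ht'
    obtain ⟨d, hd, z, hz, rfl⟩ := Submodule.mem_sup.1 ht'
    have h1 := hJ.inner_left (φ x) d n
    have h2 := hJ.inner_left (φ x) z n
    rw [hM.inner_tangentOf_mu (push_le_tangentOf (hM.J_mem_push hd)) hn] at h1
    rw [hM.inner_JPerp_mu hz hn] at h2
    rw [inner_add_left]
    linarith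
  · rw [hJ.isometry]
    exact hM.inner_tangentOf_mu (push_le_tangentOf hz) hn

/-- A vector is tangent if it is orthogonal to `J D^⊥` and to `μ`. -/
theorem mem_tangentOf {c : TangentSpace 𝓘(ℝ, E) (φ x)}
    (h : ∀ z ∈ pushPerp E φ D x, inner ℝ (J (φ x) z) c = 0)
    (hmu : ∀ n ∈ mu J φ D x, inner ℝ n c = 0) : c ∈ tangentOf E F φ x := by
  rw [← Submodule.orthogonal_orthogonal (tangentOf E F φ x), Submodule.mem_orthogonal]
  intro n hn
  have h1 := Submodule.sup_orthogonal_inf_of_hasOrthogonalProjection (hM.totallyReal x)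
  have h2 : n ∈ JPerp J φ D x ⊔ (JPerp J φ D x)ᗮ ⊓ normalOf E F φ x := by rw [h1]; exact hn
  obtain ⟨u, hu, m, hm, rfl⟩ := Submodule.mem_sup.1 h2
  obtain ⟨z, hz, rfl⟩ := Submodule.mem_map.1 hu
  rw [inner_add_left, hmu m ⟨hm.2, hm.1⟩, add_zero]
  exact h z hz

end IsCRSubmanifold

end Decomposition

/-! ### Derivatives of sections along a CR-submanifold -/

section CRSubmanifold

variable {E : Type*} [NormedAddCommGroup E] [NormedSpace ℝ E] [FiniteDimensional ℝ E]
  {N : Type*} [TopologicalSpace N] [T2Space N] [ChartedSpace E N] [IsManifold 𝓘(ℝ, E) ∞ N]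
  [RiemannianBundle (fun x : N => TangentSpace 𝓘(ℝ, E) x)]
  [IsContMDiffRiemannianBundle 𝓘(ℝ, E) ∞ E (fun p : N => TangentSpace 𝓘(ℝ, E) p)]
  {F : Type*} [NormedAddCommGroup F] [NormedSpace ℝ F] [FiniteDimensional ℝ F]
  {M : Type*} [TopologicalSpace M] [T2Space M] [ChartedSpace F M] [IsManifold 𝓘(ℝ, F) ∞ M]
  {φ : M → N} {D : Π x : M, Submodule ℝ (TangentSpace 𝓘(ℝ, F) x)}
  {J : Π p : N, TangentSpace 𝓘(ℝ, E) p →L[ℝ] TangentSpace 𝓘(ℝ, E) p}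
  {lee : Π p : N, TangentSpace 𝓘(ℝ, E) p →L[ℝ] ℝ}
  {x : M} {X Y Z : Π x : M, TangentSpace 𝓘(ℝ, F) x}

/-- For orthogonal fields the metric property of the connection moves the derivative to the other
argument. -/
theorem inner_covAlong_of_orthogonal {σ τ : Π x : M, TangentSpace 𝓘(ℝ, E) (φ x)}
    (hσ : MDiffAlongAt F φ σ x) (hτ : MDiffAlongAt F φ τ x)
    (h : ∀ᶠ y in 𝓝 x, inner ℝ (σ y) (τ y) = 0) (v : TangentSpace 𝓘(ℝ, F) x) :
    inner ℝ (covAlong φ σ x v) (τ x) = -inner ℝ (σ x) (covAlong φ τ x v) := by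
  have h1 := mvfderiv_inner hσ hτ v
  have h2 : (fun y => inner ℝ (σ y) (τ y)) =ᶠ[𝓝 x] fun _ => (0 : ℝ) := h
  rw [mvfderiv_congr h2, mvfderiv_const] at h1
  have h3 : (0 : ℝ) = inner ℝ (covAlong φ σ x v) (τ x) + inner ℝ (σ x) (covAlong φ τ x v) := h1
  linarith

theorem IsSmoothField.mdiff_pushField (hφ : ContMDiff 𝓘(ℝ, F) 𝓘(ℝ, E) ∞ φ) (hX : IsSmoothField X) :
    MDiffAlongAt F φ (pushField (E := E) φ X) x :=
  (smoothAlongAt_pushField hφ (hX x)).mdiff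

theorem IsSectionOf.pushField_mem {V : Π x : M, Submodule ℝ (TangentSpace 𝓘(ℝ, F) x)}
    (hX : IsSectionOf V X) (x : M) : pushField (E := E) φ X x ∈ push φ V x :=
  Submodule.mem_map_of_mem (hX.2 x)

namespace IsCRSubmanifold

variable (hM : IsCRSubmanifold J φ D) (hJ : IsLCK J) (hlee : IsLeeForm J lee)
include hM

/-- Every vector of `μ` extends to a section of `μ`, the orthogonal complement of `TM ⊕ J D^⊥`. -/
theorem exists_mu_section (hJ : IsLCK J) {n : TangentSpace 𝓘(ℝ, E) (φ x)} (hn : n ∈ mu J φ D x) :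
    ∃ ξ, IsSectionAlong (F := F) φ (mu J φ D) ξ ∧ ξ x = n := by
  have hD := hM.distribution
  have hDperp := IsSmoothDistribution.orthCompl (E := E) hM.immersion hD
  have h1 : IsSmoothSubbundle F φ (tangentOf E F φ) := by
    have h2 := (IsSmoothDistribution.push hM.immersion hD).sup
      (IsSmoothDistribution.push (E := E) hM.immersion hDperp) fun x => Submodule.disjoint_def.2
        fun v hv hv' => inner_self_eq_zero.1 (inner_push_pushPerp hv hv')
    convert h2 using 2 with x
    exact hM.tangentOf_eq x
  have h3 := h1.sup ((IsSmoothDistribution.push hM.immersion hDperp).map_J hJ.almostHermitian)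
    fun x => Submodule.disjoint_def.2 fun v hv hv' => by
      obtain ⟨z, hz, rfl⟩ := Submodule.mem_map.1 hv'
      exact inner_self_eq_zero.1 (hM.inner_tangentOf_JPerp hv hz)
  have h4 : (fun x => (tangentOf E F φ x ⊔ JPerp J φ D x)ᗮ) = mu J φ D :=
    funext fun x => (Submodule.inf_orthogonal _ _).symm
  have h5 := h3.exists_orthogonal_section hM.immersion.smooth (x := x) (w := n)
  change n ∈ (fun x => (tangentOf E F φ x ⊔ JPerp J φ D x)ᗮ) x → ∃ ξ, IsSectionAlong (F := F) φ
    (fun x => (tangentOf E F φ x ⊔ JPerp J φ D x)ᗮ) ξ ∧ ξ x = n at h5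
  rw [h4] at h5
  exact h5 hn

/-- Since the Lee vector field is a section of `J D^⊥`, the derivative of `J` in directions of `D^⊥`
has values in `D^⊥ ⊕ J D^⊥`: tested against `D ⊕ μ`, covariant derivatives commute with `J`. -/
theorem inner_covAlong_J (hJ : IsLCK J) (hlee : IsLeeForm J lee)
    (hB : ∀ x : M, leeVector lee (φ x) ∈ JPerp J φ D x)
    {σ : Π x : M, TangentSpace 𝓘(ℝ, E) (φ x)} (hσ : MDiffAlongAt F φ σ x)
    {v : TangentSpace 𝓘(ℝ, F) x} (hv : v ∈ orthCompl E φ D x)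
    {w : TangentSpace 𝓘(ℝ, E) (φ x)} (hw : ∀ z ∈ pushPerp E φ D x, inner ℝ z w = 0)
    (hJw : ∀ z ∈ pushPerp E φ D x, inner ℝ (J (φ x) z) w = 0) :
    inner ℝ w (covAlong φ (fun y => J (φ y) (σ y)) x v) =
      inner ℝ w (J (φ x) (covAlong φ σ x v)) := by
  have hH := hJ.almostHermitian
  have h := two_mul_inner_covAlong_J hJ hlee hσ v w
  have hu : mfderiv 𝓘(ℝ, F) 𝓘(ℝ, E) φ x v ∈ pushPerp E φ D x := Submodule.mem_map_of_mem hv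
  have hlee' : ∀ u, lee (φ x) u = inner ℝ (leeVector lee (φ x)) u := fun u => by
    rw [leeVector, InnerProductSpace.toDual_symm_apply]
  obtain ⟨b, hb, hbB⟩ := Submodule.mem_map.1 (hB x)
  have hbB' : J (φ x) b = leeVector lee (φ x) := hbB
  have h1 : lee (φ x) w = 0 := by rw [hlee', ← hbB', hJw b hb]
  have h2 : lee (φ x) (J (φ x) w) = 0 := by rw [hlee', ← hbB', hH.isometry, hw b hb]
  have h3 := hJw _ hu
  rw [hH.inner_left, neg_eq_zero] at h3
  rw [leeTensor, h1, h2, h3, hw _ hu, inner_sub_right] at h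
  linarith

/-- The key symmetry: `g(∇_X Z, JY) = g(JZ, ∇_X Y)` for sections `X`, `Z` of `D^⊥` and `Y` of
`D`. -/
theorem inner_covAlong_holomorphic (hJ : IsLCK J) (hlee : IsLeeForm J lee)
    (hB : ∀ x : M, leeVector lee (φ x) ∈ JPerp J φ D x)
    (hX : IsSectionOf (orthCompl E φ D) X) (hZ : IsSectionOf (orthCompl E φ D) Z)
    (hY : IsSectionOf D Y) (x : M) :
    inner ℝ (covAlong φ (pushField φ Z) x (X x)) (J (φ x) (pushField φ Y x)) =
      inner ℝ (JField J φ Z x) (covAlong φ (pushField φ Y) x (X x)) := by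
  have hH := hJ.almostHermitian
  have hφ := hM.immersion.smooth
  have hdZ := hZ.1.mdiff_pushField (x := x) hφ
  have h1 := hM.inner_covAlong_J hJ hlee hB hdZ (hX.2 x)
    (w := pushField φ Y x)
    (fun z hz => by rw [real_inner_comm, inner_push_pushPerp (hY.pushField_mem x) hz])
    (fun z hz => by
      rw [real_inner_comm, hM.inner_tangentOf_JPerp (push_le_tangentOf (hY.pushField_mem x)) hz])
  have h2 := inner_covAlong_of_orthogonal (hdZ.J_apply hH) (hY.1.mdiff_pushField (x := x) hφ)
    (Eventually.of_forall fun y => by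
      rw [real_inner_comm]
      exact hM.inner_tangentOf_JPerp (push_le_tangentOf (hY.pushField_mem y))
        (hZ.pushField_mem y)) (X x)
  have h3 := hH.inner_left (φ x) (covAlong φ (pushField φ Z) x (X x)) (pushField φ Y x)
  rw [real_inner_comm] at h3
  rw [real_inner_comm] at h2
  change _ = inner ℝ (J (φ x) (pushField φ Z x)) _
  linarith

/-- The second fundamental form and the shape operator of `JZ` are adjoint. -/
theorem inner_covAlong_JField (hJ : IsLCK J) (hZ : IsSectionOf (orthCompl E φ D) Z)
    (hY : IsSmoothField Y) (v : TangentSpace 𝓘(ℝ, F) x) :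
    inner ℝ (covAlong φ (pushField φ Y) x v) (JField J φ Z x) =
      -inner ℝ (pushField φ Y x) (covAlong φ (JField J φ Z) x v) := by
  have hφ := hM.immersion.smooth
  exact inner_covAlong_of_orthogonal (hY.mdiff_pushField (x := x) hφ)
    ((hZ.1.mdiff_pushField (x := x) hφ).J_apply hJ.almostHermitian)
    (Eventually.of_forall fun y => hM.inner_tangentOf_JPerp (mfderiv_mem_tangentOf _)
      (hZ.pushField_mem y)) v

end IsCRSubmanifold

end CRSubmanifold

/-! ### Conditions on the second fundamental form and on the shape operator -/

section Equivalences

variable {E : Type*} [NormedAddCommGroup E] [NormedSpace ℝ E] [FiniteDimensional ℝ E]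
  {N : Type*} [TopologicalSpace N] [T2Space N] [ChartedSpace E N] [IsManifold 𝓘(ℝ, E) ∞ N]
  [RiemannianBundle (fun x : N => TangentSpace 𝓘(ℝ, E) x)]
  [IsContMDiffRiemannianBundle 𝓘(ℝ, E) ∞ E (fun p : N => TangentSpace 𝓘(ℝ, E) p)]
  {F : Type*} [NormedAddCommGroup F] [NormedSpace ℝ F] [FiniteDimensional ℝ F]
  {M : Type*} [TopologicalSpace M] [T2Space M] [ChartedSpace F M] [IsManifold 𝓘(ℝ, F) ∞ M]
  {φ : M → N} {D : Π x : M, Submodule ℝ (TangentSpace 𝓘(ℝ, F) x)}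
  {J : Π p : N, TangentSpace 𝓘(ℝ, E) p →L[ℝ] TangentSpace 𝓘(ℝ, E) p}
  {lee : Π p : N, TangentSpace 𝓘(ℝ, E) p →L[ℝ] ℝ}
  {x : M} {X Y Z : Π x : M, TangentSpace 𝓘(ℝ, F) x}

variable (E) in
/-- The ambient covariant derivatives of sections of `D^⊥` in directions of `D^⊥` stay in
`D^⊥`. -/
def IsPerpAutoparallel (φ : M → N) (D : Π x : M, Submodule ℝ (TangentSpace 𝓘(ℝ, F) x)) : Prop :=
  ∀ X Z : Π x : M, TangentSpace 𝓘(ℝ, F) x,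
    IsSectionOf (orthCompl E φ D) X → IsSectionOf (orthCompl E φ D) Z →
    ∀ x, covAlong φ (pushField φ Z) x (X x) ∈ pushPerp E φ D x

theorem secondForm_eq_zero_iff :
    secondForm (E := E) φ X Z x = 0 ↔ covAlong φ (pushField φ Z) x (X x) ∈ tangentOf E F φ x := by
  rw [secondForm, Submodule.starProjection_apply_eq_zero_iff, normalOf,
    Submodule.orthogonal_orthogonal]

namespace IsCRSubmanifold

variable (hM : IsCRSubmanifold J φ D)
include hM

/-- The condition `h(X, Y) ∈ μ`, in terms of the ambient connection. -/
theorem secondForm_mem_mu_iff : secondForm φ X Y x ∈ mu J φ D x ↔ ∀ z ∈ pushPerp E φ D x,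
    inner ℝ (covAlong φ (pushField φ Y) x (X x)) (J (φ x) z) = 0 := by
  have h : ∀ z ∈ pushPerp E φ D x, inner ℝ (secondForm φ X Y x) (J (φ x) z) =
      inner ℝ (covAlong φ (pushField φ Y) x (X x)) (J (φ x) z) := fun z hz =>
    inner_starProjection_of_mem _ (hM.totallyReal x (hM.J_mem_JPerp hz))
  refine ⟨fun hmu z hz => ?_, fun h' => hM.mem_mu (Submodule.starProjection_apply_mem _ _)
    fun z hz => ?_⟩
  · rw [← h z hz, real_inner_comm]
    exact hM.inner_JPerp_mu hz hmu
  · rw [real_inner_comm, h z hz]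
    exact h' z hz

theorem exists_perp_section {z : TangentSpace 𝓘(ℝ, E) (φ x)} (hz : z ∈ pushPerp E φ D x) :
    ∃ Z, IsSectionOf (orthCompl E φ D) Z ∧ pushField φ Z x = z := by
  obtain ⟨v, hv, rfl⟩ := Submodule.mem_map.1 hz
  obtain ⟨Z, hZ, rfl⟩ := (IsSmoothDistribution.orthCompl hM.immersion hM.distribution)
    |>.exists_section hv
  exact ⟨Z, hZ, rfl⟩

theorem exists_holomorphic_section {d : TangentSpace 𝓘(ℝ, E) (φ x)} (hd : d ∈ push φ D x) :
    ∃ Y, IsSectionOf D Y ∧ pushField φ Y x = d := by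
  obtain ⟨v, hv, rfl⟩ := Submodule.mem_map.1 hd
  obtain ⟨Y, hY, rfl⟩ := hM.distribution.exists_section hv
  exact ⟨Y, hY, rfl⟩

/-- If `∇_X Z` has no component in `D`, then `h(X, Y)` has none in `J D^⊥`, for `Y` in `D`. -/
theorem secondForm_mem_mu_of_isPerpAutoparallel (hJ : IsLCK J) (hlee : IsLeeForm J lee)
    (hB : ∀ x : M, leeVector lee (φ x) ∈ JPerp J φ D x) (h : IsPerpAutoparallel E φ D)
    (hX : IsSectionOf (orthCompl E φ D) X) (hY : IsSectionOf D Y) (x : M) :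
    secondForm φ X Y x ∈ mu J φ D x := by
  rw [hM.secondForm_mem_mu_iff]
  intro z hz
  obtain ⟨Z, hZ, rfl⟩ := hM.exists_perp_section hz
  have h1 := hM.inner_covAlong_holomorphic hJ hlee hB hX hZ hY x
  rw [real_inner_comm, inner_push_pushPerp (hM.J_mem_push (hY.pushField_mem x)) (h X Z hX hZ x)]
    at h1
  rw [real_inner_comm]
  exact h1.symm

/-- `D^⊥` is autoparallel in the ambient manifold if and only if `M` is `D^⊥`-geodesic and `h(D^⊥,
D)` is in `μ`. -/
theorem isPerpAutoparallel_iff (hJ : IsLCK J) (hlee : IsLeeForm J lee)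
    (hB : ∀ x : M, leeVector lee (φ x) ∈ JPerp J φ D x) :
    IsPerpAutoparallel E φ D ↔
      (∀ X Z : Π x : M, TangentSpace 𝓘(ℝ, F) x,
          IsSectionOf (orthCompl E φ D) X → IsSectionOf (orthCompl E φ D) Z →
          ∀ x, secondForm (E := E) φ X Z x = 0) ∧
        (∀ X Y : Π x : M, TangentSpace 𝓘(ℝ, F) x,
          IsSectionOf (orthCompl E φ D) X → IsSectionOf D Y →
          ∀ x, secondForm φ X Y x ∈ mu J φ D x) := by
  refine ⟨fun h => ⟨fun X Z hX hZ x => secondForm_eq_zero_iff.2 (push_le_tangentOf (h X Z hX hZ x)),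
    fun X Y hX hY x => hM.secondForm_mem_mu_of_isPerpAutoparallel hJ hlee hB h hX hY x⟩, ?_⟩
  rintro ⟨h1, h2⟩ X Z hX hZ x
  refine hM.mem_pushPerp (secondForm_eq_zero_iff.1 (h1 X Z hX hZ x)) fun d hd => ?_
  -- every vector of `D` has the form `J d'` with `d'` in `D`
  rw [← hM.holomorphic x] at hd
  obtain ⟨d', hd', rfl⟩ := Submodule.mem_map.1 hd
  obtain ⟨Y, hY, rfl⟩ := hM.exists_holomorphic_section hd'
  have h3 := hM.inner_covAlong_holomorphic hJ hlee hB hX hZ hY x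
  have h4 := hM.secondForm_mem_mu_iff.1 (h2 X Y hX hY x) _ (hZ.pushField_mem x)
  rw [real_inner_comm] at h3 h4
  exact h3.trans h4

/-- For `n` in `μ`, `g(∇_X JZ, n) = -g(∇_X Z, Jn)`, and `Jn` is normal; so `∇^⊥_X JZ` has no
component in `μ` if `h(X, Z) = 0`. -/
theorem normalConn_mem_of_secondForm (hJ : IsLCK J) (hlee : IsLeeForm J lee)
    (hB : ∀ x : M, leeVector lee (φ x) ∈ JPerp J φ D x)
    (hX : IsSectionOf (orthCompl E φ D) X) (hZ : IsSectionOf (orthCompl E φ D) Z)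
    (h : secondForm (E := E) φ X Z x = 0) :
    normalConn φ X (JField J φ Z) x ∈ JPerp J φ D x := by
  rw [← Submodule.orthogonal_orthogonal (JPerp J φ D x), Submodule.mem_orthogonal]
  intro n hn
  -- only the component of `n` in `μ` matters
  obtain ⟨t, ht, m, hm, rfl⟩ := (tangentOf E F φ x).exists_add_mem_mem_orthogonal n
  have hmu : m ∈ mu J φ D x := hM.mem_mu hm fun z hz => by
    have h1 := hn _ (hM.J_mem_JPerp hz)
    rwa [inner_add_right, real_inner_comm, hM.inner_tangentOf_JPerp ht hz, zero_add] at h1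
  have hnor : normalConn φ X (JField J φ Z) x ∈ normalOf E F φ x :=
    Submodule.starProjection_apply_mem _ _
  rw [inner_add_left, hnor t ht, zero_add, real_inner_comm, normalConn,
    inner_starProjection_of_mem _ hmu.1, real_inner_comm]
  have hH := hJ.almostHermitian
  have h2 := hM.inner_covAlong_J hJ hlee hB (hZ.1.mdiff_pushField (x := x) hM.immersion.smooth)
    (hX.2 x) (w := m) (fun z hz => hM.inner_tangentOf_mu (push_le_tangentOf hz) hmu)
    (fun z hz => hM.inner_JPerp_mu hz hmu)
  have h3 := hH.inner_left (φ x) m (covAlong φ (pushField φ Z) x (X x))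
  rw [real_inner_comm, hM.inner_tangentOf_mu (secondForm_eq_zero_iff.1 h)
    (hM.J_mem_mu hH hmu)] at h3
  exact h2.trans (neg_eq_zero.1 h3.symm)

/-- The condition `h(X, Y) ∈ μ` for `Y` in `D` and in `D^⊥` gives it for all `Y`: by
`inner_covAlong_JField` it depends on the value of `Y` at the point only, and linearly. -/
theorem secondForm_mem_mu_of_sections (hJ : IsLCK J)
    (h1 : ∀ X Z : Π x : M, TangentSpace 𝓘(ℝ, F) x,
      IsSectionOf (orthCompl E φ D) X → IsSectionOf (orthCompl E φ D) Z →
      ∀ x, secondForm (E := E) φ X Z x = 0)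
    (h2 : ∀ X Y : Π x : M, TangentSpace 𝓘(ℝ, F) x,
      IsSectionOf (orthCompl E φ D) X → IsSectionOf D Y → ∀ x, secondForm φ X Y x ∈ mu J φ D x)
    (hX : IsSectionOf (orthCompl E φ D) X) (hY : IsSmoothField Y) :
    secondForm φ X Y x ∈ mu J φ D x := by
  rw [hM.secondForm_mem_mu_iff]
  intro z hz
  obtain ⟨Z, hZ, rfl⟩ := hM.exists_perp_section hz
  have h3 : pushField φ Y x ∈ tangentOf E F φ x := mfderiv_mem_tangentOf _
  rw [hM.tangentOf_eq] at h3
  obtain ⟨d, hd, z, hz, hdz⟩ := Submodule.mem_sup.1 h3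
  obtain ⟨Y', hY', rfl⟩ := hM.exists_holomorphic_section hd
  obtain ⟨Z', hZ', rfl⟩ := hM.exists_perp_section hz
  have e1 := hM.inner_covAlong_JField hJ hZ hY'.1 (X x)
  have e2 := hM.inner_covAlong_JField hJ hZ hZ'.1 (X x)
  have e3 := hM.secondForm_mem_mu_iff.1 (h2 X Y' hX hY' x) _ (hZ.pushField_mem x)
  have e4 := hM.inner_tangentOf_JPerp (secondForm_eq_zero_iff.1 (h1 X Z' hX hZ' x))
    (hZ.pushField_mem x)
  refine (hM.inner_covAlong_JField hJ hZ hY (X x)).trans ?_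
  rw [← hdz, inner_add_left]
  rw [JField] at e1 e2
  linarith

/-- `g(a_{JZ} X, Y) = g(h(X, Y), JZ)` vanishes for all `Y` if `h(X, Y)` is in `μ`. -/
theorem shapeOperator_JField_eq_zero (hJ : IsLCK J)
    (h : ∀ X Y : Π x : M, TangentSpace 𝓘(ℝ, F) x,
      IsSectionOf (orthCompl E φ D) X → IsSmoothField Y → ∀ x, secondForm φ X Y x ∈ mu J φ D x)
    (hX : IsSectionOf (orthCompl E φ D) X) (hZ : IsSectionOf (orthCompl E φ D) Z) :
    shapeOperator φ (JField J φ Z) X x = 0 := by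
  rw [shapeOperator, neg_eq_zero, Submodule.starProjection_apply_eq_zero_iff,
    Submodule.mem_orthogonal]
  intro t ht
  obtain ⟨v, -, rfl⟩ := Submodule.mem_map.1 ht
  obtain ⟨Y, hY, hYv⟩ := exists_smooth_extension v
  have e1 := hM.inner_covAlong_JField hJ hZ hY (X x)
  have e2 := hM.secondForm_mem_mu_iff.1 (h X Y hX hY x) _ (hZ.pushField_mem x)
  have e3 := neg_eq_zero.1 (e1.symm.trans e2)
  rwa [pushField, hYv.self_of_nhds, FiberBundle.extend_apply_self] at e3

/-- The second fundamental form and the shape operator of a section of `μ` are adjoint. -/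
theorem inner_covAlong_mu_section {ξ : Π x : M, TangentSpace 𝓘(ℝ, E) (φ x)}
    (hξ : IsSectionAlong (F := F) φ (mu J φ D) ξ) (hY : IsSmoothField Y)
    (v : TangentSpace 𝓘(ℝ, F) x) :
    inner ℝ (covAlong φ (pushField φ Y) x v) (ξ x) =
      -inner ℝ (pushField φ Y x) (covAlong φ ξ x v) :=
  inner_covAlong_of_orthogonal (hY.mdiff_pushField hM.immersion.smooth)
    (SmoothAlongAt.mdiff (hξ.1 x))
    (Eventually.of_forall fun y => hM.inner_tangentOf_mu (mfderiv_mem_tangentOf _) (hξ.2 y)) v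

/-- For `ξ` in `μ`, `g(a_ξ X, Z) = g(∇_X Z, ξ) = g(∇_X JZ, Jξ)`, and `Jξ` is in `μ`; so `a_ξ X` has
no component in `D^⊥` if `∇^⊥_X JZ` is in `J D^⊥`. -/
theorem shapeOperator_mem_push (hJ : IsLCK J) (hlee : IsLeeForm J lee)
    (hB : ∀ x : M, leeVector lee (φ x) ∈ JPerp J φ D x)
    (h : ∀ X Z : Π x : M, TangentSpace 𝓘(ℝ, F) x,
      IsSectionOf (orthCompl E φ D) X → IsSectionOf (orthCompl E φ D) Z →
      ∀ x, normalConn φ X (JField J φ Z) x ∈ JPerp J φ D x)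
    (hX : IsSectionOf (orthCompl E φ D) X) {ξ : Π x : M, TangentSpace 𝓘(ℝ, E) (φ x)}
    (hξ : IsSectionAlong (F := F) φ (mu J φ D) ξ) : shapeOperator φ ξ X x ∈ push φ D x := by
  have hH := hJ.almostHermitian
  refine hM.mem_push (Submodule.neg_mem _ (Submodule.starProjection_apply_mem _ _)) fun z hz => ?_
  obtain ⟨Z, hZ, rfl⟩ := hM.exists_perp_section hz
  have hJξ := hM.J_mem_mu hH (hξ.2 x)
  rw [shapeOperator, inner_neg_right, real_inner_comm, inner_starProjection_of_mem _
    (push_le_tangentOf hz), real_inner_comm, ← hM.inner_covAlong_mu_section hξ hZ.1]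
  -- pass to `∇_X JZ` by means of `J`
  have e1 := hM.inner_covAlong_J hJ hlee hB (hZ.1.mdiff_pushField (x := x) hM.immersion.smooth)
    (hX.2 x) (w := J (φ x) (ξ x)) (fun z hz => hM.inner_tangentOf_mu (push_le_tangentOf hz) hJξ)
    (fun z hz => hM.inner_JPerp_mu hz hJξ)
  rw [hH.isometry] at e1
  obtain ⟨b, hb, hbn⟩ := Submodule.mem_map.1 (h X Z hX hZ x)
  have e2 : inner ℝ (normalConn φ X (JField J φ Z) x) (J (φ x) (ξ x)) = 0 := by
    rw [← hbn]
    exact hM.inner_JPerp_mu hb hJξ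
  rw [normalConn, inner_starProjection_of_mem _ hJξ.1, real_inner_comm] at e2
  rw [real_inner_comm]
  exact e1.symm.trans e2

/-- If `a_{JZ} X = 0` for all `Z` in `D^⊥`, then `h(X, Y)` has no component in `J D^⊥`, for every
`Y`. -/
theorem inner_covAlong_eq_zero_of_shapeOperator (hJ : IsLCK J)
    (h1 : ∀ X Z : Π x : M, TangentSpace 𝓘(ℝ, F) x,
      IsSectionOf (orthCompl E φ D) X → IsSectionOf (orthCompl E φ D) Z →
      ∀ x, shapeOperator φ (JField J φ Z) X x = 0)
    (hX : IsSectionOf (orthCompl E φ D) X) (hY : IsSmoothField Y)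
    {z : TangentSpace 𝓘(ℝ, E) (φ x)} (hz : z ∈ pushPerp E φ D x) :
    inner ℝ (covAlong φ (pushField φ Y) x (X x)) (J (φ x) z) = 0 := by
  obtain ⟨Z, hZ, rfl⟩ := hM.exists_perp_section hz
  refine (hM.inner_covAlong_JField hJ hZ hY (X x)).trans ?_
  have e := h1 X Z hX hZ x
  rw [shapeOperator, neg_eq_zero, Submodule.starProjection_apply_eq_zero_iff] at e
  exact neg_eq_zero.2 (e _ (mfderiv_mem_tangentOf _))

/-- The two conditions on the shape operator exclude the components of `h(X, Z)` in `J D^⊥` and in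
`μ`. -/
theorem secondForm_eq_zero_of_shapeOperator (hJ : IsLCK J)
    (h1 : ∀ X Z : Π x : M, TangentSpace 𝓘(ℝ, F) x,
      IsSectionOf (orthCompl E φ D) X → IsSectionOf (orthCompl E φ D) Z →
      ∀ x, shapeOperator φ (JField J φ Z) X x = 0)
    (h2 : ∀ (X : Π x : M, TangentSpace 𝓘(ℝ, F) x) (ξ : Π x : M, TangentSpace 𝓘(ℝ, E) (φ x)),
      IsSectionOf (orthCompl E φ D) X → IsSectionAlong (F := F) φ (mu J φ D) ξ →
      ∀ x, shapeOperator φ ξ X x ∈ push φ D x)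
    (hX : IsSectionOf (orthCompl E φ D) X) (hZ : IsSectionOf (orthCompl E φ D) Z) :
    secondForm (E := E) φ X Z x = 0 := by
  refine secondForm_eq_zero_iff.2 (hM.mem_tangentOf (fun z hz => ?_) fun n hn => ?_)
  · rw [real_inner_comm]
    exact hM.inner_covAlong_eq_zero_of_shapeOperator hJ h1 hX hZ.1 hz
  · obtain ⟨ξ, hξ, rfl⟩ := hM.exists_mu_section hJ hn
    have e := inner_push_pushPerp (h2 X ξ hX hξ x) (hZ.pushField_mem x)
    rw [shapeOperator, inner_neg_left, inner_starProjection_of_mem _ (mfderiv_mem_tangentOf _),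
      real_inner_comm] at e
    rw [real_inner_comm]
    exact (hM.inner_covAlong_mu_section hξ hZ.1 (X x)).trans e

end IsCRSubmanifold

end Equivalences

/-! ### Frobenius' theorem on manifolds -/

universe u

section Frobenius

variable {F : Type*} [NormedAddCommGroup F] [NormedSpace ℝ F] [FiniteDimensional ℝ F]
  {M : Type u} [TopologicalSpace M] [T2Space M] [ChartedSpace F M] [IsManifold 𝓘(ℝ, F) ∞ M]
  {Δ : Π x : M, Submodule ℝ (TangentSpace 𝓘(ℝ, F) x)}

/-- A frame of a smooth distribution near `x` can be taken to consist of global sections. -/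
theorem IsSmoothDistribution.exists_frame (hΔ : IsSmoothDistribution Δ) (x : M) :
    ∃ U : Set M, IsOpen U ∧ x ∈ U ∧ ∃ (k : ℕ) (Z : Fin k → Π y : M, TangentSpace 𝓘(ℝ, F) y),
      (∀ c, IsSectionOf Δ (Z c)) ∧ ∀ y ∈ U, LinearIndependent ℝ (fun c => Z c y) ∧
        Submodule.span ℝ (range fun c => Z c y) = Δ y := by
  obtain ⟨U, hU, hx, k, X, hX, hXΔ⟩ := hΔ x
  choose f hf1 hf0 hf using fun c => exists_cutoff (φ := fun y : M => y) (σ := X c) hU hx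
    contMDiff_id fun y hy => (hX c).contMDiffAt (hU.mem_nhds hy)
  obtain ⟨U', hU's, hU', hxU'⟩ := mem_nhds_iff.1 ((eventually_all.2 hf1).and (hU.mem_nhds hx))
  refine ⟨U', hU', hxU', k, fun c y => f c y • X c y, fun c => ⟨hf c, fun y => ?_⟩, fun y hy => ?_⟩
  · by_cases hy : y ∈ U
    · refine Submodule.smul_mem _ _ ?_
      rw [← (hXΔ y hy).2]
      exact Submodule.subset_span (mem_range_self c)
    · simp only [hf0 c y hy, zero_smul, Submodule.zero_mem]
  · have h1 : ∀ c, f c y = 1 := (hU's hy).1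
    simp only [h1, one_smul]
    exact hXΔ y (hU's hy).2

/-- **Frobenius' theorem**: an involutive distribution has an integral manifold through every
point. -/
theorem IsSmoothDistribution.exists_isIntegralManifold (hΔ : IsSmoothDistribution Δ)
    (hinv : ∀ X Z, IsSectionOf Δ X → IsSectionOf Δ Z →
      ∀ x, VectorField.mlieBracket 𝓘(ℝ, F) X Z x ∈ Δ x) (x : M) :
    ∃ (k : ℕ) (L : Type u) (_ : TopologicalSpace L)
      (_ : ChartedSpace (EuclideanSpace ℝ (Fin k)) L)
      (_ : IsManifold 𝓘(ℝ, EuclideanSpace ℝ (Fin k)) ∞ L) (j : L → M),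
      IsIntegralManifold Δ k j ∧ x ∈ Set.range j := by
  have : CompleteSpace F := FiniteDimensional.complete ℝ F
  obtain ⟨U, hU, hx, k, Z, hZ, hZΔ⟩ := hΔ.exists_frame x
  set ψ := extChartAt 𝓘(ℝ, F) x with hψ
  let W : Set F := ψ.target ∩ ψ.symm ⁻¹' U
  have hW : IsOpen W := (continuousOn_extChartAt_symm x).isOpen_inter_preimage
    (isOpen_extChartAt_target x) hU
  have hxW : ψ x ∈ W := ⟨mem_extChartAt_target x, by
    rw [mem_preimage, hψ, extChartAt_to_inv x]; exact hx⟩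
  have hψs : ∀ z ∈ W, ContMDiffAt 𝓘(ℝ, F) 𝓘(ℝ, F) ∞ ψ.symm z := fun z hz =>
    (contMDiffOn_extChartAt_symm x).contMDiffAt ((isOpen_extChartAt_target x).mem_nhds hz.1)
  have hψi : ∀ z ∈ W, (mfderiv 𝓘(ℝ, F) 𝓘(ℝ, F) ψ.symm z).IsInvertible := fun z hz => by
    have := isInvertible_mfderivWithin_extChartAt_symm (I := 𝓘(ℝ, F)) (x := x) hz.1
    simpa only [modelWithCornersSelf_coe, range_id, mfderivWithin_univ] using this
  let G : Π z : F, F →L[ℝ] TangentSpace 𝓘(ℝ, F) (ψ.symm z) := fun z =>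
    mfderiv 𝓘(ℝ, F) 𝓘(ℝ, F) ψ.symm z
  have hψinj : ∀ z ∈ W, Function.Injective (G z) := fun z hz => by
    obtain ⟨e, he⟩ := hψi z hz
    change Function.Injective (mfderiv 𝓘(ℝ, F) 𝓘(ℝ, F) ψ.symm z)
    rw [← he]
    exact e.injective
  -- the frame in the chart
  let Zh : Fin k → F → F := fun c z => VectorField.mpullback 𝓘(ℝ, F) 𝓘(ℝ, F) ψ.symm (Z c) z
  have hZh : ∀ c, ∀ z ∈ W, G z (Zh c z) = Z c (ψ.symm z) :=
    fun c z hz => (hψi z hz).self_apply_inverse _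
  have hZhs : ∀ c, ContDiffOn ℝ ∞ (Zh c) W := fun c z hz => by
    have h := ContMDiffAt.mpullback_vectorField_preimage (n := ∞) (m := ∞)
      ((hZ c).1 (ψ.symm z)) (hψs z hz) (hψi z hz) (by simp)
    exact (contMDiffAt_vectorSpace_iff_contDiffAt.1 h).contDiffWithinAt
  -- `d(ψ⁻¹)` maps the span of the frame in the chart to the distribution
  have hspan : ∀ z ∈ W, (Submodule.span ℝ (range fun c => Zh c z)).map (G z).toLinearMap =
      Δ (ψ.symm z) := fun z hz => by
    rw [Submodule.map_span, ← range_comp, ← (hZΔ _ hz.2).2]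
    congr 2
    exact funext fun c => hZh c z hz
  have hli : LinearIndependent ℝ fun c => Zh c (ψ x) := by
    have h := (hZΔ _ hxW.2).1
    simp only [← hZh _ _ hxW] at h
    exact (LinearMap.linearIndependent_iff_of_injOn (G (ψ x)).toLinearMap (hψinj _ hxW).injOn).1 h
  have : IsManifold 𝓘(ℝ, F) (minSmoothness ℝ 2) M :=
    IsManifold.of_le (n := ∞) (by simpa using (ENat.LEInfty.out : (2 : WithTop ℕ∞) ≤ ∞))
  have hbr : ∀ z ∈ W, ∀ c d, VectorField.lieBracket ℝ (Zh c) (Zh d) z ∈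
      Submodule.span ℝ (range fun c => Zh c z) := fun z hz c d => by
    have h1 := VectorField.mpullback_mlieBracket (n := ∞) ((hZ c).1.mdifferentiable (by simp) _)
      ((hZ d).1.mdifferentiable (by simp) _) (hψs z hz)
      (by simpa using (ENat.LEInfty.out : (2 : WithTop ℕ∞) ≤ ∞))
    have h2 : VectorField.lieBracket ℝ (Zh c) (Zh d) z =
        VectorField.mlieBracket 𝓘(ℝ, F) (Zh c) (Zh d) z :=
      (congrFun VectorField.lieBracketWithin_univ z).symm.trans
        (congrFun VectorField.mlieBracketWithin_eq_lieBracketWithin z).symm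
    have h3 : G z (VectorField.lieBracket ℝ (Zh c) (Zh d) z) ∈ Δ (ψ.symm z) := by
      have h4 : G z (VectorField.lieBracket ℝ (Zh c) (Zh d) z) =
          VectorField.mlieBracket 𝓘(ℝ, F) (Z c) (Z d) (ψ.symm z) :=
        (congrArg (G z) (h2.trans h1.symm)).trans ((hψi z hz).self_apply_inverse _)
      rw [h4]
      exact hinv _ _ (hZ c) (hZ d) (ψ.symm z)
    rw [← hspan z hz] at h3
    obtain ⟨v, hv, hv'⟩ := Submodule.mem_map.1 h3
    rwa [← hψinj z hz hv']
  obtain ⟨r, hr, f, hf0, hfW, hfs, hfinj, hf⟩ :=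
    exists_integral_map_of_involutive hW hxW hZhs hli hbr
  -- the leaf is a ball, lifted to the universe of `M`, with its inclusion as the only chart
  let P := EuclideanSpace ℝ (Fin k)
  let L := ULift.{u} (ball (0 : P) r)
  let e : L → P := fun l => l.down
  have he : IsOpenEmbedding e :=
    isOpen_ball.isOpenEmbedding_subtypeVal.comp Homeomorph.ulift.isOpenEmbedding
  have hmem : ∀ l : L, e l ∈ ball (0 : P) r := fun l => l.down.2
  let l₀ : L := ⟨⟨0, mem_ball_self hr⟩⟩
  have : Nonempty L := ⟨l₀⟩
  let cs : ChartedSpace P L := he.singletonChartedSpace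
  have hman : IsManifold 𝓘(ℝ, P) ∞ L := he.isManifold_singleton
  have hes : ContMDiff 𝓘(ℝ, P) 𝓘(ℝ, P) ∞ e := contMDiff_isOpenEmbedding he
  have hei : ∀ l, (mfderiv 𝓘(ℝ, P) 𝓘(ℝ, P) e l).IsInvertible := fun l =>
    isInvertible_mfderiv_extChartAt (I := 𝓘(ℝ, P)) (mem_extChartAt_source l)
  let j : L → M := fun l => ψ.symm (f (e l))
  have hfl : ∀ l, ContMDiffAt 𝓘(ℝ, P) 𝓘(ℝ, F) ∞ f (e l) := fun l =>
    (hfs.contDiffAt (isOpen_ball.mem_nhds (hmem l))).contMDiffAt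
  have hjs : ContMDiff 𝓘(ℝ, P) 𝓘(ℝ, F) ∞ j := fun l =>
    (hψs _ (hfW (hmem l))).comp l ((hfl l).comp l (hes l))
  have hjd : ∀ l v, mfderiv 𝓘(ℝ, P) 𝓘(ℝ, F) j l v = G (f (e l))
      (fderiv ℝ f (e l) (mfderiv 𝓘(ℝ, P) 𝓘(ℝ, P) e l v)) := fun l v => by
    have h1 := mfderiv_comp_apply l ((hfl l).mdifferentiableAt (by simp))
      ((hes l).mdifferentiableAt (by simp)) v
    have h2 := mfderiv_comp_apply (f := fun l => f (e l)) l
      ((hψs _ (hfW (hmem l))).mdifferentiableAt (by simp))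
      (((hfl l).comp l (hes l)).mdifferentiableAt (by simp)) v
    refine h2.trans (congrArg _ (h1.trans ?_))
    rw [mfderiv_eq_fderiv]
    rfl
  refine ⟨k, L, inferInstance, cs, hman, j, ⟨?_, ?_, hjs, ?_, ?_⟩, l₀, ?_⟩
  · have : ConnectedSpace (ball (0 : P) r) := isConnected_iff_connectedSpace.1
      ⟨⟨0, mem_ball_self hr⟩, (convex_ball (0 : P) r).isPreconnected⟩
    exact Homeomorph.ulift.symm.surjective.connectedSpace Homeomorph.ulift.symm.continuous
  · intro l l' h
    exact he.injective (hfinj (hmem l) (hmem l')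
      (ψ.symm.injOn (hfW (hmem l)).1 (hfW (hmem l')).1 h))
  · intro l v w h
    rw [hjd, hjd] at h
    have h1 := (hf _ (hmem l)).1 (hψinj _ (hfW (hmem l)) h)
    obtain ⟨g, hg⟩ := hei l
    rw [← hg] at h1
    exact g.injective h1
  · intro l
    rw [← hspan _ (hfW (hmem l)), ← (hf _ (hmem l)).2]
    ext v
    constructor
    · rintro ⟨w, rfl⟩
      exact Submodule.mem_map.2 ⟨_, ⟨_, rfl⟩, (hjd l w).symm⟩
    · rintro ⟨_, ⟨a, rfl⟩, rfl⟩
      obtain ⟨g, hg⟩ := hei l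
      refine ⟨g.symm a, (hjd l _).trans ?_⟩
      rw [← hg]
      exact congrArg (fun b => G (f (e l)) (fderiv ℝ f (e l) b))
        (g.apply_symm_apply a)
  · change ψ.symm (f 0) = x
    rw [hf0]
    exact extChartAt_to_inv x

end Frobenius

/-! ### Totally geodesic leaves -/

section Leaves

variable {E : Type*} [NormedAddCommGroup E] [NormedSpace ℝ E] [FiniteDimensional ℝ E]
  {N : Type*} [TopologicalSpace N] [T2Space N] [ChartedSpace E N] [IsManifold 𝓘(ℝ, E) ∞ N]
  [RiemannianBundle (fun x : N => TangentSpace 𝓘(ℝ, E) x)]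
  [IsContMDiffRiemannianBundle 𝓘(ℝ, E) ∞ E (fun p : N => TangentSpace 𝓘(ℝ, E) p)]
  {F : Type*} [NormedAddCommGroup F] [NormedSpace ℝ F] [FiniteDimensional ℝ F]
  {M : Type u} [TopologicalSpace M] [T2Space M] [ChartedSpace F M] [IsManifold 𝓘(ℝ, F) ∞ M]
  {φ : M → N} {D : Π x : M, Submodule ℝ (TangentSpace 𝓘(ℝ, F) x)}

section IntegralManifold

variable {k : ℕ} {L : Type u} [TopologicalSpace L] [ChartedSpace (EuclideanSpace ℝ (Fin k)) L]
  [IsManifold 𝓘(ℝ, EuclideanSpace ℝ (Fin k)) ∞ L] {j : L → M}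

/-- An integral manifold is not assumed to be Hausdorff, but it inherits this from `M`. -/
theorem IsIntegralManifold.t2Space {Δ : Π x : M, Submodule ℝ (TangentSpace 𝓘(ℝ, F) x)}
    (hj : IsIntegralManifold Δ k j) : T2Space L :=
  T2Space.of_injective_continuous hj.injective hj.smooth.continuous

theorem IsIntegralManifold.pushField_comp (hφ : IsSmoothImmersion E F φ)
    {Δ : Π x : M, Submodule ℝ (TangentSpace 𝓘(ℝ, F) x)} (hj : IsIntegralManifold Δ k j)
    (Z : Π q : L, TangentSpace 𝓘(ℝ, EuclideanSpace ℝ (Fin k)) q) (q : L) :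
    pushField (E := E) (φ ∘ j) Z q = mfderiv 𝓘(ℝ, F) 𝓘(ℝ, E) φ (j q)
      (mfderiv 𝓘(ℝ, EuclideanSpace ℝ (Fin k)) 𝓘(ℝ, F) j q (Z q)) :=
  mfderiv_comp_apply q (hφ.smooth.mdifferentiableAt (by simp))
    (hj.smooth.mdifferentiableAt (by simp)) (Z q)

theorem IsIntegralManifold.mfderiv_mem {Δ : Π x : M, Submodule ℝ (TangentSpace 𝓘(ℝ, F) x)}
    (hj : IsIntegralManifold Δ k j) {q : L} (w : TangentSpace 𝓘(ℝ, EuclideanSpace ℝ (Fin k)) q) :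
    mfderiv 𝓘(ℝ, EuclideanSpace ℝ (Fin k)) 𝓘(ℝ, F) j q w ∈ Δ (j q) := by
  rw [← hj.tangent q]
  exact LinearMap.mem_range_self _ w

theorem IsIntegralManifold.tangentOf_comp (hφ : IsSmoothImmersion E F φ)
    (hj : IsIntegralManifold (orthCompl E φ D) k j) (q : L) :
    tangentOf E (EuclideanSpace ℝ (Fin k)) (φ ∘ j) q = pushPerp E φ D (j q) := by
  ext v
  constructor
  · intro hv
    obtain ⟨w, -, rfl⟩ := Submodule.mem_map.1 hv
    exact Submodule.mem_map.2 ⟨_, hj.mfderiv_mem w, (hj.pushField_comp hφ (fun q => (w :)) q).symm⟩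
  · intro hv
    obtain ⟨u, hu, rfl⟩ := Submodule.mem_map.1 hv
    rw [← hj.tangent q] at hu
    obtain ⟨w, rfl⟩ := hu
    exact Submodule.mem_map.2 ⟨w, trivial, hj.pushField_comp hφ (fun q => (w :)) q⟩

/-- The covariant derivative of a field tangent to a leaf agrees, up to vectors tangent to the leaf,
with that of any section of `D^⊥` with the same value at the point: both are determined by the
derivatives of the sections orthogonal to `D^⊥`. -/
theorem IsIntegralManifold.inner_covAlong_comp (hφ : IsSmoothImmersion E F φ)
    (hD : IsSmoothDistribution D) (hj : IsIntegralManifold (orthCompl E φ D) k j)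
    {Z' : Π q : L, TangentSpace 𝓘(ℝ, EuclideanSpace ℝ (Fin k)) q} (hZ' : IsSmoothField Z')
    {Z : Π x : M, TangentSpace 𝓘(ℝ, F) x} (hZ : IsSectionOf (orthCompl E φ D) Z) {q : L}
    (hq : mfderiv 𝓘(ℝ, EuclideanSpace ℝ (Fin k)) 𝓘(ℝ, F) j q (Z' q) = Z (j q))
    (w : TangentSpace 𝓘(ℝ, EuclideanSpace ℝ (Fin k)) q)
    {n : TangentSpace 𝓘(ℝ, E) (φ (j q))} (hn : n ∈ (pushPerp E φ D (j q))ᗮ) :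
    inner ℝ (covAlong (φ ∘ j) (pushField (φ ∘ j) Z') q w : TangentSpace 𝓘(ℝ, E) (φ (j q))) n =
      inner ℝ (covAlong φ (pushField φ Z) (j q)
        (mfderiv 𝓘(ℝ, EuclideanSpace ℝ (Fin k)) 𝓘(ℝ, F) j q w)) n := by
  have := hj.t2Space
  obtain ⟨ξ, hξ, rfl⟩ := (IsSmoothDistribution.push hφ (IsSmoothDistribution.orthCompl hφ
    hD)).exists_orthogonal_section hφ.smooth hn
  have hξd : MDiffAlongAt F φ ξ (j q) := SmoothAlongAt.mdiff (hξ.1 (j q))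
  have hjd : MDifferentiableAt 𝓘(ℝ, EuclideanSpace ℝ (Fin k)) 𝓘(ℝ, F) j q :=
    hj.smooth.mdifferentiableAt (by simp)
  have h1 := inner_covAlong_of_orthogonal (σ := pushField (φ ∘ j) Z') (τ := fun q => ξ (j q))
    (hZ'.mdiff_pushField (hφ.smooth.comp hj.smooth) (x := q)) (hξd.comp hjd)
    (Eventually.of_forall fun y => hξ.2 (j y) _ (by
      rw [hj.pushField_comp hφ]
      exact Submodule.mem_map_of_mem (hj.mfderiv_mem _))) w
  have h2 := inner_covAlong_of_orthogonal (hZ.1.mdiff_pushField (x := j q) hφ.smooth) hξd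
    (Eventually.of_forall fun y => hξ.2 y _ (hZ.pushField_mem y))
    (mfderiv 𝓘(ℝ, EuclideanSpace ℝ (Fin k)) 𝓘(ℝ, F) j q w)
  rw [covAlong_comp hξd hjd, hj.pushField_comp hφ, hq] at h1
  exact h1.trans h2.symm

end IntegralManifold

/-- At a point, compare sections of `D^⊥` with fields on a leaf through it. -/
theorem IsTotallyRealRuled.isPerpAutoparallel (hφ : IsSmoothImmersion E F φ)
    (hD : IsSmoothDistribution D) (h : IsTotallyRealRuled E φ D) : IsPerpAutoparallel E φ D := by
  intro X Z hX hZ x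
  obtain ⟨k, L, _, _, _, j, hj, q, rfl⟩ := h.1 x
  have := hj.t2Space
  have hX' := hX.2 (j q)
  have hZ' := hZ.2 (j q)
  rw [← hj.tangent q] at hX' hZ'
  obtain ⟨w, hw⟩ := hX'
  obtain ⟨z, hz⟩ := hZ'
  obtain ⟨W, hW, hWw⟩ := exists_smooth_extension w
  obtain ⟨Y, hY, hYz⟩ := exists_smooth_extension z
  have hWq : W q = w := by rw [hWw.self_of_nhds, FiberBundle.extend_apply_self]
  have hYq : Y q = z := by rw [hYz.self_of_nhds, FiberBundle.extend_apply_self]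
  have h1 := secondForm_eq_zero_iff.1 (h.2 k L j hj W Y hW hY q)
  rw [hj.tangentOf_comp hφ, hWq] at h1
  rw [← Submodule.orthogonal_orthogonal (pushPerp E φ D (j q)), Submodule.mem_orthogonal]
  intro n hn
  have h2 := hj.inner_covAlong_comp hφ hD hY hZ (q := q)
    ((congrArg _ hYq).trans hz) w hn
  have hw' : mfderiv 𝓘(ℝ, EuclideanSpace ℝ (Fin k)) 𝓘(ℝ, F) j q w = X (j q) := hw
  rw [hw', hn _ h1] at h2
  rw [real_inner_comm]
  exact h2.symm

/-- The converse: the leaves exist by Frobenius' theorem, and are compared with sections of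
`D^⊥`. -/
theorem IsPerpAutoparallel.isTotallyRealRuled (hφ : IsSmoothImmersion E F φ)
    (hD : IsSmoothDistribution D) (h : IsPerpAutoparallel E φ D) : IsTotallyRealRuled E φ D := by
  have hDperp := IsSmoothDistribution.orthCompl (E := E) hφ hD
  have : CompleteSpace F := FiniteDimensional.complete ℝ F
  refine ⟨hDperp.exists_isIntegralManifold fun X Z hX hZ x => ?_, ?_⟩
  · -- the connection is torsion-free, so `D^⊥` is involutive
    have h1 := covAlong_pushField_sub (x := x) hφ.smooth (hX.1.mdifferentiable (by simp) x)
      (hZ.1.mdifferentiable (by simp) x)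
    have h2 := Submodule.sub_mem _ (h X Z hX hZ x) (h Z X hZ hX x)
    rw [h1] at h2
    obtain ⟨v, hv, hv'⟩ := Submodule.mem_map.1 h2
    rwa [← hφ.injective_mfderiv x hv']
  · intro k L _ _ _ j hj X Z hX hZ q
    have := hj.t2Space
    rw [secondForm_eq_zero_iff, hj.tangentOf_comp hφ]
    obtain ⟨X', hX', hXq⟩ := hDperp.exists_section (hj.mfderiv_mem (X q))
    obtain ⟨Z', hZ', hZq⟩ := hDperp.exists_section (hj.mfderiv_mem (Z q))
    rw [← Submodule.orthogonal_orthogonal (pushPerp E φ D (j q)), Submodule.mem_orthogonal]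
    intro n hn
    have h2 := hj.inner_covAlong_comp hφ hD hZ hZ' hZq.symm (X q) hn
    rw [← hXq, hn _ (h X' Z' hX' hZ' (j q))] at h2
    rw [real_inner_comm]
    exact h2

end Leaves

end CRLCK

end

end

theorem mainTheorem5
    {E : Type*} [NormedAddCommGroup E] [NormedSpace ℝ E] [FiniteDimensional ℝ E]
    {N : Type*} [TopologicalSpace N] [T2Space N] [SecondCountableTopology N]
    [ChartedSpace E N] [IsManifold 𝓘(ℝ, E) ∞ N]
    [RiemannianBundle (fun p : N => TangentSpace 𝓘(ℝ, E) p)]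
    [IsContMDiffRiemannianBundle 𝓘(ℝ, E) ∞ E (fun p : N => TangentSpace 𝓘(ℝ, E) p)]
    {F : Type*} [NormedAddCommGroup F] [NormedSpace ℝ F] [FiniteDimensional ℝ F]
    {M : Type*} [TopologicalSpace M] [T2Space M] [SecondCountableTopology M]
    [ChartedSpace F M] [IsManifold 𝓘(ℝ, F) ∞ M]
    (J : Π p : N, TangentSpace 𝓘(ℝ, E) p →L[ℝ] TangentSpace 𝓘(ℝ, E) p) (hJ : IsLCK J)
    (lee : Π p : N, TangentSpace 𝓘(ℝ, E) p →L[ℝ] ℝ) (hlee : IsLeeForm J lee)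
    (φ : M → N) (D : Π x : M, Submodule ℝ (TangentSpace 𝓘(ℝ, F) x))
    (hM : IsCRSubmanifold J φ D)
    (hB : ∀ x : M, leeVector lee (φ x) ∈ JPerp J φ D x) :
    List.TFAE [
      IsTotallyRealRuled E φ D,
      (∀ X Z : Π x : M, TangentSpace 𝓘(ℝ, F) x,
          IsSectionOf (orthCompl E φ D) X → IsSectionOf (orthCompl E φ D) Z →
          ∀ x, secondForm (E := E) φ X Z x = 0) ∧
        (∀ X Y : Π x : M, TangentSpace 𝓘(ℝ, F) x,
          IsSectionOf (orthCompl E φ D) X → IsSectionOf D Y →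
          ∀ x, secondForm φ X Y x ∈ mu J φ D x),
      (∀ X Z : Π x : M, TangentSpace 𝓘(ℝ, F) x,
          IsSectionOf (orthCompl E φ D) X → IsSectionOf (orthCompl E φ D) Z →
          ∀ x, normalConn φ X (JField J φ Z) x ∈ JPerp J φ D x) ∧
        (∀ X Y : Π x : M, TangentSpace 𝓘(ℝ, F) x,
          IsSectionOf (orthCompl E φ D) X → IsSmoothField Y →
          ∀ x, secondForm φ X Y x ∈ mu J φ D x),
      (∀ X Z : Π x : M, TangentSpace 𝓘(ℝ, F) x,
          IsSectionOf (orthCompl E φ D) X → IsSectionOf (orthCompl E φ D) Z →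
          ∀ x, shapeOperator φ (JField J φ Z) X x = 0) ∧
        (∀ (X : Π x : M, TangentSpace 𝓘(ℝ, F) x) (ξ : Π x : M, TangentSpace 𝓘(ℝ, E) (φ x)),
          IsSectionOf (orthCompl E φ D) X →
          IsSectionAlong (F := F) φ (mu J φ D) ξ →
          ∀ x, shapeOperator φ ξ X x ∈ push φ D x)] := by
  have hi := hM.immersion
  have hD := hM.distribution
  tfae_have 1 ↔ 2 :=
    Iff.trans ⟨fun h => h.isPerpAutoparallel hi hD, fun h => h.isTotallyRealRuled hi hD⟩
      (hM.isPerpAutoparallel_iff hJ hlee hB)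
  tfae_have 2 → 3 := fun h =>
    ⟨fun X Z hX hZ x => hM.normalConn_mem_of_secondForm hJ hlee hB hX hZ (h.1 X Z hX hZ x),
      fun X Y hX hY x => hM.secondForm_mem_mu_of_sections hJ h.1 h.2 hX hY⟩
  tfae_have 3 → 4 := fun h =>
    ⟨fun X Z hX hZ x => hM.shapeOperator_JField_eq_zero hJ h.2 hX hZ,
      fun X ξ hX hξ x => hM.shapeOperator_mem_push hJ hlee hB h.1 hX hξ⟩
  tfae_have 4 → 2 := fun h =>
    ⟨fun X Z hX hZ x => hM.secondForm_eq_zero_of_shapeOperator hJ h.1 h.2 hX hZ,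
      fun X Y hX hY x => hM.secondForm_mem_mu_iff.2 fun z hz =>
        hM.inner_covAlong_eq_zero_of_shapeOperator hJ h.1 hX hY.1 hz⟩
  tfae_finish
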